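/- **Setting.** Let $K$ be a non-Archimedean local field of arbitrary characteristic, with ring of integers $\mathcal O_K$, maximal ideal $\pi\mathcal O_K$, residue field $\mathbb F_q$ and normalized absolute value $|\cdot|$ (so $|\pi|=q^{-1}$), and let $dx$ be the Haar measure on $K^n$ with $\int_{\mathcal O_K^n}dx=1$. A bar denotes reduction modulo $\pi$. Let $n\ge 2$ and let $f,g\in\mathcal O_K[x_1,\dots,x_n]\setminus\pi\mathcal O_K[x_1,\dots,x_n]$ be non-constant; put $D_K=\{x\in K^n: f(x)g(x)=0\}$. For $h=\sum_m c_mx^m\ne0$ let $\Gamma(h)$ be its Newton polyhedron, the convex hull of $\bigcup_{c_m\neq 0}(m+\mathbb R_{\ge0}^n)$. For $a\in\mathbb R_{\ge0}^n$ and $\Gamma=\Gamma(h)$ put $d(a,\Gamma)=\min_{x\in\Gamma}\langle a,x\rangle$, $F(a,\Gamma)=\{x\in\Gamma:\langle a,x\rangle=d(a,\Gamma)\}$ and $h_a=\sum_{m\in F(a,\Gamma)}c_mx^m$; put $\sigma(a)=a_1+\dots+a_n$. Let $\mathfrak D$ be the set of primitive vectors in $\mathbb N^n\setminus\{0\}$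 perpendicular to a facet (face of codimension one) of $\Gamma(fg)$. Assume that $f/g$ is non-degenerate over $\mathbb F_q$ with respect to $\Gamma(fg)$: writing $(h_1,h_2)=(f,g)$, for every $k\in\mathbb R_{\ge0}^n$, every non-empty $I\subseteq\{1,2\}$ and every $z\in(\mathbb F_q^\times)^n$ such that $\overline{h_{i,k}}(z)=0\Leftrightarrow i\in I$, the matrix $\big[\partial\overline{h_{i,k}}/\partial x_j(z)\big]_{i\in I,\,1\le j\le n}$ has rank $|I|$. Fix a simplicial polyhedral subdivision $\mathcal F$ of $\mathbb R_{\ge0}^n$ subordinate to $\Gamma(fg)$, that is, a partition of $\mathbb R_{\ge0}^n\setminus\{0\}$ into finitely many cones $\Delta=\{\sum_{i=1}^l\lambda_iw_i:\lambda_i>0\}$, each with linearly independent generators $w_1,\dots,w_l\in\mathfrak D$ and such that for some proper face $\tau$ of $\Gamma(fg)$ one has $F(a,\Gamma(fg))=\tau$ for all $a\in\Delta$. Put $b(\Delta)=\sum_iw_i$ and $b(\{0\})=0$. For $\Delta\in\mathcal F\cup\{\{0\}\}$ let $N_{\Delta,\{f\}}$, $N_{\Delta,\{g\}}$, $N_{\Delta,\{f,g\}}$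 be the numbers of $z\in(\mathbb F_q^\times)^n$ at which, among $\overline{f_{b(\Delta)}}$ and $\overline{g_{b(\Delta)}}$, respectively only the first, only the second, or both vanish. Let $Z(s_1,s_2,f,g)$ be the meromorphic continuation to $\mathbb C^2$ of $\int_{\mathcal O_K^n\setminus D_K}|f(x)|^{s_1}|g(x)|^{s_2}\,dx$ $(\operatorname{Re}s_1,\operatorname{Re}s_2>0)$, and put $Z(s,f/g)=Z(s,-s,f,g)$. Let $e(a)=d(a,\Gamma(g))-d(a,\Gamma(f))$, let $\alpha$ be the minimum of $\sigma(w)/e(w)$ over the $w\in\mathfrak D$ with $e(w)>0$ ($+\infty$ if there are none), let $\beta$ be the maximum of $\sigma(w)/e(w)$ over the $w\in\mathfrak D$ with $e(w)<0$ ($-\infty$ if there are none), and let $\widetilde\alpha=\min\{1,\alpha\}$, $\widetilde\beta=\max\{-1,\beta\}$. **Theorem.** The continuation exists and can be restricted to the line $s_2=-s_1$, so that $Z(s,f/g)$ is a meromorphic function on $\mathbb C$, and: (i) $Z(s,f/g)$ is a rational function of $q^{-s}$, and $$Z(s,f/g)=\sum_{\Delta\in\mathcal F\cup\{\{0\}\}}L_\Delta(s)S_\Delta(s),$$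 where $$L_\Delta(s)=q^{-n}\Big[(q-1)^n-N_{\Delta,\{f\}}\tfrac{1-q^{-s}}{1-q^{-1-s}}-N_{\Delta,\{g\}}\tfrac{1-q^{s}}{1-q^{-1+s}}-N_{\Delta,\{f,g\}}\tfrac{(1-q^{-s})(1-q^{s})}{q(1-q^{-1-s})(1-q^{-1+s})}\Big],$$ $S_{\{0\}}(s)=1$ and, for $\Delta\in\mathcal F$ with generators $w_1,\dots,w_l$, $$S_\Delta(s)=\frac{\sum_tq^{-\sigma(t)+e(t)s}}{\prod_{i=1}^l\big(1-q^{-\sigma(w_i)+e(w_i)s}\big)},$$ with $t$ running through $\mathbb Z^n\cap\{\sum_i\lambda_iw_i:0<\lambda_i\le1\}$. (ii) $Z(s,f/g)$ is holomorphic on the band $\widetilde\beta<\operatorname{Re}(s)<\widetilde\alpha$, and on this band it equals the absolutely convergent integral $\int_{\mathcal O_K^n\setminus D_K}|f(x)/g(x)|^s\,dx$. (iii) Every pole of $Z(s,f/g)$ is of the form $1+\frac{2\pi\sqrt{-1}\,k}{\ln q}$, $-1+\frac{2\pi\sqrt{-1}\,k}{\ln q}$, or $\frac{\sigma(w)}{e(w)}+\frac{2\pi\sqrt{-1}\,k}{e(w)\ln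 q}$, with $k\in\mathbb Z$ and $w\in\mathfrak D$ with $e(w)\neq0$. -/

import Mathlib

open MeasureTheory Set

noncomputable section

namespace NewtonZeta

/-! ### Newton polyhedra in `ℝⁿ` -/

/-- The Newton polyhedron at the origin of a polynomial: the convex hull of the union of the sets
`m + ℝ₊ⁿ`, where `m` runs through the exponents of the monomials occurring in `h`. -/
def newtonPolyhedron {n : ℕ} {R : Type*} [CommRing R] (h : MvPolynomial (Fin n) R) :
    Set (Fin n → ℝ) :=
  convexHull ℝ (⋃ m ∈ h.support, {x : Fin n → ℝ | ∀ j, (m j : ℝ) ≤ x j})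

/-- `d(a, Γ) = min_{x ∈ Γ} ⟨a, x⟩`. For `a` with non-negative coordinates and `Γ` the Newton
polyhedron of a non-zero polynomial the infimum is a minimum. -/
def dist {n : ℕ} (a : Fin n → ℝ) (Γ : Set (Fin n → ℝ)) : ℝ :=
  sInf ((fun x : Fin n → ℝ => ∑ j, a j * x j) '' Γ)

/-- The first meet locus `F(a, Γ)`. -/
def firstMeet {n : ℕ} (a : Fin n → ℝ) (Γ : Set (Fin n → ℝ)) : Set (Fin n → ℝ) :=
  {x | x ∈ Γ ∧ ∑ j, a j * x j = dist a Γ}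

/-- A proper face: a non-empty intersection of `Γ` with a supporting hyperplane. (Replacing the
normal vector `b` by `-b`, one may always take `Γ` to lie in the half-space `⟨b, x⟩ ≥ c`.) -/
def IsProperFace {n : ℕ} (Γ τ : Set (Fin n → ℝ)) : Prop :=
  ∃ (b : Fin n → ℝ) (c : ℝ), b ≠ 0 ∧ (∀ x ∈ Γ, c ≤ ∑ j, b j * x j) ∧
    τ = {x | x ∈ Γ ∧ ∑ j, b j * x j = c} ∧ τ.Nonempty

/-- A facet: a face whose affine hull has codimension one in `ℝⁿ`. -/
def IsFacet {n : ℕ} (Γ τ : Set (Fin n → ℝ)) : Prop :=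
  IsProperFace Γ τ ∧ Module.finrank ℝ (vectorSpan ℝ τ) + 1 = n

/-- A vector of natural numbers as a real vector. -/
def toReal {n : ℕ} (w : Fin n → ℕ) : Fin n → ℝ := fun j => (w j : ℝ)

/-- `𝔇(Γ)`: the primitive vectors in `ℕⁿ ∖ {0}` perpendicular to a facet of `Γ`. -/
def facetNormals {n : ℕ} (Γ : Set (Fin n → ℝ)) : Set (Fin n → ℕ) :=
  {w | w ≠ 0 ∧ Finset.univ.gcd w = 1 ∧ ∃ τ, IsFacet Γ τ ∧
    ∀ x ∈ τ, ∀ y ∈ τ, ∑ j, toReal w j * (x j - y j) = 0}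

/-- `σ(w) = w₁ + ⋯ + wₙ`. -/
def sigma {n : ℕ} (w : Fin n → ℕ) : ℕ := ∑ j, w j

/-- The face function `h_a` of `h`: the sum of the monomials of `h` with exponent in
`F(a, Γ(h))`. -/
def faceFun {n : ℕ} {R : Type*} [CommRing R] (h : MvPolynomial (Fin n) R) (a : Fin n → ℝ) :
    MvPolynomial (Fin n) R :=
  open scoped Classical in
  ∑ m ∈ h.support.filter (fun m => (fun j => (m j : ℝ)) ∈ firstMeet a (newtonPolyhedron h)),
    MvPolynomial.monomial m (h.coeff m)

/-! ### Simplicial subdivisions -/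

/-- The cone strictly spanned by a finite set of vectors; it is `{0}` for the empty set. -/
def openCone {n : ℕ} (W : Finset (Fin n → ℕ)) : Set (Fin n → ℝ) :=
  {x | ∃ c : (Fin n → ℕ) → ℝ, (∀ w ∈ W, 0 < c w) ∧ x = ∑ w ∈ W, c w • toReal w}

/-- The barycenter of the cone strictly spanned by `W`; it is `0` for the empty set. -/
def barycenter {n : ℕ} (W : Finset (Fin n → ℕ)) : Fin n → ℝ := ∑ w ∈ W, toReal w

/-- The class `Δ_τ` of all `a ∈ ℝ₊ⁿ` with first meet locus `τ`. -/
def faceCone {n : ℕ} (Γ τ : Set (Fin n → ℝ)) : Set (Fin n → ℝ) :=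
  {a | (∀ j, 0 ≤ a j) ∧ firstMeet a Γ = τ}

/-- A simplicial polyhedral subdivision of `ℝ₊ⁿ` subordinate to `Γ`: a partition of `ℝ₊ⁿ ∖ {0}`
into finitely many cones, each strictly spanned by linearly independent elements of `𝔇(Γ)` and
contained in a single class `Δ_τ`. Every cone is recorded by its set of generators. -/
structure SimplicialSubdivision {n : ℕ} (Γ : Set (Fin n → ℝ)) where
  cones : Finset (Finset (Fin n → ℕ))
  generators_mem : ∀ W ∈ cones, ∀ w ∈ W, w ∈ facetNormals Γ
  linearIndependent : ∀ W ∈ cones, LinearIndependent ℝ (fun w : W => toReal (w : Fin n → ℕ))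
  subordinate : ∀ W ∈ cones, ∃ τ, IsProperFace Γ τ ∧ openCone W ⊆ faceCone Γ τ
  disjoint : ∀ W ∈ cones, ∀ W' ∈ cones, W ≠ W' → Disjoint (openCone W) (openCone W')
  cover : ⋃ W ∈ cones, openCone W = {x : Fin n → ℝ | (∀ j, 0 ≤ x j) ∧ x ≠ 0}

/-- The set `ℤⁿ ∩ {∑ λ_w w ; 0 < λ_w ≤ 1}`. -/
def fundamentalPoints {n : ℕ} (W : Finset (Fin n → ℕ)) : Set (Fin n → ℤ) :=
  {t | ∃ c : (Fin n → ℕ) → ℝ, (∀ w ∈ W, 0 < c w ∧ c w ≤ 1) ∧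
    (fun j => (t j : ℝ)) = ∑ w ∈ W, c w • toReal w}

theorem fundamentalPoints_finite {n : ℕ} (W : Finset (Fin n → ℕ)) :
    (fundamentalPoints W).Finite := by
  refine (Set.finite_Icc (0 : Fin n → ℤ) (fun j => ∑ w ∈ W, (w j : ℤ))).subset ?_
  rintro t ⟨c, hc, ht⟩
  have key : ∀ j, (t j : ℝ) = ∑ w ∈ W, c w * (w j : ℝ) := fun j => by
    have := congrFun ht j
    simpa [toReal, Finset.sum_apply] using this
  refine ⟨fun j => ?_, fun j => ?_⟩
  · have h : (0 : ℝ) ≤ (t j : ℝ) := by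
      rw [key j]
      exact Finset.sum_nonneg fun w hw => mul_nonneg (hc w hw).1.le (Nat.cast_nonneg _)
    exact_mod_cast h
  · have h : (t j : ℝ) ≤ ∑ w ∈ W, (w j : ℝ) := by
      rw [key j]
      refine Finset.sum_le_sum fun w hw => ?_
      exact mul_le_of_le_one_left (Nat.cast_nonneg _) (hc w hw).2
    exact_mod_cast h

/-! ### Non-degeneracy and local zeta functions over a local field -/

section LocalField

variable {K : Type*} [NontriviallyNormedField K] [IsUltrametricDist K]

open scoped NormedField in
/-- The ring of integers of `K`, that is, the closed unit ball. -/
abbrev RingInt (K : Type*) [NontriviallyNormedField K] [IsUltrametricDist K] : Subring K :=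
  Valued.integer K

/-- The residue field of `K`. -/
abbrev ResField (K : Type*) [NontriviallyNormedField K] [IsUltrametricDist K] : Type _ :=
  IsLocalRing.ResidueField (RingInt K)

/-- The cardinality `q` of the residue field of `K`. -/
def resCard (K : Type*) [NontriviallyNormedField K] [IsUltrametricDist K] : ℕ := Nat.card (ResField K)

/-- Reduction of the coefficients of a polynomial modulo the maximal ideal of the ring of integers. -/
def reduction {n : ℕ} (h : MvPolynomial (Fin n) (RingInt K)) : MvPolynomial (Fin n) (ResField K) :=
  MvPolynomial.map (IsLocalRing.residue (RingInt K)) h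

/-- Non-degeneracy over the residue field of a polynomial mapping `h = (h₁, …, h_r)` with respect
to its Newton polyhedron: for all `k ∈ ℝ₊ⁿ` and all non-empty `I`, the Jacobian matrix of the
reduced face functions `(h_{i,k})_{i ∈ I}` has rank `|I|` at every point of the torus over the
residue field at which exactly the reduced face functions with index in `I` vanish. -/
def NonDegenerate {n r : ℕ} (h : Fin r → MvPolynomial (Fin n) (RingInt K)) : Prop :=
  ∀ k : Fin n → ℝ, (∀ j, 0 ≤ k j) → ∀ I : Finset (Fin r), I.Nonempty →
    ∀ z : Fin n → ResField K, (∀ j, z j ≠ 0) →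
      (∀ i, MvPolynomial.eval z (reduction (faceFun (h i) k)) = 0 ↔ i ∈ I) →
      (Matrix.of fun (i : I) (j : Fin n) =>
        MvPolynomial.eval z
          (MvPolynomial.pderiv j (reduction (faceFun (h (i : Fin r)) k)))).rank = I.card

/-- The set `𝒪ⁿ ∖ D`, where `D ⊆ Kⁿ` is the union of the zero sets of the `hᵢ`. -/
def zetaDomain {n r : ℕ} (h : Fin r → MvPolynomial (Fin n) (RingInt K)) : Set (Fin n → K) :=
  {x | (∀ j, ‖x j‖ ≤ 1) ∧ ∀ i, MvPolynomial.aeval x (h i) ≠ 0}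

/-- The integral `Z(s, h) = ∫_{𝒪ⁿ ∖ D} ∏ᵢ |hᵢ(x)|^{sᵢ} dx`, which converges if `Re sᵢ > 0` for
all `i`. -/
def zetaIntegral {n r : ℕ} [MeasurableSpace K] (μ : Measure (Fin n → K))
    (h : Fin r → MvPolynomial (Fin n) (RingInt K)) (s : Fin r → ℂ) : ℂ :=
  ∫ x in zetaDomain h, ∏ i, ((‖MvPolynomial.aeval x (h i)‖ : ℝ) : ℂ) ^ s i ∂μ

/-- `Z` is the local zeta function `s ↦ Z(s, -s, f, g)` of `f / g`, where `Z(s₁, s₂, f, g)` is the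
meromorphic continuation to `ℂ²` of the zeta integral on `Re s₁ > 0`, `Re s₂ > 0`.
The continuation is written as a quotient `A / B` of entire functions on `ℂ²` whose denominator
does not vanish identically on the line `s₂ = -s₁`, so that it can be restricted to that line. By
the identity theorem the restriction does not depend on the choice of `A` and `B`. A meromorphic
function on `ℂ` is taken in normal form: it has its limit as value wherever it has a removable
singularity, and the value `0` at its poles. So there is at most one such function `Z`. -/
def IsQuotientZeta {n : ℕ} [MeasurableSpace K] (μ : Measure (Fin n → K))
    (f g : MvPolynomial (Fin n) (RingInt K)) (Z : ℂ → ℂ) : Prop :=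
  MeromorphicNFOn Z univ ∧
  ∃ A B : (Fin 2 → ℂ) → ℂ, AnalyticOnNhd ℂ A univ ∧ AnalyticOnNhd ℂ B univ ∧
    (∀ s : Fin 2 → ℂ, (∀ i, 0 < (s i).re) → B s * zetaIntegral μ ![f, g] s = A s) ∧
    (∃ s : ℂ, B ![s, -s] ≠ 0) ∧
    ∀ s : ℂ, B ![s, -s] ≠ 0 → Z s = A ![s, -s] / B ![s, -s]

/-! ### The data attached to `f / g` -/

/-- `N_{Δ,{f}}`: the number of points of the torus over the residue field at which the reduction
of `f_{b(Δ)}` vanishes and that of `g_{b(Δ)}` does not. Note `N_{Δ,{g}}` is `countOne g f W`. -/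
def countOne {n : ℕ} (f g : MvPolynomial (Fin n) (RingInt K)) (W : Finset (Fin n → ℕ)) : ℕ :=
  Nat.card {z : Fin n → ResField K // (∀ j, z j ≠ 0) ∧
    MvPolynomial.eval z (reduction (faceFun f (barycenter W))) = 0 ∧
    MvPolynomial.eval z (reduction (faceFun g (barycenter W))) ≠ 0}

/-- `N_{Δ,{f,g}}`: the number of points of the torus over the residue field at which the
reductions of `f_{b(Δ)}` and `g_{b(Δ)}` both vanish. -/
def countBoth {n : ℕ} (f g : MvPolynomial (Fin n) (RingInt K)) (W : Finset (Fin n → ℕ)) : ℕ :=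
  Nat.card {z : Fin n → ResField K // (∀ j, z j ≠ 0) ∧
    MvPolynomial.eval z (reduction (faceFun f (barycenter W))) = 0 ∧
    MvPolynomial.eval z (reduction (faceFun g (barycenter W))) = 0}

/-- `L_Δ(s, f/g)`, for `Δ` the cone strictly spanned by `W` (and `Δ = {0}` for `W = ∅`). -/
def LFactor {n : ℕ} (f g : MvPolynomial (Fin n) (RingInt K)) (W : Finset (Fin n → ℕ)) (s : ℂ) : ℂ :=
  (resCard K : ℂ) ^ (-(n : ℂ)) *
    (((resCard K : ℂ) - 1) ^ n
      - (countOne f g W : ℂ) *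
          ((1 - (resCard K : ℂ) ^ (-s)) / (1 - (resCard K : ℂ) ^ (-1 - s)))
      - (countOne g f W : ℂ) *
          ((1 - (resCard K : ℂ) ^ s) / (1 - (resCard K : ℂ) ^ (-1 + s)))
      - (countBoth f g W : ℂ) *
          (((1 - (resCard K : ℂ) ^ (-s)) * (1 - (resCard K : ℂ) ^ s)) /
            ((resCard K : ℂ) * (1 - (resCard K : ℂ) ^ (-1 - s)) *
              (1 - (resCard K : ℂ) ^ (-1 + s)))))

/-- `d(a, Γ(g)) - d(a, Γ(f))`. -/
def distDiff {n : ℕ} (f g : MvPolynomial (Fin n) (RingInt K)) (a : Fin n → ℝ) : ℝ :=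
  dist a (newtonPolyhedron g) - dist a (newtonPolyhedron f)

/-- The factor `1 - q^{-σ(w) - (d(w, Γ(f)) - d(w, Γ(g))) s}`. -/
def denomFactor {n : ℕ} (f g : MvPolynomial (Fin n) (RingInt K)) (w : Fin n → ℕ) (s : ℂ) : ℂ :=
  1 - (resCard K : ℂ) ^ (-(sigma w : ℂ) + (distDiff f g (toReal w) : ℂ) * s)

/-- `S_Δ(s)`, for `Δ` the cone strictly spanned by `W`. -/
def SFactor {n : ℕ} (f g : MvPolynomial (Fin n) (RingInt K)) (W : Finset (Fin n → ℕ)) (s : ℂ) : ℂ :=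
  (∑ t ∈ (fundamentalPoints_finite W).toFinset,
    (resCard K : ℂ) ^ (-((∑ j, t j : ℤ) : ℂ) + (distDiff f g (fun j => (t j : ℝ)) : ℂ) * s)) /
    ∏ w ∈ W, denomFactor f g w s

/-- The number `σ(w) / (d(w, Γ(g)) - d(w, Γ(f)))`. -/
def slope {n : ℕ} (f g : MvPolynomial (Fin n) (RingInt K)) (w : Fin n → ℕ) : ℝ :=
  (sigma w : ℝ) / distDiff f g (toReal w)

/-- `α(f/g)`: the minimum of the slopes over `T₊`, and `+∞` if `T₊` is empty. -/
def alpha {n : ℕ} (f g : MvPolynomial (Fin n) (RingInt K)) : EReal :=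
  ⨅ w ∈ {w | w ∈ facetNormals (newtonPolyhedron (f * g)) ∧ 0 < distDiff f g (toReal w)},
    ((slope f g w : ℝ) : EReal)

/-- `β(f/g)`: the maximum of the slopes over `T₋`, and `-∞` if `T₋` is empty. -/
def beta {n : ℕ} (f g : MvPolynomial (Fin n) (RingInt K)) : EReal :=
  ⨆ w ∈ {w | w ∈ facetNormals (newtonPolyhedron (f * g)) ∧ distDiff f g (toReal w) < 0},
    ((slope f g w : ℝ) : EReal)

/-- The open band `max(-1, β) < Re s < min(1, α)`. -/
def band {n : ℕ} (f g : MvPolynomial (Fin n) (RingInt K)) : Set ℂ :=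
  {s | max (-1) (beta f g) < ((s.re : ℝ) : EReal) ∧ ((s.re : ℝ) : EReal) < min 1 (alpha f g)}

/-- The set of candidate poles. Vectors `w` with `d(w, Γ(g)) = d(w, Γ(f))` contribute none. -/
def candidatePoles {n : ℕ} (f g : MvPolynomial (Fin n) (RingInt K)) : Set ℂ :=
  {s | ∃ k : ℤ, s = 1 + 2 * Real.pi * Complex.I * k / Real.log (resCard K)} ∪
  {s | ∃ k : ℤ, s = -1 + 2 * Real.pi * Complex.I * k / Real.log (resCard K)} ∪
  {s | ∃ w ∈ facetNormals (newtonPolyhedron (f * g)), distDiff f g (toReal w) ≠ 0 ∧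
    ∃ k : ℤ, s = (slope f g w : ℂ) +
      2 * Real.pi * Complex.I * k / ((distDiff f g (toReal w) : ℂ) * Real.log (resCard K))}

end LocalField

end NewtonZeta

end

noncomputable section

/-! ### The discrete valuation: uniformizer and residue field. -/

namespace NewtonZeta

variable {K : Type*} [NontriviallyNormedField K] [IsUltrametricDist K]

/-! Off the coordinate hyperplanes, a null set, the domain of integration splits into cells
according to three data: the orders k of the coordinates, their leading digits z, and the orders a
of the rescaled polynomials. The substitution x_j = ϖ^{k_j} u_j turns h_i into ϖ^{d(k, Γ(h_i))}
F_i(u), where F_i has the same reduction as the face function of h_i in direction k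
(`exists_isRescaling`). The integrand is constant on each cell, so only volumes are needed.

Non-degeneracy supplies the volumes. On the residue class of z, the F_i with non-zero reduction have
norm 1; the others have independent differentials modulo ϖ, and after an isometry of the class they
form an affine map with surjective integral linear part (`isBoxInvariant_map_of_rank`). Their values
are therefore jointly equidistributed in the maximal ideal, and the volume is a product of
one-variable weights (`haar_real_levelSet`). Only a Taylor estimate and a count of balls enter, so
the characteristic plays no role.

Summing geometric series over a and a finite sum over z leaves q^{-σ(k) - ∑ d(k, Γ(h_i)) s_i} times
a factor that depends on k only through the face functions. On a cone of the subdivision d(·, Γ(fg))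
= d(·, Γ(f)) + d(·, Γ(g)) is linear; both summands are concave, hence linear as well, and the face
functions are constant (`pairing_eq_dist_of_mem_openCone`). A lattice point of a simplicial cone is
uniquely a fundamental point plus a natural combination of generators, so each cone contributes a
product of geometric series (`hasSum_cone`).

Everything converges absolutely once Re s_i > -1 and the terms at the generators have modulus less
than 1. This holds for Re s_i > 0, and also on the line s₂ = -s₁ over the band. One identity,
denominator times integral equals numerator (`zetaDen_mul_integral`), thus yields both the
continuation and the integral on the band; both sides of the fraction are entire Laurent polynomials
in q^{-s} on the line, and poles can only come from zeros of the denominator. -/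

/-- The arithmetic of the norm of a local field with uniformizer `ϖ`. -/
structure IsUniformizer (ϖ : RingInt K) : Prop where
  norm_eq : ‖(ϖ : K)‖ = (resCard K : ℝ)⁻¹
  exists_norm_eq : ∀ x : K, x ≠ 0 → ‖x‖ ≤ 1 → ∃ k : ℕ, ‖x‖ = (resCard K : ℝ)⁻¹ ^ k
  finite : Finite (ResField K)

theorem mem_ringInt {x : K} : x ∈ RingInt K ↔ ‖x‖ ≤ 1 := Valued.integer.mem_iff

theorem norm_ringInt_le (x : RingInt K) : ‖(x : K)‖ ≤ 1 := Valued.integer.norm_le_one x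

theorem residue_eq_zero_iff {x : RingInt K} :
    IsLocalRing.residue (RingInt K) x = 0 ↔ ‖(x : K)‖ < 1 := by
  rw [IsLocalRing.residue_eq_zero_iff, IsLocalRing.mem_maximalIdeal, mem_nonunits_iff,
    Valued.integer.isUnit_iff_norm_eq_one]
  have := norm_ringInt_le x
  constructor
  · exact fun h => lt_of_le_of_ne this h
  · exact fun h => ne_of_lt h

open scoped NormedField in
-- Local compactness makes the unit ball compact, and a compact valuation ring is a discrete
-- valuation ring with finite residue field. Every non-zero integer is then a unit times a power of
-- an irreducible element, whose norm `hnorm` prescribes.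
theorem exists_isUniformizer [LocallyCompactSpace K]
    (hnorm : ∀ ϖ : RingInt K, Irreducible ϖ → ‖(ϖ : K)‖ = (resCard K : ℝ)⁻¹) :
    ∃ ϖ : RingInt K, IsUniformizer ϖ := by
  have : ProperSpace K := ProperSpace.of_locallyCompactSpace K
  have hR : (Valued.v : Valuation K NNReal).RankOne :=
    inferInstanceAs (Valuation.RankOne (NormedField.valuation (K := K)))
  have hc : CompactSpace (RingInt K) := by
    have : ((RingInt K : Subring K) : Set K) = Metric.closedBall 0 1 := by
      ext x
      simp [mem_ringInt]
    exact isCompact_iff_compactSpace.1 (this ▸ isCompact_closedBall (0 : K) 1)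
  obtain ⟨-, hD, hfin⟩ :=
    (Valued.integer.compactSpace_iff_completeSpace_and_isDiscreteValuationRing_and_finite_residueField).1 hc
  obtain ⟨ϖ, hϖ⟩ := IsDiscreteValuationRing.exists_irreducible (RingInt K)
  refine ⟨ϖ, hnorm ϖ hϖ, fun x hx hx1 => ?_, hfin⟩
  have hx' : (⟨x, mem_ringInt.2 hx1⟩ : RingInt K) ≠ 0 := fun h => hx (congrArg Subtype.val h)
  obtain ⟨k, u, hu⟩ := IsDiscreteValuationRing.eq_unit_mul_pow_irreducible hx' hϖ
  refine ⟨k, ?_⟩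
  have := congrArg (fun y : RingInt K => ‖(y : K)‖) hu
  simpa [hnorm ϖ hϖ] using this

namespace IsUniformizer

variable {ϖ : RingInt K}

theorem one_lt (hϖ : IsUniformizer ϖ) : 1 < resCard K := by
  have := hϖ.finite
  exact Finite.one_lt_card

theorem inv_lt_one (hϖ : IsUniformizer ϖ) : (resCard K : ℝ)⁻¹ < 1 :=
  inv_lt_one_of_one_lt₀ (by exact_mod_cast hϖ.one_lt)

theorem inv_pos (hϖ : IsUniformizer ϖ) : 0 < (resCard K : ℝ)⁻¹ := by
  have := hϖ.one_lt
  positivity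

theorem ne_zero (hϖ : IsUniformizer ϖ) : (ϖ : K) ≠ 0 := by
  rw [← norm_pos_iff, hϖ.norm_eq]
  exact hϖ.inv_pos

theorem norm_lt_one_iff (hϖ : IsUniformizer ϖ) {x : K} : ‖x‖ < 1 ↔ ‖x‖ ≤ (resCard K : ℝ)⁻¹ := by
  constructor
  · intro h
    rcases eq_or_ne x 0 with rfl | hx
    · simp
    obtain ⟨k, hk⟩ := hϖ.exists_norm_eq x hx h.le
    rw [hk] at h ⊢
    have : k ≠ 0 := by
      rintro rfl
      simp at h
    exact pow_le_of_le_one hϖ.inv_pos.le hϖ.inv_lt_one.le this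
  · exact fun h => h.trans_lt hϖ.inv_lt_one

theorem pow_inj (hϖ : IsUniformizer ϖ) {k l : ℕ} (h : (resCard K : ℝ)⁻¹ ^ k = (resCard K : ℝ)⁻¹ ^ l) : k = l :=
  pow_right_injective₀ hϖ.inv_pos hϖ.inv_lt_one.ne h

theorem norm_le_pow_succ_iff (hϖ : IsUniformizer ϖ) {x : K} {a : ℕ} :
    ‖x‖ ≤ (resCard K : ℝ)⁻¹ ^ (a + 1) ↔ ‖x‖ < (resCard K : ℝ)⁻¹ ^ a := by
  have h0 : 0 < (resCard K : ℝ)⁻¹ ^ a := pow_pos hϖ.inv_pos a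
  have h : ‖x / (ϖ : K) ^ a‖ = ‖x‖ / (resCard K : ℝ)⁻¹ ^ a := by
    rw [norm_div, norm_pow, hϖ.norm_eq]
  have := hϖ.norm_lt_one_iff (x := x / (ϖ : K) ^ a)
  rw [h, div_lt_one h0, div_le_iff₀ h0] at this
  rw [this, pow_succ']

end IsUniformizer

end NewtonZeta

/-! ### Support functions and face functions of Newton polyhedra. -/

namespace NewtonZeta

/-- The pairing `⟨a, m⟩` of a real vector with an exponent. -/
def pairing {n : ℕ} (a : Fin n → ℝ) (m : Fin n →₀ ℕ) : ℝ := ∑ j, a j * (m j : ℝ)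

theorem pairing_add {n : ℕ} (a b : Fin n → ℝ) (m : Fin n →₀ ℕ) :
    pairing (a + b) m = pairing a m + pairing b m := by
  simp [pairing, add_mul, Finset.sum_add_distrib]

theorem pairing_smul {n : ℕ} (c : ℝ) (a : Fin n → ℝ) (m : Fin n →₀ ℕ) :
    pairing (c • a) m = c * pairing a m := by
  simp [pairing, mul_assoc, Finset.mul_sum]

theorem pairing_add_right {n : ℕ} (a : Fin n → ℝ) (m m' : Fin n →₀ ℕ) :
    pairing a (m + m') = pairing a m + pairing a m' := by
  simp [pairing, mul_add, Finset.sum_add_distrib]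

section Polyhedron

variable {n : ℕ} {R : Type*} [CommRing R]

theorem coe_mem_newtonPolyhedron {h : MvPolynomial (Fin n) R} {m : Fin n →₀ ℕ}
    (hm : m ∈ h.support) : (fun j => (m j : ℝ)) ∈ newtonPolyhedron h := by
  refine subset_convexHull ℝ _ ?_
  simp only [mem_iUnion]
  exact ⟨m, hm, fun j => le_rfl⟩

/-- A half-space with non-negative normal that contains an exponent contains its translated orthant,
and half-spaces are convex. This reduces the infimum over the polyhedron to a minimum over the
finite support. -/
theorem le_of_mem_newtonPolyhedron {h : MvPolynomial (Fin n) R} {a : Fin n → ℝ}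
    (ha : ∀ j, 0 ≤ a j) {c : ℝ} (hc : ∀ m ∈ h.support, c ≤ pairing a m) {x : Fin n → ℝ}
    (hx : x ∈ newtonPolyhedron h) : c ≤ ∑ j, a j * x j := by
  have hconv : Convex ℝ {x : Fin n → ℝ | c ≤ ∑ j, a j * x j} := by
    refine convex_halfSpace_ge ⟨fun x y => ?_, fun r x => ?_⟩ c
    · simp [mul_add, Finset.sum_add_distrib]
    · simp only [Pi.smul_apply, smul_eq_mul, Finset.mul_sum]
      exact Finset.sum_congr rfl fun j _ => by ring
  refine (convexHull_min ?_ hconv) hx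
  intro y hy
  simp only [mem_iUnion] at hy
  obtain ⟨m, hm, hy⟩ := hy
  exact (hc m hm).trans (Finset.sum_le_sum fun j _ => mul_le_mul_of_nonneg_left (hy j) (ha j))

theorem dist_eq_of_forall_le {h : MvPolynomial (Fin n) R} {a : Fin n → ℝ}
    (ha : ∀ j, 0 ≤ a j) {m : Fin n →₀ ℕ} (hm : m ∈ h.support)
    (hmin : ∀ m' ∈ h.support, pairing a m ≤ pairing a m') :
    dist a (newtonPolyhedron h) = pairing a m := by
  refine IsLeast.csInf_eq ⟨⟨_, coe_mem_newtonPolyhedron hm, rfl⟩, ?_⟩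
  rintro _ ⟨x, hx, rfl⟩
  exact le_of_mem_newtonPolyhedron ha hmin hx

theorem exists_dist_eq {h : MvPolynomial (Fin n) R} (hh : h ≠ 0) {a : Fin n → ℝ}
    (ha : ∀ j, 0 ≤ a j) : ∃ m ∈ h.support, dist a (newtonPolyhedron h) = pairing a m := by
  obtain ⟨m, hm, hmin⟩ := Finset.exists_min_image h.support (pairing a)
    (MvPolynomial.support_nonempty.2 hh)
  exact ⟨m, hm, dist_eq_of_forall_le ha hm hmin⟩

theorem dist_le {h : MvPolynomial (Fin n) R} {a : Fin n → ℝ}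
    (ha : ∀ j, 0 ≤ a j) {m : Fin n →₀ ℕ} (hm : m ∈ h.support) :
    dist a (newtonPolyhedron h) ≤ pairing a m := by
  obtain ⟨m', hm', hmin⟩ := Finset.exists_min_image h.support (pairing a) ⟨m, hm⟩
  rw [dist_eq_of_forall_le ha hm' hmin]
  exact hmin m hm

theorem coeff_faceFun (h : MvPolynomial (Fin n) R) (a : Fin n → ℝ) (m : Fin n →₀ ℕ)
    [Decidable (pairing a m = dist a (newtonPolyhedron h))] :
    (faceFun h a).coeff m =
      if pairing a m = dist a (newtonPolyhedron h) then h.coeff m else 0 := by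
  classical
  simp only [faceFun, MvPolynomial.coeff_sum, MvPolynomial.coeff_monomial]
  rw [Finset.sum_ite_eq' _ m]
  simp only [Finset.mem_filter, firstMeet, mem_ofPred_eq]
  by_cases hm : m ∈ h.support
  · simp only [hm, coe_mem_newtonPolyhedron hm, true_and]
    exact if_congr Iff.rfl rfl rfl
  · simp [hm, MvPolynomial.notMem_support_iff.1 hm]

theorem faceFun_ne_zero {h : MvPolynomial (Fin n) R} (hh : h ≠ 0) {a : Fin n → ℝ}
    (ha : ∀ j, 0 ≤ a j) : faceFun h a ≠ 0 := by
  classical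
  obtain ⟨m, hm, hd⟩ := exists_dist_eq hh ha
  intro h0
  have := coeff_faceFun h a m
  rw [h0, if_pos hd.symm] at this
  exact MvPolynomial.mem_support_iff.1 hm this.symm

/-- No cancellation occurs in lowest weight: the product of the face functions is non-zero over a
domain, and any exponent `m` of it has weight exactly the sum of the two minima. In that weight only
minimal terms of both factors contribute, so `f * g` has the same coefficient at `m`. -/
theorem dist_mul [IsDomain R] {f g : MvPolynomial (Fin n) R} (hf : f ≠ 0) (hg : g ≠ 0)
    {a : Fin n → ℝ} (ha : ∀ j, 0 ≤ a j) :
    dist a (newtonPolyhedron (f * g)) =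
      dist a (newtonPolyhedron f) + dist a (newtonPolyhedron g) := by
  classical
  obtain ⟨m, hm⟩ := MvPolynomial.support_nonempty.2
    (mul_ne_zero (faceFun_ne_zero hf ha) (faceFun_ne_zero hg ha))
  rw [MvPolynomial.mem_support_iff, MvPolynomial.coeff_mul] at hm
  have hpair : pairing a m = dist a (newtonPolyhedron f) + dist a (newtonPolyhedron g) := by
    obtain ⟨⟨i, j⟩, hij, hne⟩ := Finset.exists_ne_zero_of_sum_ne_zero hm
    rw [Finset.HasAntidiagonal.mem_antidiagonal] at hij
    simp only [coeff_faceFun] at hne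
    rw [← hij]
    simp only [pairing_add_right]
    split_ifs at hne with h1 h2 <;> simp_all
  have hcoeff : (f * g).coeff m ≠ 0 := by
    rw [MvPolynomial.coeff_mul]
    convert hm using 1
    refine Finset.sum_congr rfl fun ⟨i, j⟩ hij => ?_
    rw [Finset.HasAntidiagonal.mem_antidiagonal] at hij
    simp only at hij ⊢
    simp only [coeff_faceFun]
    by_cases hi : i ∈ f.support
    swap
    · simp [MvPolynomial.notMem_support_iff.1 hi]
    by_cases hj : j ∈ g.support
    swap
    · simp [MvPolynomial.notMem_support_iff.1 hj]
    have h1 := dist_le ha hi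
    have h2 := dist_le ha hj
    rw [← hij, pairing_add_right] at hpair
    rw [if_pos (by linarith), if_pos (by linarith)]
  rw [dist_eq_of_forall_le ha (MvPolynomial.mem_support_iff.2 hcoeff), hpair]
  intro m' hm'
  obtain ⟨i, hi, j, hj, rfl⟩ := Finset.mem_add.1 (MvPolynomial.support_mul f g hm')
  rw [hpair, pairing_add_right]
  exact add_le_add (dist_le ha hi) (dist_le ha hj)

end Polyhedron

/-! ### Linearity of the support functions on cones of the subdivision. -/

section Cone

variable {n : ℕ}

theorem barycenter_mem_openCone (W : Finset (Fin n → ℕ)) : barycenter W ∈ openCone W :=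
  ⟨fun _ => 1, fun _ _ => one_pos, by simp [barycenter]⟩

theorem nonneg_of_combination {W : Finset (Fin n → ℕ)} {c : (Fin n → ℕ) → ℝ}
    (hc : ∀ w ∈ W, 0 ≤ c w) (j : Fin n) : 0 ≤ (∑ w ∈ W, c w • toReal w) j := by
  rw [Finset.sum_apply]
  exact Finset.sum_nonneg fun w hw => mul_nonneg (hc w hw) (Nat.cast_nonneg _)

theorem nonneg_of_mem_openCone {W : Finset (Fin n → ℕ)} {a : Fin n → ℝ} (ha : a ∈ openCone W)
    (j : Fin n) : 0 ≤ a j := by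
  obtain ⟨c, hc, rfl⟩ := ha
  exact nonneg_of_combination (fun w hw => (hc w hw).le) j

theorem exists_sub_smul_mem_openCone {W : Finset (Fin n → ℕ)} {a b : Fin n → ℝ}
    (ha : a ∈ openCone W) (hb : b ∈ openCone W) : ∃ ε : ℝ, 0 < ε ∧ b - ε • a ∈ openCone W := by
  obtain ⟨c, hc, rfl⟩ := ha
  obtain ⟨e, he, rfl⟩ := hb
  have hS : 0 ≤ ∑ w ∈ W, c w / e w := Finset.sum_nonneg fun w hw => (div_pos (hc w hw) (he w hw)).le
  refine ⟨(1 + ∑ w ∈ W, c w / e w)⁻¹, by positivity,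
    fun w => e w - (1 + ∑ w ∈ W, c w / e w)⁻¹ * c w, fun w hw => ?_, ?_⟩
  · have h1 : c w / e w ≤ ∑ w ∈ W, c w / e w :=
      Finset.single_le_sum (f := fun w => c w / e w)
        (fun w hw => (div_pos (hc w hw) (he w hw)).le) hw
    rw [sub_pos, inv_mul_lt_iff₀ (by positivity)]
    rw [div_le_iff₀ (he w hw)] at h1
    nlinarith [he w hw]
  · rw [Finset.smul_sum, ← Finset.sum_sub_distrib]
    exact Finset.sum_congr rfl fun w _ => by rw [sub_smul, mul_smul]

variable {R : Type*} [CommRing R] [IsDomain R] {f g : MvPolynomial (Fin n) R}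

/-- The sum d(·, Γ(f)) + d(·, Γ(g)) is pairing with a point of `τ` on the cone, hence additive along
b = εa + (b - εa). Each summand is superadditive, so neither inequality can be strict, and an
exponent that is minimal at `b` must be minimal at `a`. -/
theorem pairing_eq_dist_of_mem_openCone (hf : f ≠ 0) (hg : g ≠ 0) {W : Finset (Fin n → ℕ)}
    {τ : Set (Fin n → ℝ)} (hτ : τ.Nonempty)
    (hW : openCone W ⊆ faceCone (newtonPolyhedron (f * g)) τ) {a b : Fin n → ℝ}
    (ha : a ∈ openCone W) (hb : b ∈ openCone W) {m : Fin n →₀ ℕ} (hm : m ∈ f.support)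
    (h : pairing b m = dist b (newtonPolyhedron f)) :
    pairing a m = dist a (newtonPolyhedron f) := by
  obtain ⟨x, hx⟩ := hτ
  obtain ⟨ε, hε, hba⟩ := exists_sub_smul_mem_openCone ha hb
  have key : ∀ y ∈ openCone W, ∑ j, y j * x j =
      dist y (newtonPolyhedron f) + dist y (newtonPolyhedron g) := fun y hy => by
    rw [← dist_mul hf hg (nonneg_of_mem_openCone hy)]
    have hxy : x ∈ firstMeet y (newtonPolyhedron (f * g)) := by
      rw [(hW hy).2]
      exact hx
    exact hxy.2
  have hlin : ∑ j, b j * x j = ε * ∑ j, a j * x j + ∑ j, (b - ε • a) j * x j := by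
    rw [Finset.mul_sum, ← Finset.sum_add_distrib]
    refine Finset.sum_congr rfl fun j _ => ?_
    simp only [Pi.sub_apply, Pi.smul_apply, smul_eq_mul]
    ring
  have hdec : ∀ m, pairing b m = ε * pairing a m + pairing (b - ε • a) m := fun m => by
    rw [← pairing_smul, ← pairing_add]
    congr 1
    abel
  rw [key a ha, key b hb, key _ hba] at hlin
  obtain ⟨m', hm', hd⟩ := exists_dist_eq hg (nonneg_of_mem_openCone hb)
  have h1 := dist_le (nonneg_of_mem_openCone ha) hm
  have h2 := dist_le (nonneg_of_mem_openCone hba) hm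
  have h3 := dist_le (nonneg_of_mem_openCone ha) hm'
  have h4 := dist_le (nonneg_of_mem_openCone hba) hm'
  rw [hdec] at hd h
  have h5 := mul_le_mul_of_nonneg_left h3 hε.le
  refine le_antisymm ?_ h1
  refine le_of_mul_le_mul_left ?_ hε
  linarith

theorem faceFun_eq_of_mem_openCone (hf : f ≠ 0) (hg : g ≠ 0) {W : Finset (Fin n → ℕ)}
    {τ : Set (Fin n → ℝ)} (hτ : τ.Nonempty)
    (hW : openCone W ⊆ faceCone (newtonPolyhedron (f * g)) τ) {a b : Fin n → ℝ}
    (ha : a ∈ openCone W) (hb : b ∈ openCone W) : faceFun f a = faceFun f b := by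
  classical
  ext m
  simp only [coeff_faceFun]
  by_cases hm : m ∈ f.support
  · have h1 := pairing_eq_dist_of_mem_openCone hf hg hτ hW ha hb hm
    have h2 := pairing_eq_dist_of_mem_openCone hf hg hτ hW hb ha hm
    simp only [show (pairing a m = dist a (newtonPolyhedron f)) =
      (pairing b m = dist b (newtonPolyhedron f)) from propext ⟨h2, h1⟩]
  · simp [MvPolynomial.notMem_support_iff.1 hm]

/-- On the closed cone generated by `W` the function `d(·, Γ(f))` is linear. -/
theorem exists_dist_eq_pairing_on_cone (hf : f ≠ 0) (hg : g ≠ 0) {W : Finset (Fin n → ℕ)}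
    {τ : Set (Fin n → ℝ)} (hτ : τ.Nonempty)
    (hW : openCone W ⊆ faceCone (newtonPolyhedron (f * g)) τ) :
    ∃ m : Fin n →₀ ℕ, ∀ c : (Fin n → ℕ) → ℝ, (∀ w ∈ W, 0 ≤ c w) →
      dist (∑ w ∈ W, c w • toReal w) (newtonPolyhedron f) =
        pairing (∑ w ∈ W, c w • toReal w) m := by
  have hb := barycenter_mem_openCone W
  obtain ⟨m, hm, hd⟩ := exists_dist_eq hf (nonneg_of_mem_openCone hb)
  refine ⟨m, fun c hc => dist_eq_of_forall_le (nonneg_of_combination hc) hm fun m' hm' => ?_⟩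
  set a := ∑ w ∈ W, c w • toReal w with ha
  -- A boundary point is pushed into the open cone by a small multiple of the barycenter, where `m`
  -- is known to be minimal.
  have key : ∀ η : ℝ, 0 < η → pairing a m + η * pairing (barycenter W) m ≤
      pairing a m' + η * pairing (barycenter W) m' := fun η hη => by
    have hmem : a + η • barycenter W ∈ openCone W := by
      refine ⟨fun w => c w + η, fun w hw => add_pos_of_nonneg_of_pos (hc w hw) hη, ?_⟩
      simp only [ha, barycenter, add_smul, Finset.sum_add_distrib, Finset.smul_sum]
    rw [← pairing_smul, ← pairing_smul, ← pairing_add, ← pairing_add,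
      pairing_eq_dist_of_mem_openCone hf hg hτ hW hmem hb hm hd.symm]
    exact dist_le (nonneg_of_mem_openCone hmem) hm'
  by_contra! hlt
  have hB : pairing (barycenter W) m ≤ pairing (barycenter W) m' :=
    hd ▸ dist_le (nonneg_of_mem_openCone hb) hm'
  set B := pairing (barycenter W) m' - pairing (barycenter W) m
  have hB' : 0 ≤ B := sub_nonneg.2 hB
  -- This `η` satisfies `η * B < pairing a m - pairing a m'`, which replaces a limit `η → 0`; the `+
  -- 1` covers `B = 0`.
  have h1 := key ((pairing a m - pairing a m') / (B + 1)) (div_pos (sub_pos.2 hlt) (by linarith))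
  have h2 : (pairing a m - pairing a m') / (B + 1) * B < pairing a m - pairing a m' := by
    rw [div_mul_eq_mul_div, div_lt_iff₀ (by linarith)]
    nlinarith
  simp only [B] at h1 h2 ⊢
  linarith

end Cone

end NewtonZeta

/-! ### Digits, polydiscs and spheres, and measures invariant on polydiscs. -/

namespace NewtonZeta

variable {K : Type*} [NontriviallyNormedField K] [IsUltrametricDist K]

/-- A representative in the ring of integers of an element of the residue field. -/
def resLift (r : ResField K) : RingInt K :=
  Function.surjInv IsLocalRing.residue_surjective r

theorem residue_resLift (r : ResField K) : IsLocalRing.residue (RingInt K) (resLift r) = r :=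
  Function.surjInv_eq IsLocalRing.residue_surjective r

section Digit

variable {ϖ : RingInt K}

theorem norm_sub_resLift_le (hϖ : IsUniformizer ϖ) {x : RingInt K} {r : ResField K} :
    ‖(x : K) - (resLift r : K)‖ ≤ (resCard K : ℝ)⁻¹ ↔ IsLocalRing.residue (RingInt K) x = r := by
  rw [← hϖ.norm_lt_one_iff, ← AddSubgroupClass.coe_sub, ← residue_eq_zero_iff, map_sub,
    residue_resLift, sub_eq_zero]

theorem norm_sub_digit_le_iff (hϖ : IsUniformizer ϖ) {x : RingInt K} {r : ResField K} {a : ℕ} :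
    ‖(ϖ : K) ^ a * x - (ϖ : K) ^ a * resLift r‖ ≤ (resCard K : ℝ)⁻¹ ^ (a + 1) ↔
      IsLocalRing.residue (RingInt K) x = r := by
  rw [← mul_sub, norm_mul, norm_pow, hϖ.norm_eq, pow_succ,
    mul_le_mul_iff_right₀ (pow_pos hϖ.inv_pos a), norm_sub_resLift_le hϖ]

theorem exists_eq_pow_mul (hϖ : IsUniformizer ϖ) {x : K} {a : ℕ}
    (hx : ‖x‖ ≤ (resCard K : ℝ)⁻¹ ^ a) : ∃ y : RingInt K, x = (ϖ : K) ^ a * y := by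
  refine ⟨⟨x / (ϖ : K) ^ a, mem_ringInt.2 ?_⟩, ?_⟩
  · rw [norm_div, norm_pow, hϖ.norm_eq]
    exact div_le_one_of_le₀ hx (pow_pos hϖ.inv_pos a).le
  · have := pow_ne_zero a hϖ.ne_zero
    field_simp

theorem norm_pow_mul_eq_iff (hϖ : IsUniformizer ϖ) {x : RingInt K} {a : ℕ} :
    ‖(ϖ : K) ^ a * x‖ = (resCard K : ℝ)⁻¹ ^ a ↔ IsLocalRing.residue (RingInt K) x ≠ 0 := by
  have h0 := pow_pos hϖ.inv_pos a
  rw [norm_mul, norm_pow, hϖ.norm_eq, ne_eq, residue_eq_zero_iff, not_lt, mul_eq_left₀ h0.ne']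
  exact ⟨fun h => h.ge, fun h => le_antisymm (norm_ringInt_le x) h⟩

theorem norm_pow_mul_le (hϖ : IsUniformizer ϖ) (x : RingInt K) (a : ℕ) :
    ‖(ϖ : K) ^ a * x‖ ≤ (resCard K : ℝ)⁻¹ ^ a := by
  rw [norm_mul, norm_pow, hϖ.norm_eq]
  exact mul_le_of_le_one_right (pow_pos hϖ.inv_pos a).le (norm_ringInt_le x)

/-- The closed polydisc with center `c` and radii `q ^ (-a i)`. -/
def polyBox {ι : Type*} (c : ι → K) (a : ι → ℕ) : Set (ι → K) :=
  {x | ∀ i, ‖x i - c i‖ ≤ (resCard K : ℝ)⁻¹ ^ a i}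

/-- The product of the spheres with center `0` and radii `q ^ (-a i)`. -/
def polySphere {ι : Type*} (a : ι → ℕ) : Set (ι → K) :=
  {x | ∀ i, ‖x i‖ = (resCard K : ℝ)⁻¹ ^ a i}

variable {ι : Type*}

theorem measurableSet_polyBox [Finite ι] [MeasurableSpace K] [BorelSpace K] (c : ι → K)
    (a : ι → ℕ) : MeasurableSet (polyBox c a) := by
  have : polyBox c a = ⋂ i, (fun x : ι → K => x i) ⁻¹' Metric.closedBall (c i)
      ((resCard K : ℝ)⁻¹ ^ a i) := by
    ext x
    simp [polyBox, dist_eq_norm]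
  rw [this]
  exact MeasurableSet.iInter fun i => measurable_pi_apply i measurableSet_closedBall

/-- One more digit in one coordinate: the q possible digits at place `a i` cut the polydisc into q
translates of the next smaller one. -/
theorem polyBox_zero_eq_iUnion [DecidableEq ι] (hϖ : IsUniformizer ϖ) (a : ι → ℕ) (i : ι) :
    polyBox (0 : ι → K) a = ⋃ r : ResField K,
      polyBox (Pi.single i ((ϖ : K) ^ a i * resLift r)) (a + Pi.single i 1) := by
  ext x
  simp only [mem_iUnion]
  constructor
  · intro hx
    have hi := hx i
    rw [Pi.zero_apply, sub_zero] at hi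
    obtain ⟨y, hy⟩ := exists_eq_pow_mul hϖ hi
    refine ⟨IsLocalRing.residue (RingInt K) y, fun j => ?_⟩
    rcases eq_or_ne j i with rfl | hj
    · simp only [Pi.single_eq_same, Pi.add_apply, hy]
      exact (norm_sub_digit_le_iff hϖ).2 rfl
    · simpa [Pi.single_eq_of_ne hj] using hx j
  · rintro ⟨r, hr⟩ j
    rcases eq_or_ne j i with rfl | hj
    · have := hr j
      simp only [Pi.single_eq_same, Pi.add_apply] at this
      rw [Pi.zero_apply, sub_zero, ← sub_add_cancel (x j) ((ϖ : K) ^ a j * resLift r)]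
      refine (IsUltrametricDist.norm_add_le_max _ _).trans (max_le ?_ (norm_pow_mul_le hϖ _ _))
      exact this.trans (pow_le_pow_of_le_one hϖ.inv_pos.le hϖ.inv_lt_one.le (Nat.le_succ _))
    · simpa [Pi.single_eq_of_ne hj] using hr j

/-- A point has norm exactly q^{-a i} in coordinate i when its digit at place `a i` is non-zero,
which leaves q - 1 choices for each coordinate. -/
theorem polySphere_eq_iUnion (hϖ : IsUniformizer ϖ) (a : ι → ℕ) :
    polySphere (K := K) a = ⋃ r : ι → {r : ResField K // r ≠ 0},
      polyBox (fun i => (ϖ : K) ^ a i * resLift (r i : ResField K)) (a + 1) := by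
  ext x
  simp only [mem_iUnion]
  constructor
  · intro hx
    choose y hy using fun i => exists_eq_pow_mul hϖ (hx i).le
    refine ⟨fun i => ⟨IsLocalRing.residue (RingInt K) (y i), ?_⟩, fun i => ?_⟩
    · have := hx i
      rw [hy] at this
      exact (norm_pow_mul_eq_iff hϖ).1 this
    · rw [hy]
      exact (norm_sub_digit_le_iff hϖ).2 rfl
  · rintro ⟨r, hr⟩ i
    have h1 := hr i
    rw [Pi.add_apply, Pi.one_apply, hϖ.norm_le_pow_succ_iff] at h1
    have h2 : ‖(ϖ : K) ^ a i * resLift (r i : ResField K)‖ = (resCard K : ℝ)⁻¹ ^ a i := by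
      rw [norm_pow_mul_eq_iff hϖ, residue_resLift]
      exact (r i).2
    rw [← h2] at h1 ⊢
    rw [← sub_add_cancel (x i) ((ϖ : K) ^ a i * resLift (r i : ResField K)),
      IsUltrametricDist.norm_add_eq_max_of_norm_ne_norm h1.ne, max_eq_right h1.le]

theorem disjoint_polyBox {c c' : ι → K} {a : ι → ℕ} {i : ι}
    (h : (resCard K : ℝ)⁻¹ ^ a i < ‖c i - c' i‖) : Disjoint (polyBox c a) (polyBox c' a) := by
  rw [Set.disjoint_left]
  intro x hx hx'
  refine h.not_ge ?_
  rw [← dist_eq_norm]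
  refine (dist_triangle_max (c i) (x i) (c' i)).trans (max_le ?_ ?_)
  · rw [dist_comm, dist_eq_norm]
    exact hx i
  · rw [dist_eq_norm]
    exact hx' i

theorem lt_norm_digit_sub (hϖ : IsUniformizer ϖ) {r r' : ResField K} (h : r ≠ r') (a : ℕ) :
    (resCard K : ℝ)⁻¹ ^ (a + 1) < ‖(ϖ : K) ^ a * resLift r - (ϖ : K) ^ a * resLift r'‖ := by
  rw [← not_le, norm_sub_digit_le_iff hϖ, residue_resLift]
  exact h

variable [Fintype ι] [MeasurableSpace K] [BorelSpace K]

/-- A finite measure giving equal mass to the translates of every polydisc inside the unit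
polydisc. -/
structure IsBoxInvariant (ν : Measure (ι → K)) : Prop where
  finite : IsFiniteMeasure ν
  eq : ∀ (c : ι → K) (a : ι → ℕ), (∀ i, ‖c i‖ ≤ 1) → ν.real (polyBox c a) = ν.real (polyBox 0 a)

/-- Shrinking one radius by one step divides the mass by q, because the q pieces have equal mass;
the induction is on the sum of the exponents. Invariance on polydiscs alone thus fixes all these
masses up to the total one. -/
theorem IsBoxInvariant.measureReal_polyBox_zero (hϖ : IsUniformizer ϖ) {ν : Measure (ι → K)}
    (hν : IsBoxInvariant ν) (a : ι → ℕ) :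
    ν.real (polyBox 0 a) = ν.real (polyBox 0 0) * ∏ i, (resCard K : ℝ)⁻¹ ^ a i := by
  classical
  have := hν.finite
  have := hϖ.finite
  have := Fintype.ofFinite (ResField K)
  have step : ∀ (a : ι → ℕ) (i : ι), ν.real (polyBox 0 (a + Pi.single i 1)) =
      ν.real (polyBox 0 a) * (resCard K : ℝ)⁻¹ := fun a i => by
    have h := measureReal_iUnion_fintype (μ := ν)
      (f := fun r : ResField K =>
        polyBox (Pi.single i ((ϖ : K) ^ a i * resLift r)) (a + Pi.single i 1))
      (fun r r' hr => disjoint_polyBox (i := i) (by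
        simpa using lt_norm_digit_sub hϖ hr (a i)))
      (fun r => measurableSet_polyBox _ _)
    rw [← polyBox_zero_eq_iUnion hϖ a i, Finset.sum_congr rfl fun r _ => hν.eq _ _ fun j => ?_,
      Finset.sum_const, Finset.card_univ, ← Nat.card_eq_fintype_card, nsmul_eq_mul] at h
    · rw [h, resCard]
      have : (Nat.card (ResField K) : ℝ) ≠ 0 := by
        have := hϖ.one_lt
        rw [resCard] at this
        positivity
      field_simp
    · rcases eq_or_ne j i with rfl | hj
      · rw [Pi.single_eq_same]
        exact (norm_pow_mul_le hϖ _ _).trans (pow_le_one₀ hϖ.inv_pos.le hϖ.inv_lt_one.le)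
      · simp [Pi.single_eq_of_ne hj]
  obtain ⟨N, hN⟩ : ∃ N, N = ∑ i, a i := ⟨_, rfl⟩
  induction N generalizing a with
  | zero =>
    have : a = 0 := by
      ext i
      exact Finset.sum_eq_zero_iff.1 hN.symm i (Finset.mem_univ i)
    simp [this]
  | succ N ih =>
    obtain ⟨i, hi⟩ : ∃ i, 0 < a i := by
      by_contra! h
      rw [Finset.sum_eq_zero fun i _ => Nat.le_zero.1 (h i)] at hN
      omega
    obtain ⟨b, rfl⟩ : ∃ b : ι → ℕ, a = b + Pi.single i 1 := by
      refine ⟨a - Pi.single i 1, ?_⟩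
      ext j
      rcases eq_or_ne j i with rfl | hj
      · simp only [Pi.add_apply, Pi.sub_apply, Pi.single_eq_same]
        omega
      · simp [Pi.single_eq_of_ne hj]
    rw [step, ih b, mul_assoc]
    · congr 1
      simp only [Pi.add_apply, pow_add, Finset.prod_mul_distrib]
      congr 1
      rw [Finset.prod_eq_single i (fun j _ hj => by simp [Pi.single_eq_of_ne hj]) (by simp)]
      simp
    · simp only [Pi.add_apply, Finset.sum_add_distrib, Finset.sum_pi_single', Finset.mem_univ,
        if_true] at hN
      omega

theorem IsBoxInvariant.measureReal_polyBox (hϖ : IsUniformizer ϖ) {ν : Measure (ι → K)}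
    (hν : IsBoxInvariant ν) {c : ι → K} (hc : ∀ i, ‖c i‖ ≤ 1) (a : ι → ℕ) :
    ν.real (polyBox c a) = ν.real (polyBox 0 0) * ∏ i, (resCard K : ℝ)⁻¹ ^ a i := by
  rw [hν.eq c a hc, hν.measureReal_polyBox_zero hϖ]

theorem IsBoxInvariant.measureReal_polySphere (hϖ : IsUniformizer ϖ) {ν : Measure (ι → K)}
    (hν : IsBoxInvariant ν) (a : ι → ℕ) :
    ν.real (polySphere a) = ν.real (polyBox 0 0) *
      ∏ i, (((resCard K : ℝ) - 1) * (resCard K : ℝ)⁻¹ ^ (a i + 1)) := by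
  classical
  have := hν.finite
  have := hϖ.finite
  have := Fintype.ofFinite (ResField K)
  rw [polySphere_eq_iUnion hϖ, measureReal_iUnion_fintype]
  rotate_left
  · intro r r' hr
    obtain ⟨i, hi⟩ := Function.ne_iff.1 hr
    exact disjoint_polyBox (i := i) (lt_norm_digit_sub hϖ (fun h => hi (Subtype.ext h)) _)
  · exact fun r => measurableSet_polyBox _ _
  rw [Finset.sum_congr rfl fun r _ => hν.measureReal_polyBox hϖ (fun i => ?_) _,
    Finset.sum_const, Finset.card_univ, Fintype.card_pi, nsmul_eq_mul]
  · have hcard : Fintype.card {r : ResField K // r ≠ 0} = resCard K - 1 := by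
      rw [Fintype.card_subtype_compl, Fintype.card_subtype_eq, resCard, Nat.card_eq_fintype_card]
    simp only [hcard, Finset.prod_mul_distrib, Pi.add_apply, Pi.one_apply]
    rw [Nat.cast_prod, Nat.cast_sub hϖ.one_lt.le, Nat.cast_one]
    ring
  · exact (norm_pow_mul_le hϖ _ _).trans (pow_le_one₀ hϖ.inv_pos.le hϖ.inv_lt_one.le)

end Digit

end NewtonZeta

/-! ### Isometries of ultrametric balls preserve invariant measure. -/

namespace NewtonZeta

section IsometryCount

variable {E : Type*} [NormedAddCommGroup E] [IsUltrametricDist E]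

/-- In an ultrametric space "at distance at most ρ" is an equivalence relation; the set consists of
one representative for each class meeting the ball, finite by compactness. -/
theorem exists_finset_separated [ProperSpace E] {r ρ : ℝ} (hρ : 0 < ρ) (hr : ρ ≤ r) :
    ∃ t : Finset E, (∀ y ∈ t, ‖y‖ ≤ r) ∧ (∀ x : E, ‖x‖ ≤ r → ∃ y ∈ t, ‖x - y‖ ≤ ρ) ∧
      ∀ x ∈ t, ∀ y ∈ t, ‖x - y‖ ≤ ρ → x = y := by
  let S : Setoid E := ⟨fun x y => Dist.dist x y ≤ ρ, ⟨fun x => by simp [hρ.le],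
    fun {x y} h => by rwa [dist_comm], fun {x y z} h h' =>
      (dist_triangle_max x y z).trans (max_le h h')⟩⟩
  let rep : E → E := fun x => (Quotient.mk S x).out
  have hrep : ∀ x, Dist.dist (rep x) x ≤ ρ := fun x => Quotient.mk_out (s := S) x
  have hrep' : ∀ x y, Dist.dist x y ≤ ρ → rep x = rep y := fun x y h =>
    congrArg Quotient.out (Quotient.sound (s := S) h)
  have hfin : (rep '' Metric.closedBall 0 r).Finite := by
    obtain ⟨t, -, ht, hcov⟩ := (isCompact_closedBall (0 : E) r).finite_cover_balls hρ
    refine (ht.image rep).subset ?_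
    rintro _ ⟨x, hx, rfl⟩
    have := hcov hx
    simp only [mem_iUnion] at this
    obtain ⟨y, hy, hxy⟩ := this
    exact ⟨y, hy, (hrep' x y (Metric.mem_ball.1 hxy).le).symm⟩
  refine ⟨hfin.toFinset, ?_, ?_, ?_⟩
  · intro y hy
    obtain ⟨x, hx, rfl⟩ := hfin.mem_toFinset.1 hy
    have h1 := hrep x
    rw [mem_closedBall_zero_iff] at hx
    rw [dist_eq_norm] at h1
    rw [← sub_add_cancel (rep x) x]
    exact (IsUltrametricDist.norm_add_le_max _ _).trans (max_le (h1.trans hr) hx)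
  · intro x hx
    refine ⟨rep x, hfin.mem_toFinset.2 ⟨x, mem_closedBall_zero_iff.2 hx, rfl⟩, ?_⟩
    rw [← dist_eq_norm, dist_comm]
    exact hrep x
  · intro x hx y hy h
    obtain ⟨x, -, rfl⟩ := hfin.mem_toFinset.1 hx
    obtain ⟨y, -, rfl⟩ := hfin.mem_toFinset.1 hy
    rw [← dist_eq_norm] at h
    refine hrep' x y ?_
    refine (dist_triangle_max x (rep x) y).trans (max_le (dist_comm x _ ▸ hrep x) ?_)
    exact (dist_triangle_max (rep x) (rep y) y).trans (max_le h (hrep y))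

variable [MeasurableSpace E] [BorelSpace E] {μ : Measure E} [μ.IsAddLeftInvariant]

/-- A saturated set is a disjoint union of closed ρ-balls of equal measure, so its measure is a
count of centers. -/
theorem measure_saturated {r ρ : ℝ} (hr : ρ ≤ r) {t : Finset E}
    (ht : ∀ y ∈ t, ‖y‖ ≤ r) (hcov : ∀ x : E, ‖x‖ ≤ r → ∃ y ∈ t, ‖x - y‖ ≤ ρ)
    (hsep : ∀ x ∈ t, ∀ y ∈ t, ‖x - y‖ ≤ ρ → x = y) {S : Set E}
    (hS : ∀ x y, ‖x‖ ≤ r → ‖x - y‖ ≤ ρ → (x ∈ S ↔ y ∈ S)) [DecidablePred (· ∈ S)] :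
    μ (Metric.closedBall 0 r ∩ S) =
      (t.filter (· ∈ S)).card * μ (Metric.closedBall (0 : E) ρ) := by
  have hU : Metric.closedBall 0 r ∩ S = ⋃ y ∈ t.filter (· ∈ S), Metric.closedBall y ρ := by
    ext x
    simp only [mem_inter_iff, mem_iUnion, Finset.mem_filter,
      Metric.mem_closedBall, dist_eq_norm, exists_prop, sub_zero]
    constructor
    · rintro ⟨hx, hxS⟩
      obtain ⟨y, hy, hxy⟩ := hcov x hx
      exact ⟨y, ⟨hy, (hS x y hx hxy).1 hxS⟩, hxy⟩
    · rintro ⟨y, ⟨hy, hyS⟩, hxy⟩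
      refine ⟨?_, (hS y x (ht y hy) (norm_sub_rev x y ▸ hxy)).1 hyS⟩
      rw [← sub_add_cancel x y]
      exact (IsUltrametricDist.norm_add_le_max _ _).trans (max_le (hxy.trans hr) (ht y hy))
  rw [hU, measure_biUnion_finset]
  · rw [Finset.sum_congr rfl fun y _ => ?_, Finset.sum_const, nsmul_eq_mul]
    have : Metric.closedBall (0 : E) ρ = (fun x => y + x) ⁻¹' Metric.closedBall y ρ := by
      ext x
      simp [dist_eq_norm]
    rw [this, measure_preimage_add]
  · intro x hx y hy hxy
    simp only [Finset.coe_filter, mem_ofPred_eq] at hx hy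
    refine (IsUltrametricDist.closedBall_eq_or_disjoint x y ρ).resolve_left fun h => hxy ?_
    refine hsep x hx.1 y hy.1 ?_
    rw [← dist_eq_norm, ← Metric.mem_closedBall, ← h]
    exact Metric.mem_closedBall_self (by
      obtain ⟨w, -, hw⟩ := hcov x (ht x hx.1)
      exact (norm_nonneg _).trans hw)
  · exact fun y _ => measurableSet_closedBall

/-- An isometric self-map of a ball of an ultrametric space preserves the invariant measure of
every union of balls of a fixed radius. -/
theorem measure_preimage_isometry [ProperSpace E] {r ρ : ℝ} (hρ : 0 < ρ) (hr : ρ ≤ r) {Φ : E → E}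
    (hmaps : ∀ x, ‖x‖ ≤ r → ‖Φ x‖ ≤ r)
    (hiso : ∀ x y, ‖x‖ ≤ r → ‖y‖ ≤ r → ‖Φ x - Φ y‖ = ‖x - y‖) {S : Set E}
    (hS : ∀ x y, ‖x - y‖ ≤ ρ → (x ∈ S ↔ y ∈ S)) :
    μ (Metric.closedBall 0 r ∩ Φ ⁻¹' S) = μ (Metric.closedBall 0 r ∩ S) := by
  classical
  obtain ⟨t, ht, hcov, hsep⟩ := exists_finset_separated (E := E) hρ hr
  have hnear : ∀ x y : E, ‖x‖ ≤ r → ‖x - y‖ ≤ ρ → ‖y‖ ≤ r := fun x y hx hxy => by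
    rw [← sub_add_cancel y x]
    refine (IsUltrametricDist.norm_add_le_max _ _).trans (max_le ?_ hx)
    rw [norm_sub_rev]
    exact hxy.trans hr
  rw [measure_saturated (S := Φ ⁻¹' S) hr ht hcov hsep (fun x y hx hxy => hS _ _ ?_),
    measure_saturated hr ht hcov hsep (fun x y _ hxy => hS x y hxy)]
  swap
  · rwa [hiso x y hx (hnear x y hx hxy)]
  congr 2
  choose! rep hrep_mem hrep using hcov
  -- An isometry induces an injection on the ρ-classes. As there are finitely many classes it is a
  -- permutation, so the counts on both sides agree and no inverse of `Φ` has to be constructed.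
  have hinj : Set.InjOn (fun y => rep (Φ y)) t := fun y hy y' hy' h => by
    refine hsep y hy y' hy' ?_
    have h1 := hrep _ (hmaps y (ht y hy))
    have h2 := hrep _ (hmaps y' (ht y' hy'))
    simp only at h
    rw [← hiso y y' (ht y hy) (ht y' hy'), ← sub_add_sub_cancel _ (rep (Φ y)) _]
    refine (IsUltrametricDist.norm_add_le_max _ _).trans (max_le h1 ?_)
    rw [h, norm_sub_rev]
    exact h2
  have hmt : Set.MapsTo (fun y => rep (Φ y)) (t : Set E) t :=
    fun y hy => hrep_mem _ (hmaps y (ht y hy))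
  have hsurj := Finset.surjOn_of_injOn_of_card_le _ hmt hinj le_rfl
  refine Finset.card_bij (fun y _ => rep (Φ y)) ?_ ?_ ?_
  · intro y hy
    rw [Finset.mem_filter] at hy ⊢
    exact ⟨hmt hy.1, (hS _ _ (hrep _ (hmaps y (ht y hy.1)))).1 hy.2⟩
  · intro y hy y' hy' h
    exact hinj (Finset.mem_filter.1 hy).1 (Finset.mem_filter.1 hy').1 h
  · intro y hy
    rw [Finset.mem_filter] at hy
    obtain ⟨x, hx, hxy⟩ := hsurj hy.1
    refine ⟨x, Finset.mem_filter.2 ⟨hx, ?_⟩, hxy⟩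
    refine (hS _ _ (hrep _ (hmaps x (ht x hx)))).2 ?_
    simp only at hxy
    rw [hxy]
    exact hy.2

end IsometryCount

/-! ### First-order Taylor estimate for integral polynomials. -/

section Taylor

theorem norm_sub_le_max_of_ultra {E : Type*} [SeminormedAddCommGroup E] [IsUltrametricDist E]
    (x y : E) : ‖x - y‖ ≤ max ‖x‖ ‖y‖ := by
  rw [sub_eq_add_neg, ← norm_neg y]
  exact IsUltrametricDist.norm_add_le_max _ _

variable {K : Type*} [NontriviallyNormedField K] [IsUltrametricDist K] {n : ℕ}

theorem norm_aeval_le (h : MvPolynomial (Fin n) (RingInt K)) {x : Fin n → K}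
    (hx : ∀ j, ‖x j‖ ≤ 1) : ‖MvPolynomial.aeval x h‖ ≤ 1 := by
  have : x = algebraMap (RingInt K) K ∘ fun j => ⟨x j, mem_ringInt.2 (hx j)⟩ := rfl
  rw [this, MvPolynomial.aeval_algebraMap_apply]
  exact norm_ringInt_le _

theorem norm_sum_mul_le {ι : Type*} [Fintype ι] {x y : ι → K} {C : ℝ} (hC : 0 ≤ C)
    (hx : ∀ j, ‖x j‖ ≤ 1) (hy : ∀ j, ‖y j‖ ≤ C) : ‖∑ j, x j * y j‖ ≤ C := by
  refine IsUltrametricDist.norm_sum_le_of_forall_le_of_nonneg hC fun j _ => ?_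
  rw [norm_mul]
  exact (mul_le_of_le_one_left (norm_nonneg _) (hx j)).trans (hy j)

/-- First-order Taylor expansion of an integral polynomial near an integral point. -/
theorem norm_taylor_le (h : MvPolynomial (Fin n) (RingInt K)) {z u v : Fin n → K} {r : ℝ}
    (hr : r ≤ 1) (hz : ∀ j, ‖z j‖ ≤ 1) (hu : ∀ j, ‖u j - z j‖ ≤ r) (hv : ∀ j, ‖v j - z j‖ ≤ r)
    {C : ℝ} (hC : 0 ≤ C) (hC' : C ≤ r) (huv : ∀ j, ‖u j - v j‖ ≤ C) :
    ‖MvPolynomial.aeval u h - MvPolynomial.aeval v h -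
      ∑ j, MvPolynomial.aeval z (MvPolynomial.pderiv j h) * (u j - v j)‖ ≤ r * C := by
  have hr0 : 0 ≤ r := hC.trans hC'
  have int_of : ∀ w : Fin n → K, (∀ j, ‖w j - z j‖ ≤ r) → ∀ j, ‖w j‖ ≤ 1 := fun w hw j => by
    rw [← sub_add_cancel (w j) (z j)]
    exact (IsUltrametricDist.norm_add_le_max _ _).trans (max_le ((hw j).trans hr) (hz j))
  have hu1 := int_of u hu
  have hv1 := int_of v hv
  induction h using MvPolynomial.induction_on generalizing u v C with
  | C a => simpa using mul_nonneg hr0 hC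
  | add p p' hp hp' =>
    have := (IsUltrametricDist.norm_add_le_max _ _).trans
      (max_le (hp hu hv hC hC' huv hu1 hv1) (hp' hu hv hC hC' huv hu1 hv1))
    refine (congrArg norm ?_).trans_le this
    simp only [map_add, add_mul, Finset.sum_add_distrib]
    ring
  | mul_X p i hp =>
    have hd : ∀ j, ‖MvPolynomial.aeval z (MvPolynomial.pderiv j p)‖ ≤ 1 :=
      fun j => norm_aeval_le _ hz
    -- The induction hypothesis for the pair `v`, `z` with `C = r`; this is why `u`, `v` and `C` are
    -- generalized.
    have hzv : ‖MvPolynomial.aeval v p - MvPolynomial.aeval z p‖ ≤ r := by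
      have h1 := hp hv (fun j => by simpa using hr0) hr0 le_rfl hv hv1 hz
      rw [← sub_add_cancel (MvPolynomial.aeval v p - MvPolynomial.aeval z p)
        (∑ j, MvPolynomial.aeval z (MvPolynomial.pderiv j p) * (v j - z j))]
      refine (IsUltrametricDist.norm_add_le_max _ _).trans
        (max_le (h1.trans (mul_le_of_le_one_left hr0 hr)) (norm_sum_mul_le hr0 hd hv))
    -- Leibniz rule for the error term: the three products on the right are bounded by `1 * (r *
    -- C)`, `r * C` and `r * C`.
    have e : MvPolynomial.aeval u (p * MvPolynomial.X i) -
        MvPolynomial.aeval v (p * MvPolynomial.X i) -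
        ∑ j, MvPolynomial.aeval z (MvPolynomial.pderiv j (p * MvPolynomial.X i)) * (u j - v j) =
      u i * (MvPolynomial.aeval u p - MvPolynomial.aeval v p -
        ∑ j, MvPolynomial.aeval z (MvPolynomial.pderiv j p) * (u j - v j)) +
      ((u i - z i) * ∑ j, MvPolynomial.aeval z (MvPolynomial.pderiv j p) * (u j - v j) +
      (MvPolynomial.aeval v p - MvPolynomial.aeval z p) * (u i - v i)) := by
      have : ∑ j, MvPolynomial.aeval z (MvPolynomial.pderiv j (p * MvPolynomial.X i)) *
          (u j - v j) = z i * ∑ j, MvPolynomial.aeval z (MvPolynomial.pderiv j p) * (u j - v j) +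
          MvPolynomial.aeval z p * (u i - v i) := by
        simp only [Derivation.leibniz, MvPolynomial.pderiv_X, smul_eq_mul, map_add, map_mul,
          MvPolynomial.aeval_X, add_mul, Finset.sum_add_distrib, Finset.mul_sum]
        rw [add_comm]
        congr 1
        · exact Finset.sum_congr rfl fun j _ => by ring
        · rw [Finset.sum_eq_single i]
          · simp
          · intro j _ hj
            simp [Pi.single_eq_of_ne' hj]
          · simp
      rw [this]
      simp only [map_mul, MvPolynomial.aeval_X]
      ring
    rw [e]
    have hrC := mul_nonneg hr0 hC
    refine (IsUltrametricDist.norm_add_le_max _ _).trans (max_le ?_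
      ((IsUltrametricDist.norm_add_le_max _ _).trans (max_le ?_ ?_)))
    · rw [norm_mul]
      exact (mul_le_of_le_one_left (norm_nonneg _) (hu1 i)).trans (hp hu hv hC hC' huv hu1 hv1)
    · rw [norm_mul]
      exact mul_le_mul (hu i) (norm_sum_mul_le hC hd huv) (norm_nonneg _) hr0
    · rw [norm_mul]
      exact mul_le_mul hzv (huv i) (norm_nonneg _) hr0

theorem residue_eval (h : MvPolynomial (Fin n) (RingInt K)) (z : Fin n → RingInt K) :
    IsLocalRing.residue (RingInt K) (MvPolynomial.eval z h) =
      MvPolynomial.eval (fun j => IsLocalRing.residue (RingInt K) (z j)) (reduction h) := by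
  rw [reduction, MvPolynomial.eval_map, MvPolynomial.eval₂_eq_eval_map, MvPolynomial.eval_map]
  exact MvPolynomial.eval₂_comp_left (IsLocalRing.residue (RingInt K)) (RingHom.id _) z h

end Taylor

end NewtonZeta

/-! ### Haar measure of polydiscs, and maps that are submersive modulo ϖ. -/

namespace NewtonZeta

variable {K : Type*} [NontriviallyNormedField K] [IsUltrametricDist K] {n : ℕ}

theorem mem_polyBox_zero_zero {ι : Type*} {x : ι → K} :
    x ∈ polyBox (0 : ι → K) 0 ↔ ∀ j, ‖x j‖ ≤ 1 := by
  simp [polyBox]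

theorem secondCountable_of_locallyCompact (K : Type*) [NontriviallyNormedField K]
    [LocallyCompactSpace K] : SecondCountableTopology K := by
  have : ProperSpace K := ProperSpace.of_locallyCompactSpace K
  infer_instance

theorem preimage_add_polyBox {ι : Type*} (c : ι → K) (a : ι → ℕ) :
    (fun x => c + x) ⁻¹' polyBox c a = polyBox 0 a := by
  ext x
  simp [polyBox]

section Haar

variable [LocallyCompactSpace K] [MeasurableSpace K] [BorelSpace K]
  {μ : Measure (Fin n → K)} [μ.IsAddHaarMeasure]

theorem haar_polyBox_eq (c : Fin n → K) (a : Fin n → ℕ) : μ (polyBox c a) = μ (polyBox 0 a) := by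
  have := secondCountable_of_locallyCompact K
  rw [← preimage_add_polyBox c a, measure_preimage_add]

/-- Box invariance is defined for finite measures, so it is applied to the restriction to the unit
polydisc, of mass 1; translation then allows an arbitrary center. -/
theorem haar_real_polyBox {ϖ : RingInt K} (hϖ : IsUniformizer ϖ)
    (hμ : μ {x | ∀ j, ‖x j‖ ≤ 1} = 1) (c : Fin n → K) (a : Fin n → ℕ) :
    μ.real (polyBox c a) = ∏ i, (resCard K : ℝ)⁻¹ ^ a i := by
  have hμ' : μ (polyBox 0 0) = 1 := by
    rw [← hμ]
    congr 1
    ext x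
    exact mem_polyBox_zero_zero
  have hsub : ∀ (c : Fin n → K) (a : Fin n → ℕ), (∀ i, ‖c i‖ ≤ 1) →
      polyBox c a ⊆ polyBox 0 0 := fun c a hc x hx => by
    rw [mem_polyBox_zero_zero]
    intro j
    rw [← sub_add_cancel (x j) (c j)]
    refine (IsUltrametricDist.norm_add_le_max _ _).trans (max_le ((hx j).trans ?_) (hc j))
    exact pow_le_one₀ hϖ.inv_pos.le hϖ.inv_lt_one.le
  have hinv : IsBoxInvariant (μ.restrict (polyBox 0 0)) := by
    refine ⟨⟨by simp [hμ']⟩, fun c a hc => ?_⟩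
    rw [measureReal_restrict_apply (measurableSet_polyBox _ _),
      measureReal_restrict_apply (measurableSet_polyBox _ _),
      inter_eq_left.2 (hsub c a hc), inter_eq_left.2 (hsub 0 a (by simp)), measureReal_def,
      measureReal_def, haar_polyBox_eq]
  have := hinv.measureReal_polyBox_zero hϖ a
  rw [measureReal_restrict_apply (measurableSet_polyBox _ _),
    measureReal_restrict_apply (measurableSet_polyBox _ _), inter_self,
    inter_eq_left.2 (hsub 0 a (by simp)), measureReal_def μ (polyBox 0 0), hμ'] at this
  rw [measureReal_def, haar_polyBox_eq, ← measureReal_def, this]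
  simp

theorem haar_polyBox_lt_top {ϖ : RingInt K} (hϖ : IsUniformizer ϖ)
    (hμ : μ {x | ∀ j, ‖x j‖ ≤ 1} = 1) (c : Fin n → K) (a : Fin n → ℕ) : μ (polyBox c a) < ⊤ := by
  rw [lt_top_iff_ne_top]
  intro h
  have := haar_real_polyBox hϖ hμ c a
  rw [measureReal_def, h, ENNReal.toReal_top] at this
  exact (Finset.prod_pos fun i _ => pow_pos hϖ.inv_pos (a i)).ne this

theorem measurable_aeval (F : MvPolynomial (Fin n) (RingInt K)) :
    Measurable fun u : Fin n → K => MvPolynomial.aeval u F := by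
  have := secondCountable_of_locallyCompact K
  have : Continuous fun u : Fin n → K => MvPolynomial.aeval u F := by
    simp only [MvPolynomial.aeval_def, MvPolynomial.eval₂_eq_eval_map]
    exact MvPolynomial.continuous_eval _
  exact this.measurable

end Haar

section RightInverse

variable {ι : Type*} [Fintype ι] [DecidableEq ι]

/-- Full row rank gives a right inverse over the residue field. For any lift `B'` of it, `A * B'`
has determinant congruent to 1, hence a unit, and multiplying `B'` by the inverse of `A * B'`
corrects the lift. -/
theorem exists_rightInverse_of_residue_rank (A : Matrix ι (Fin n) (RingInt K))
    (hA : (A.map (IsLocalRing.residue (RingInt K))).rank = Fintype.card ι) :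
    ∃ B : Matrix (Fin n) ι (RingInt K), A * B = 1 := by
  have hsurj : Function.Surjective (A.map (IsLocalRing.residue (RingInt K))).mulVec := by
    have : LinearMap.range (A.map (IsLocalRing.residue (RingInt K))).mulVecLin = ⊤ := by
      apply Submodule.eq_top_of_finrank_eq
      rw [Module.finrank_fintype_fun_eq_card]
      exact hA
    exact LinearMap.range_eq_top.1 this
  obtain ⟨B, hB⟩ := Matrix.mulVec_surjective_iff_exists_right_inverse.1 hsurj
  set B' : Matrix (Fin n) ι (RingInt K) := B.map resLift with hB'
  have hBB : B'.map (IsLocalRing.residue (RingInt K)) = B := by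
    ext i j
    simp [hB', residue_resLift]
  have hunit : IsUnit (A * B').det := by
    have h1 : IsLocalRing.residue (RingInt K) (A * B').det = 1 := by
      rw [RingHom.map_det, RingHom.mapMatrix_apply, Matrix.map_mul, hBB, hB, Matrix.det_one]
    refine isUnit_of_map_unit (IsLocalRing.residue (RingInt K)) _ ?_
    rw [h1]
    exact isUnit_one
  refine ⟨B' * (A * B')⁻¹, ?_⟩
  rw [← Matrix.mul_assoc, Matrix.mul_nonsing_inv _ hunit]

theorem norm_integral_mulVec_le {ι κ : Type*} [Fintype κ] (A : Matrix ι κ (RingInt K)) {x : κ → K}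
    {C : ℝ} (hC : 0 ≤ C) (hx : ∀ j, ‖x j‖ ≤ C) (i : ι) :
    ‖(A.map (algebraMap (RingInt K) K)).mulVec x i‖ ≤ C :=
  norm_sum_mul_le hC (fun j => norm_ringInt_le (A i j)) hx

end RightInverse

section Submersion

variable [LocallyCompactSpace K] [MeasurableSpace K] [BorelSpace K]
  {μ : Measure (Fin n → K)} [μ.IsAddHaarMeasure] {ι : Type*} [Fintype ι]

/-- A measure-theoretic form of Hensel's lemma. On the ball of radius 1/q the map differs from its
linear part `A'` by a map with Lipschitz constant 1/q. Absorbing the difference through an integral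
right inverse of `A'` gives an isometry `Φ` with A' ∘ Φ = L. Preimages of boxes thus become
preimages under a surjective linear map, which are translates of each other. -/
theorem isBoxInvariant_map_of_rank {ϖ : RingInt K} (hϖ : IsUniformizer ϖ)
    (hμ : μ {x | ∀ j, ‖x j‖ ≤ 1} = 1) (F : ι → MvPolynomial (Fin n) (RingInt K))
    (z : Fin n → RingInt K)
    (hF : ∀ i, IsLocalRing.residue (RingInt K) (MvPolynomial.eval z (F i)) = 0)
    (hrank : (Matrix.of fun (i : ι) (j : Fin n) => IsLocalRing.residue (RingInt K)
      (MvPolynomial.eval z (MvPolynomial.pderiv j (F i)))).rank = Fintype.card ι) :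
    IsBoxInvariant ((μ.restrict (polyBox (fun j => (z j : K)) 1)).map
      fun u i => (ϖ : K)⁻¹ * MvPolynomial.aeval u (F i)) := by
  classical
  have : ProperSpace K := ProperSpace.of_locallyCompactSpace K
  set q1 := (resCard K : ℝ)⁻¹ with hq1
  have q1pos : 0 < q1 := hϖ.inv_pos
  have q1lt : q1 < 1 := hϖ.inv_lt_one
  set z' : Fin n → K := fun j => (z j : K) with hz'
  have hmeas : Measurable fun (u : Fin n → K) (i : ι) => (ϖ : K)⁻¹ * MvPolynomial.aeval u (F i) :=
    measurable_pi_lambda _ fun i => (measurable_aeval (F i)).const_mul _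
  refine ⟨⟨?_⟩, fun c a hc => ?_⟩
  · rw [Measure.map_apply hmeas MeasurableSet.univ, preimage_univ, Measure.restrict_apply_univ]
    exact haar_polyBox_lt_top hϖ hμ _ _
  set A : Matrix ι (Fin n) (RingInt K) := Matrix.of fun (i : ι) (j : Fin n) =>
    MvPolynomial.eval z (MvPolynomial.pderiv j (F i)) with hA
  obtain ⟨B, hAB⟩ := exists_rightInverse_of_residue_rank A hrank
  set A' := A.map (algebraMap (RingInt K) K) with hA'
  set B' := B.map (algebraMap (RingInt K) K) with hB'
  have hAB' : A' * B' = 1 := by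
    rw [hA', hB', ← Matrix.map_mul, hAB, Matrix.map_one _ (map_zero _) (map_one _)]
  have hAij : ∀ i j, A' i j = MvPolynomial.aeval z' (MvPolynomial.pderiv j (F i)) := fun i j => by
    have : z' = algebraMap (RingInt K) K ∘ z := rfl
    rw [this, MvPolynomial.aeval_algebraMap_apply]
    rfl
  let L : (Fin n → K) → ι → K := fun x i => MvPolynomial.aeval (z' + x) (F i)
  -- The correction term is a strict contraction, so by the ultrametric inequality it does not
  -- affect distances.
  let Φ : (Fin n → K) → Fin n → K := fun x => x + B'.mulVec (L x - A'.mulVec x)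
  have hAΦ : ∀ x, A'.mulVec (Φ x) = L x := fun x => by
    simp only [Φ]
    rw [Matrix.mulVec_add, Matrix.mulVec_mulVec, hAB', Matrix.one_mulVec]
    abel
  have hL0 : ∀ i, ‖L 0 i‖ ≤ q1 := fun i => by
    have : z' + 0 = algebraMap (RingInt K) K ∘ z := by
      rw [add_zero]
      rfl
    simp only [L]
    rw [this, MvPolynomial.aeval_algebraMap_apply, ← hϖ.norm_lt_one_iff]
    exact residue_eq_zero_iff.1 (hF i)
  have hcontr : ∀ x y : Fin n → K, ‖x‖ ≤ q1 → ‖y‖ ≤ q1 → ∀ i,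
      ‖(L x - A'.mulVec x - (L y - A'.mulVec y)) i‖ ≤ q1 * ‖x - y‖ := fun x y hx hy i => by
    have h := norm_taylor_le (F i) (z := z') (u := z' + x) (v := z' + y) q1lt.le
      (fun j => norm_ringInt_le (z j)) (fun j => by simpa using (norm_le_pi_norm x j).trans hx)
      (fun j => by simpa using (norm_le_pi_norm y j).trans hy) (norm_nonneg (x - y))
      ((norm_sub_le_max_of_ultra x y).trans (max_le hx hy))
      (fun j => by simpa using norm_le_pi_norm (x - y) j)
    refine (congrArg norm ?_).trans_le h
    simp only [L, Pi.sub_apply, Matrix.mulVec, dotProduct, hAij, Pi.add_apply,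
      add_sub_add_left_eq_sub, mul_sub, Finset.sum_sub_distrib]
    ring
  have hmaps : ∀ x, ‖x‖ ≤ q1 → ‖Φ x‖ ≤ q1 := fun x hx => by
    refine (IsUltrametricDist.norm_add_le_max _ _).trans (max_le hx ?_)
    refine (pi_norm_le_iff_of_nonneg q1pos.le).2 fun j =>
      norm_integral_mulVec_le B q1pos.le (fun i => ?_) j
    have h := hcontr x 0 hx (by simpa using q1pos.le) i
    rw [sub_zero, Matrix.mulVec_zero, sub_zero, Pi.sub_apply] at h
    rw [← sub_add_cancel ((L x - A'.mulVec x) i) (L 0 i)]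
    refine (IsUltrametricDist.norm_add_le_max _ _).trans (max_le (h.trans ?_) (hL0 i))
    exact mul_le_of_le_one_right q1pos.le (hx.trans q1lt.le)
  have hiso : ∀ x y, ‖x‖ ≤ q1 → ‖y‖ ≤ q1 → ‖Φ x - Φ y‖ = ‖x - y‖ := fun x y hx hy => by
    rcases eq_or_ne x y with rfl | hxy
    · simp
    have h1 : Φ x - Φ y = (x - y) + B'.mulVec (L x - A'.mulVec x - (L y - A'.mulVec y)) := by
      simp only [Φ, Matrix.mulVec_sub]
      abel
    have h2 : ‖B'.mulVec (L x - A'.mulVec x - (L y - A'.mulVec y))‖ ≤ q1 * ‖x - y‖ :=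
      (pi_norm_le_iff_of_nonneg (by positivity)).2 fun j =>
        norm_integral_mulVec_le B (by positivity) (hcontr x y hx hy) j
    have h3 : 0 < ‖x - y‖ := norm_pos_iff.2 (sub_ne_zero.2 hxy)
    have h4 : ‖B'.mulVec (L x - A'.mulVec x - (L y - A'.mulVec y))‖ < ‖x - y‖ := by nlinarith
    rw [h1, IsUltrametricDist.norm_add_eq_max_of_norm_ne_norm h4.ne', max_eq_left h4.le]
  have hball : ∀ x : Fin n → K, x ∈ polyBox z' 1 ↔ -z' + x ∈ Metric.closedBall 0 q1 := fun x => by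
    rw [mem_closedBall_zero_iff, pi_norm_le_iff_of_nonneg q1pos.le]
    simp [polyBox, neg_add_eq_sub, hq1]
  let S : (ι → K) → Set (Fin n → K) := fun c =>
    {v | ∀ i, ‖A'.mulVec v i - ϖ * c i‖ ≤ q1 ^ (a i + 1)}
  have hmain : ∀ c : ι → K, ((μ.restrict (polyBox z' 1)).map
      fun u i => (ϖ : K)⁻¹ * MvPolynomial.aeval u (F i)) (polyBox c a) =
      μ (Metric.closedBall 0 q1 ∩ S c) := fun c => by
    rw [Measure.map_apply hmeas (measurableSet_polyBox _ _),
      Measure.restrict_apply (hmeas (measurableSet_polyBox _ _))]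
    have hset : (fun (u : Fin n → K) (i : ι) => (ϖ : K)⁻¹ * MvPolynomial.aeval u (F i)) ⁻¹'
        polyBox c a ∩ polyBox z' 1 =
        (fun x => -z' + x) ⁻¹' (Metric.closedBall 0 q1 ∩ Φ ⁻¹' S c) := by
      ext u
      rw [mem_inter_iff, and_comm, mem_preimage, mem_preimage, mem_inter_iff, hball]
      refine and_congr_right fun _ => forall_congr' fun i => ?_
      have h1 : ‖(ϖ : K)⁻¹ * MvPolynomial.aeval u (F i) - c i‖ =
          ‖L (-z' + u) i - ϖ * c i‖ / q1 := by
        have h2 : MvPolynomial.aeval u (F i) = L (-z' + u) i := by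
          simp only [L, add_neg_cancel_left]
        have h3 := hϖ.ne_zero
        rw [h2, hq1, ← hϖ.norm_eq, ← norm_div]
        congr 1
        field_simp
      rw [h1, hAΦ, div_le_iff₀ q1pos, pow_succ]
    rw [hset, measure_preimage_add]
    -- This `ρ` is at most every `q1 ^ (a i + 1)`, so `S c` is a union of ρ-balls; the extra 1 keeps
    -- `ρ ≤ q1`.
    refine measure_preimage_isometry (ρ := q1 ^ (∑ i, a i + 1)) (pow_pos q1pos _) ?_ hmaps hiso ?_
    · exact pow_le_of_le_one q1pos.le q1lt.le (Nat.succ_ne_zero _)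
    have hone : ∀ x y, ‖x - y‖ ≤ q1 ^ (∑ i, a i + 1) → x ∈ S c → y ∈ S c := fun x y hxy hx i => by
      have h1 := norm_integral_mulVec_le A (pow_pos q1pos _).le
        (fun j => (norm_le_pi_norm (y - x) j).trans (norm_sub_rev x y ▸ hxy)) i
      rw [← hA', Matrix.mulVec_sub, Pi.sub_apply] at h1
      rw [← sub_add_sub_cancel (A'.mulVec y i) (A'.mulVec x i) (ϖ * c i)]
      refine (IsUltrametricDist.norm_add_le_max _ _).trans (max_le (h1.trans ?_) (hx i))
      refine pow_le_pow_of_le_one q1pos.le q1lt.le (Nat.succ_le_succ ?_)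
      exact Finset.single_le_sum (f := a) (fun _ _ => Nat.zero_le _) (Finset.mem_univ i)
    exact fun x y hxy => ⟨hone x y hxy, hone y x (norm_sub_rev x y ▸ hxy)⟩
  rw [measureReal_def, measureReal_def, hmain, hmain]
  congr 1
  have hBc : ‖B'.mulVec ((ϖ : K) • c)‖ ≤ q1 :=
    (pi_norm_le_iff_of_nonneg q1pos.le).2 fun j => norm_integral_mulVec_le B q1pos.le
      (fun i => by
        rw [Pi.smul_apply, smul_eq_mul, norm_mul, hϖ.norm_eq]
        exact mul_le_of_le_one_right q1pos.le (hc i)) j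
  -- `A'` maps this vector to `ϖ • c`, and its norm is at most `q1`: the translation carries `S 0`
  -- to `S c` and preserves the ball.
  rw [← measure_preimage_add μ (B'.mulVec ((ϖ : K) • c))]
  congr 1
  ext x
  refine and_congr ?_ (forall_congr' fun i => ?_)
  · rw [mem_closedBall_zero_iff, mem_closedBall_zero_iff]
    constructor
    · intro h
      rw [← add_sub_cancel_left (B'.mulVec ((ϖ : K) • c)) x]
      exact (norm_sub_le_max_of_ultra _ _).trans (max_le h hBc)
    · exact fun h => (IsUltrametricDist.norm_add_le_max _ _).trans (max_le hBc h)
  · rw [Matrix.mulVec_add, Matrix.mulVec_mulVec, hAB', Matrix.one_mulVec]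
    simp

end Submersion

end NewtonZeta

/-! ### Rescaling by powers of ϖ, and level sets on a residue class. -/

namespace NewtonZeta

variable {K : Type*} [NontriviallyNormedField K] [IsUltrametricDist K] {n : ℕ}

section Rescaling

/-- The pairing of two vectors of natural numbers. -/
def natPairing (k : Fin n → ℕ) (m : Fin n →₀ ℕ) : ℕ := ∑ j, k j * m j

theorem pairing_toReal (k : Fin n → ℕ) (m : Fin n →₀ ℕ) :
    pairing (toReal k) m = (natPairing k m : ℝ) := by
  simp [pairing, toReal, natPairing]

theorem toReal_nonneg (k : Fin n → ℕ) (j : Fin n) : 0 ≤ toReal k j := Nat.cast_nonneg _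

/-- `F` and `d` describe the polynomial `f(ϖ ^ k x)` as `ϖ ^ d F(x)`, where `d = d(k, Γ(f))` and
`F` reduces to the reduction of the face function `f_k`. -/
structure IsRescaling (ϖ : RingInt K) (f : MvPolynomial (Fin n) (RingInt K)) (k : Fin n → ℕ)
    (F : MvPolynomial (Fin n) (RingInt K)) (d : ℕ) : Prop where
  dist_eq : dist (toReal k) (newtonPolyhedron f) = d
  aeval_eq : ∀ u : Fin n → K, MvPolynomial.aeval (fun j => (ϖ : K) ^ k j * u j) f =
    (ϖ : K) ^ d * MvPolynomial.aeval u F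
  reduction_eq : reduction F = reduction (faceFun f (toReal k))

/-- The monomial with exponent m acquires the factor ϖ^{⟨k,m⟩}. Dividing by the least such power
leaves integral coefficients, and only the monomials that attain the minimum, those of the face
function, can survive modulo ϖ. -/
theorem exists_isRescaling {ϖ : RingInt K} (hϖ : IsUniformizer ϖ)
    {f : MvPolynomial (Fin n) (RingInt K)} (hf : f ≠ 0) (k : Fin n → ℕ) :
    ∃ F d, IsRescaling ϖ f k F d := by
  classical
  obtain ⟨m₀, hm₀, hd⟩ := exists_dist_eq hf (toReal_nonneg k)
  rw [pairing_toReal] at hd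
  have hle : ∀ m ∈ f.support, natPairing k m₀ ≤ natPairing k m := fun m hm => by
    have := dist_le (toReal_nonneg k) hm
    rw [hd, pairing_toReal] at this
    exact_mod_cast this
  refine ⟨∑ m ∈ f.support,
    MvPolynomial.monomial m (f.coeff m * ϖ ^ (natPairing k m - natPairing k m₀)),
    natPairing k m₀, hd, fun u => ?_, ?_⟩
  · rw [MvPolynomial.aeval_def, MvPolynomial.eval₂_eq', map_sum, Finset.mul_sum]
    refine Finset.sum_congr rfl fun m hm => ?_
    rw [MvPolynomial.aeval_monomial, Finsupp.prod_fintype _ _ (fun _ => pow_zero _)]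
    simp only [mul_pow, ← pow_mul, Finset.prod_mul_distrib, Finset.prod_pow_eq_pow_sum]
    change _ * ((ϖ : K) ^ natPairing k m * _) = _
    conv_lhs => rw [← Nat.add_sub_of_le (hle m hm), pow_add]
    simp only [map_mul, map_pow, show algebraMap (RingInt K) K ϖ = (ϖ : K) from rfl]
    ring
  · have hϖ0 : IsLocalRing.residue (RingInt K) ϖ = 0 := by
      rw [residue_eq_zero_iff, hϖ.norm_eq]
      exact hϖ.inv_lt_one
    ext m
    rw [reduction, reduction, MvPolynomial.coeff_map, MvPolynomial.coeff_map, coeff_faceFun,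
      MvPolynomial.coeff_sum]
    simp only [MvPolynomial.coeff_monomial, Finset.sum_ite_eq']
    by_cases hm : m ∈ f.support
    · rw [if_pos hm, hd, pairing_toReal, map_mul, map_pow, hϖ0]
      by_cases h : natPairing k m = natPairing k m₀
      · rw [if_pos (by rw [h])]
        simp [h]
      · rw [if_neg (by exact_mod_cast h), zero_pow, mul_zero, map_zero]
        have := hle m hm
        omega
    · rw [if_neg hm, MvPolynomial.notMem_support_iff.1 hm, ite_self]

end Rescaling

section Scaling

variable [LocallyCompactSpace K] [MeasurableSpace K] [BorelSpace K]
  {μ : Measure (Fin n → K)} [μ.IsAddHaarMeasure]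

/-- Multiplication of the `j`-th coordinate by `ϖ ^ (-k j)`. -/
def unscale (ϖ : K) (k : Fin n → ℕ) (x : Fin n → K) : Fin n → K := fun j => (ϖ ^ k j)⁻¹ * x j

/-- The image of `μ` under a linear automorphism is again a Haar measure, hence a multiple of `μ`;
the unit polydisc, whose preimage is `polyBox 0 k`, determines the constant. -/
theorem haar_real_preimage_unscale {ϖ : RingInt K} (hϖ : IsUniformizer ϖ)
    (hμ : μ {x | ∀ j, ‖x j‖ ≤ 1} = 1) (k : Fin n → ℕ) {Y : Set (Fin n → K)}
    (hY : MeasurableSet Y) :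
    μ.real (unscale (ϖ : K) k ⁻¹' Y) = (∏ j, (resCard K : ℝ)⁻¹ ^ k j) * μ.real Y := by
  have := secondCountable_of_locallyCompact K
  let e : (Fin n → K) ≃L[K] (Fin n → K) := ContinuousLinearEquiv.piCongrRight fun j =>
    ContinuousLinearEquiv.unitsEquivAut K (Units.mk0 ((ϖ : K) ^ k j) (pow_ne_zero _ hϖ.ne_zero))⁻¹
  have he : (e : (Fin n → K) → Fin n → K) = unscale (ϖ : K) k := by
    ext x j
    simp [e, unscale, mul_comm]
  have hmeas : Measurable (unscale (ϖ : K) k : (Fin n → K) → Fin n → K) := by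
    rw [← he]
    exact e.continuous.measurable
  have hH : (μ.map (unscale (ϖ : K) k)).IsAddHaarMeasure := by
    rw [← he]
    exact e.isAddHaarMeasure_map μ
  have hc := Measure.isAddLeftInvariant_eq_smul (μ.map (unscale (ϖ : K) k)) μ
  set c := (μ.map (unscale (ϖ : K) k)).addHaarScalarFactor μ
  have key : ∀ Y : Set (Fin n → K), MeasurableSet Y →
      μ.real (unscale (ϖ : K) k ⁻¹' Y) = c * μ.real Y := fun Y hY => by
    rw [measureReal_def, ← Measure.map_apply hmeas hY, hc, Measure.smul_apply,
      ENNReal.smul_def, smul_eq_mul, ENNReal.toReal_mul]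
    rfl
  have h1 := key (polyBox 0 0) (measurableSet_polyBox _ _)
  have h2 : unscale (ϖ : K) k ⁻¹' polyBox 0 0 = polyBox 0 k := by
    ext x
    refine forall_congr' fun j => ?_
    have := pow_pos hϖ.inv_pos (k j)
    simp only [unscale, Pi.zero_apply, sub_zero, pow_zero]
    rw [norm_mul, norm_inv, norm_pow, hϖ.norm_eq, inv_mul_le_iff₀ this, mul_one]
  rw [h2, haar_real_polyBox hϖ hμ, haar_real_polyBox hϖ hμ] at h1
  rw [key Y hY, h1]
  simp

end Scaling

section Residue

variable {r : ℕ}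

/-- The probability that a polynomial has norm `q ^ (-a)` on a residue class, according to
whether its reduction vanishes there (and then is a submersion) or not. -/
def levelWeight (K : Type*) [NontriviallyNormedField K] [IsUltrametricDist K] (p : Prop)
    (a : ℕ) : ℝ :=
  open scoped Classical in
  if p then (if a = 0 then 0 else ((resCard K : ℝ) - 1) * (resCard K : ℝ)⁻¹ ^ a)
  else (if a = 0 then 1 else 0)

/-- The part of the residue class of `z` on which the `F i` have norm `q ^ (-a i)`. -/
def levelSet (F : Fin r → MvPolynomial (Fin n) (RingInt K)) (z : Fin n → ResField K)
    (a : Fin r → ℕ) : Set (Fin n → K) :=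
  {u | u ∈ polyBox (fun j => (resLift (z j) : K)) 1 ∧
    ∀ i, ‖MvPolynomial.aeval u (F i)‖ = (resCard K : ℝ)⁻¹ ^ a i}

theorem norm_aeval_lt_one_iff {ϖ : RingInt K} (hϖ : IsUniformizer ϖ)
    (F : MvPolynomial (Fin n) (RingInt K)) {z : Fin n → ResField K} {u : Fin n → K}
    (hu : u ∈ polyBox (fun j => (resLift (z j) : K)) 1) :
    ‖MvPolynomial.aeval u F‖ ≤ (resCard K : ℝ)⁻¹ ↔ MvPolynomial.eval z (reduction F) = 0 := by
  have hu1 : ∀ j, ‖u j‖ ≤ 1 := fun j => by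
    rw [← sub_add_cancel (u j) (resLift (z j) : K)]
    refine (IsUltrametricDist.norm_add_le_max _ _).trans (max_le ((hu j).trans ?_)
      (norm_ringInt_le _))
    exact pow_le_one₀ hϖ.inv_pos.le hϖ.inv_lt_one.le
  let u' : Fin n → RingInt K := fun j => ⟨u j, mem_ringInt.2 (hu1 j)⟩
  have hz : (fun j => IsLocalRing.residue (RingInt K) (u' j)) = z := by
    ext j
    refine (norm_sub_resLift_le hϖ).1 ?_
    simpa using hu j
  have h1 : MvPolynomial.aeval u F = (MvPolynomial.eval u' F : RingInt K) := by
    have : u = algebraMap (RingInt K) K ∘ u' := rfl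
    rw [this, MvPolynomial.aeval_algebraMap_apply]
    rfl
  rw [h1, ← hϖ.norm_lt_one_iff, ← residue_eq_zero_iff, residue_eval, hz]

variable [LocallyCompactSpace K] [MeasurableSpace K] [BorelSpace K]
  {μ : Measure (Fin n → K)} [μ.IsAddHaarMeasure]

theorem measurableSet_levelSet (F : Fin r → MvPolynomial (Fin n) (RingInt K))
    (z : Fin n → ResField K) (a : Fin r → ℕ) : MeasurableSet (levelSet F z a) := by
  have : {u : Fin n → K | ∀ i, ‖MvPolynomial.aeval u (F i)‖ = (resCard K : ℝ)⁻¹ ^ a i} =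
      ⋂ i, (fun u : Fin n → K => ‖MvPolynomial.aeval u (F i)‖) ⁻¹' {(resCard K : ℝ)⁻¹ ^ a i} := by
    ext u
    simp
  change MeasurableSet (polyBox _ 1 ∩
    {u : Fin n → K | ∀ i, ‖MvPolynomial.aeval u (F i)‖ = (resCard K : ℝ)⁻¹ ^ a i})
  rw [this]
  exact (measurableSet_polyBox _ _).inter (MeasurableSet.iInter fun i =>
    (measurable_aeval (F i)).norm (measurableSet_singleton _))

/-- Polynomials with non-vanishing reduction at `z` have norm 1 on the whole class and impose no
condition beyond a i = 0. The remaining ones, divided by ϖ, push the class of mass q^{-n} forward to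
a box-invariant measure, for which the level set is the preimage of a product of spheres. -/
theorem haar_real_levelSet {ϖ : RingInt K} (hϖ : IsUniformizer ϖ)
    (hμ : μ {x | ∀ j, ‖x j‖ ≤ 1} = 1) (F : Fin r → MvPolynomial (Fin n) (RingInt K))
    (z : Fin n → ResField K)
    (hrank : ∀ I : Finset (Fin r), I.Nonempty →
      (∀ i, MvPolynomial.eval z (reduction (F i)) = 0 ↔ i ∈ I) →
      (Matrix.of fun (i : I) (j : Fin n) =>
        MvPolynomial.eval z (MvPolynomial.pderiv j (reduction (F i)))).rank = I.card)
    (a : Fin r → ℕ) :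
    μ.real (levelSet F z a) = (resCard K : ℝ)⁻¹ ^ n *
      ∏ i, levelWeight K (MvPolynomial.eval z (reduction (F i)) = 0) (a i) := by
  classical
  -- A zero weight means that `a i` is incompatible with the reduction at `z`, and then the level
  -- set is empty.
  by_cases h0 : ∃ i, levelWeight K (MvPolynomial.eval z (reduction (F i)) = 0) (a i) = 0
  · obtain ⟨i, hi⟩ := h0
    rw [Finset.prod_eq_zero (Finset.mem_univ i) hi, mul_zero]
    have : levelSet F z a = ∅ := by
      rw [eq_empty_iff_forall_notMem]
      rintro u ⟨hu, hu'⟩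
      have h1 := norm_aeval_lt_one_iff hϖ (F i) hu
      rw [hu' i] at h1
      simp only [levelWeight] at hi
      split_ifs at hi with hv ha ha
      · rw [ha, pow_zero] at h1
        exact (h1.2 hv).not_gt hϖ.inv_lt_one
      · have := hϖ.one_lt
        have h2 : (1 : ℝ) < resCard K := by exact_mod_cast this
        have h3 : 0 < ((resCard K : ℝ) - 1) * (resCard K : ℝ)⁻¹ ^ a i :=
          mul_pos (by linarith) (pow_pos hϖ.inv_pos _)
        exact h3.ne' hi
      · exact one_ne_zero hi
      · exact hv (h1.1 (pow_le_of_le_one hϖ.inv_pos.le hϖ.inv_lt_one.le ha))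
    rw [this, measureReal_empty]
  push Not at h0
  set I : Finset (Fin r) := Finset.univ.filter
    fun i => MvPolynomial.eval z (reduction (F i)) = 0 with hI
  have hmemI : ∀ i, MvPolynomial.eval z (reduction (F i)) = 0 ↔ i ∈ I := fun i => by simp [hI]
  have hpos : ∀ i ∈ I, a i ≠ 0 := fun i hi h => h0 i (by
    rw [levelWeight, if_pos ((hmemI i).2 hi), if_pos h])
  have hzero : ∀ i, i ∉ I → a i = 0 := fun i hi => by
    by_contra h
    exact h0 i (by rw [levelWeight, if_neg (fun h' => hi ((hmemI i).1 h')), if_neg h])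
  have hres : (fun j => IsLocalRing.residue (RingInt K) (resLift (z j))) = z :=
    funext fun j => residue_resLift (z j)
  have hinv := isBoxInvariant_map_of_rank (μ := μ) hϖ hμ (fun i : I => F i)
    (fun j => resLift (z j)) (fun i => by rw [residue_eval, hres]; exact (hmemI i).2 i.2) (by
      rw [Fintype.card_coe]
      have hM : (Matrix.of fun (i : I) (j : Fin n) => IsLocalRing.residue (RingInt K)
          (MvPolynomial.eval (fun j => resLift (z j)) (MvPolynomial.pderiv j (F i)))) =
          Matrix.of fun (i : I) (j : Fin n) =>
            MvPolynomial.eval z (MvPolynomial.pderiv j (reduction (F i))) := by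
        ext i j
        simp only [Matrix.of_apply]
        rw [residue_eval, hres, reduction, reduction, MvPolynomial.pderiv_map]
      rw [hM]
      -- The rank hypothesis concerns non-empty `I` only; a matrix without rows has rank 0.
      rcases I.eq_empty_or_nonempty with hIe | hIn
      · have : IsEmpty I := by
          rw [hIe]
          infer_instance
        have h1 := Matrix.rank_le_card_height (Matrix.of fun (i : I) (j : Fin n) =>
          MvPolynomial.eval z (MvPolynomial.pderiv j (reduction (F i))))
        rw [Fintype.card_coe] at h1
        rw [hIe, Finset.card_empty] at h1 ⊢
        omega
      · exact hrank I hIn hmemI)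
  have hmeas : Measurable fun (u : Fin n → K) (i : I) =>
      (ϖ : K)⁻¹ * MvPolynomial.aeval u (F i) :=
    measurable_pi_lambda _ fun i => (measurable_aeval (F i)).const_mul _
  have hball : ∀ u ∈ polyBox (fun j => (resLift (z j) : K)) 1, ∀ i ∈ I,
      ‖MvPolynomial.aeval u (F i)‖ ≤ (resCard K : ℝ)⁻¹ := fun u hu i hi =>
    (norm_aeval_lt_one_iff hϖ (F i) hu).2 ((hmemI i).2 hi)
  have hscaled : ∀ (u : Fin n → K) (i : Fin r), ‖(ϖ : K)⁻¹ * MvPolynomial.aeval u (F i)‖ =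
      ‖MvPolynomial.aeval u (F i)‖ / (resCard K : ℝ)⁻¹ := fun u i => by
    rw [norm_mul, norm_inv, hϖ.norm_eq, mul_comm, div_eq_mul_inv]
  -- Division by ϖ lowers each order by one; on `I` all `a i` are positive, so the truncated
  -- subtraction is exact.
  have hsph : MeasurableSet (polySphere (K := K) fun i : I => a i - 1) := by
    rw [polySphere_eq_iUnion hϖ]
    have := hϖ.finite
    exact MeasurableSet.iUnion fun _ => measurableSet_polyBox _ _
  have h1 := hinv.measureReal_polySphere hϖ (fun i : I => a i - 1)
  rw [map_measureReal_apply hmeas hsph, map_measureReal_apply hmeas (measurableSet_polyBox _ _),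
    measureReal_restrict_apply (hmeas hsph),
    measureReal_restrict_apply (hmeas (measurableSet_polyBox _ _))] at h1
  have e1 : (fun (u : Fin n → K) (i : I) => (ϖ : K)⁻¹ * MvPolynomial.aeval u (F i)) ⁻¹'
      (polySphere fun i : I => a i - 1) ∩ polyBox (fun j => (resLift (z j) : K)) 1 =
      levelSet F z a := by
    ext u
    rw [inter_comm]
    refine and_congr_right fun hu => ?_
    have hI' : ∀ i ∈ I, ‖(ϖ : K)⁻¹ * MvPolynomial.aeval u (F i)‖ = (resCard K : ℝ)⁻¹ ^ (a i - 1) ↔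
        ‖MvPolynomial.aeval u (F i)‖ = (resCard K : ℝ)⁻¹ ^ a i := fun i hi => by
      rw [hscaled, div_eq_iff hϖ.inv_pos.ne', ← pow_succ, Nat.sub_add_cancel
        (Nat.pos_of_ne_zero (hpos i hi))]
    constructor
    · intro h i
      by_cases hi : i ∈ I
      · exact (hI' i hi).1 (h ⟨i, hi⟩)
      · rw [hzero i hi, pow_zero]
        have h2 := mt (norm_aeval_lt_one_iff hϖ (F i) hu).1 (mt (hmemI i).1 hi)
        rw [← hϖ.norm_lt_one_iff, not_lt] at h2
        refine le_antisymm (norm_aeval_le _ fun j => ?_) h2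
        rw [← sub_add_cancel (u j) (resLift (z j) : K)]
        refine (IsUltrametricDist.norm_add_le_max _ _).trans (max_le ((hu j).trans ?_)
          (norm_ringInt_le _))
        exact pow_le_one₀ hϖ.inv_pos.le hϖ.inv_lt_one.le
    · exact fun h i => (hI' i i.2).2 (h i)
  have e2 : (fun (u : Fin n → K) (i : I) => (ϖ : K)⁻¹ * MvPolynomial.aeval u (F i)) ⁻¹'
      (polyBox 0 0) ∩ polyBox (fun j => (resLift (z j) : K)) 1 =
      polyBox (fun j => (resLift (z j) : K)) 1 := by
    refine inter_eq_right.2 fun u hu => ?_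
    rw [mem_preimage, mem_polyBox_zero_zero]
    intro i
    rw [hscaled]
    exact div_le_one_of_le₀ (hball u hu i i.2) hϖ.inv_pos.le
  rw [e1, e2, haar_real_polyBox hϖ hμ] at h1
  rw [h1]
  congr 1
  · simp
  · rw [← Finset.prod_subset (Finset.subset_univ I) (fun i _ hi => ?_),
      ← Finset.prod_coe_sort (M := ℝ) I]
    · refine Finset.prod_congr rfl fun i _ => ?_
      rw [levelWeight, if_pos ((hmemI i).2 i.2), if_neg (hpos i i.2), Nat.sub_add_cancel
        (Nat.pos_of_ne_zero (hpos i i.2))]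
    · rw [levelWeight, if_neg (fun h => hi ((hmemI i).1 h)), if_pos (hzero i hi)]

end Residue

end NewtonZeta

/-! ### Products of series, and the geometric series of the level weights. -/

namespace NewtonZeta

section ProductSeries

variable {𝕜 : Type*} [NormedField 𝕜] [CompleteSpace 𝕜]

/-- Absolute summability is carried along because multiplying in the next series requires it. -/
theorem hasSum_prod_fin (m : ℕ) (f : Fin m → ℕ → 𝕜) (hf : ∀ i, Summable fun a => ‖f i a‖) :
    (Summable fun a : Fin m → ℕ => ‖∏ i, f i (a i)‖) ∧
      HasSum (fun a : Fin m → ℕ => ∏ i, f i (a i)) (∏ i, ∑' a, f i a) := by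
  induction m with
  | zero =>
    simp only [Finset.univ_eq_empty, Finset.prod_empty]
    exact ⟨(hasSum_fintype _).summable, by simp⟩
  | succ m ih =>
    obtain ⟨h1, h2⟩ := ih (fun i => f i.succ) fun i => hf i.succ
    have hs := (hf 0).mul_of_nonneg h1 (fun _ => norm_nonneg _) fun _ => norm_nonneg _
    simp only [← norm_mul] at hs
    have hsum := (hf 0).of_norm.hasSum.mul h2 hs.of_norm
    have e : ∀ a : Fin (m + 1) → ℕ, ∏ i, f i (a i) =
        f 0 ((Fin.consEquiv fun _ => ℕ).symm a).1 *
          ∏ i, f (Fin.succ i) (((Fin.consEquiv fun _ => ℕ).symm a).2 i) := fun a =>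
      Fin.prod_univ_succ _
    simp only [e, Fin.prod_univ_succ (fun i => ∑' a, f i a)]
    let g : ℕ × (Fin m → ℕ) → 𝕜 := fun p => f 0 p.1 * ∏ i, f (Fin.succ i) (p.2 i)
    exact ⟨(Equiv.summable_iff (f := fun p => ‖g p‖) (Fin.consEquiv fun _ => ℕ).symm).2 hs,
      (Equiv.hasSum_iff (f := g) (Fin.consEquiv fun _ => ℕ).symm).2 hsum⟩

/-- The product of finitely many absolutely convergent series, as a series over tuples. -/
theorem hasSum_prod_pi {ι : Type*} [Fintype ι] (f : ι → ℕ → 𝕜)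
    (hf : ∀ i, Summable fun a => ‖f i a‖) :
    (Summable fun a : ι → ℕ => ‖∏ i, f i (a i)‖) ∧
      HasSum (fun a : ι → ℕ => ∏ i, f i (a i)) (∏ i, ∑' a, f i a) := by
  let e := (Fintype.equivFin ι).symm
  obtain ⟨h1, h2⟩ := hasSum_prod_fin _ (fun i => f (e i)) fun i => hf (e i)
  have hcomp : ∀ a : ι → ℕ, ∏ i, f i (a i) = ∏ i, f (e i) (a (e i)) := fun a =>
    (Equiv.prod_comp e fun i => f i (a i)).symm
  rw [Equiv.prod_comp e fun i => ∑' a, f i a] at h2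
  simp only [hcomp]
  let g : (Fin (Fintype.card ι) → ℕ) → 𝕜 := fun a => ∏ i, f (e i) (a i)
  exact ⟨(Equiv.summable_iff (f := fun p => ‖g p‖) (Equiv.arrowCongr e.symm (Equiv.refl ℕ))).2 h1,
    (Equiv.hasSum_iff (f := g) (Equiv.arrowCongr e.symm (Equiv.refl ℕ))).2 h2⟩

end ProductSeries

variable {K : Type*} [NontriviallyNormedField K] [IsUltrametricDist K] {n r : ℕ}

section LevelSum

variable {ϖ : RingInt K}

theorem IsUniformizer.natCast_ne_zero (hϖ : IsUniformizer ϖ) : (resCard K : ℂ) ≠ 0 := by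
  have := hϖ.one_lt
  exact_mod_cast (by omega : resCard K ≠ 0)

theorem IsUniformizer.inv_pow_cpow (hϖ : IsUniformizer ϖ) (m : ℕ) (s : ℂ) :
    (((resCard K : ℝ)⁻¹ ^ m : ℝ) : ℂ) ^ s = (resCard K : ℂ) ^ (-(m : ℂ) * s) := by
  have h1 := pow_pos hϖ.inv_pos m
  rw [Complex.cpow_def_of_ne_zero (by exact_mod_cast h1.ne'),
    Complex.cpow_def_of_ne_zero hϖ.natCast_ne_zero, ← Complex.ofReal_log h1.le, Real.log_pow,
    Real.log_inv, ← Complex.natCast_log]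
  push_cast
  congr 1
  ring

theorem IsUniformizer.norm_cpow (hϖ : IsUniformizer ϖ) (w : ℂ) :
    ‖(resCard K : ℂ) ^ w‖ = (resCard K : ℝ) ^ w.re :=
  Complex.norm_natCast_cpow_of_pos (by have := hϖ.one_lt; omega) w

theorem IsUniformizer.norm_cpow_lt_one (hϖ : IsUniformizer ϖ) {w : ℂ} (hw : w.re < 0) :
    ‖(resCard K : ℂ) ^ w‖ < 1 := by
  rw [hϖ.norm_cpow]
  exact Real.rpow_lt_one_of_one_lt_of_neg (by exact_mod_cast hϖ.one_lt) hw

theorem IsUniformizer.one_sub_cpow_ne_zero (hϖ : IsUniformizer ϖ) {w : ℂ} (hw : w.re < 0) :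
    1 - (resCard K : ℂ) ^ w ≠ 0 := by
  intro h
  have h1 := hϖ.norm_cpow_lt_one hw
  rw [← sub_eq_zero.1 h, norm_one] at h1
  exact h1.false

theorem IsUniformizer.cpow_natCast_mul (hϖ : IsUniformizer ϖ) (a : ℕ) (s : ℂ) :
    ((resCard K : ℝ)⁻¹ ^ a : ℂ) * (resCard K : ℂ) ^ (-(a : ℂ) * s) =
      ((resCard K : ℂ) ^ (-1 - s)) ^ a := by
  rw [← Complex.cpow_nat_mul, show (a : ℂ) * (-1 - s) = -(a : ℂ) + -(a : ℂ) * s by ring,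
    Complex.cpow_add _ _ hϖ.natCast_ne_zero, Complex.cpow_neg, Complex.cpow_natCast]
  simp

/-- The sum of the series `∑ levelWeight p a * q ^ (-a s)`. -/
def levelSum (K : Type*) [NontriviallyNormedField K] [IsUltrametricDist K] (p : Prop) (s : ℂ) :
    ℂ :=
  open scoped Classical in
  if p then ((resCard K : ℂ) - 1) * (resCard K : ℂ) ^ (-1 - s) /
    (1 - (resCard K : ℂ) ^ (-1 - s)) else 1

/-- The constant q covers both cases of the weight, so the geometric majorant does not depend on the
residue point and dominates uniformly over all cells. -/
theorem IsUniformizer.norm_levelWeight_mul_le (hϖ : IsUniformizer ϖ) (p : Prop) (s : ℂ) (a : ℕ) :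
    ‖(levelWeight K p a : ℂ) * (resCard K : ℂ) ^ (-(a : ℂ) * s)‖ ≤
      (resCard K : ℝ) * ‖(resCard K : ℂ) ^ (-1 - s)‖ ^ a := by
  have h1 : (1 : ℝ) < resCard K := by exact_mod_cast hϖ.one_lt
  have h2 : |levelWeight K p a| ≤ (resCard K : ℝ) * (resCard K : ℝ)⁻¹ ^ a := by
    have h0 := pow_pos hϖ.inv_pos a
    rw [levelWeight]
    split_ifs with hp ha ha
    · rw [abs_zero]
      positivity
    · rw [abs_of_nonneg (mul_nonneg (by linarith) h0.le)]
      exact mul_le_mul_of_nonneg_right (by linarith) h0.le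
    · rw [ha]
      simpa using h1.le
    · rw [abs_zero]
      positivity
  rw [← norm_pow, ← hϖ.cpow_natCast_mul, norm_mul, norm_mul, Complex.norm_real, Real.norm_eq_abs,
    ← mul_assoc]
  refine mul_le_mul_of_nonneg_right (h2.trans_eq ?_) (norm_nonneg _)
  rw [norm_pow, Complex.norm_real, Real.norm_of_nonneg hϖ.inv_pos.le]

theorem IsUniformizer.summable_levelWeight (hϖ : IsUniformizer ϖ) {s : ℂ} (hs : -1 < s.re) :
    Summable fun a : ℕ => (resCard K : ℝ) * ‖(resCard K : ℂ) ^ (-1 - s)‖ ^ a := by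
  refine Summable.mul_left _ (summable_geometric_of_lt_one (norm_nonneg _) ?_)
  refine hϖ.norm_cpow_lt_one ?_
  simp only [Complex.sub_re, Complex.neg_re, Complex.one_re]
  linarith

theorem IsUniformizer.tsum_levelWeight (hϖ : IsUniformizer ϖ) (p : Prop) {s : ℂ}
    (hs : -1 < s.re) :
    ∑' a : ℕ, (levelWeight K p a : ℂ) * (resCard K : ℂ) ^ (-(a : ℂ) * s) = levelSum K p s := by
  rw [levelSum]
  split_ifs with hp
  · have hx : ‖(resCard K : ℂ) ^ (-1 - s)‖ < 1 := by
      refine hϖ.norm_cpow_lt_one ?_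
      simp only [Complex.sub_re, Complex.neg_re, Complex.one_re]
      linarith
    have hsum := (hasSum_geometric_of_norm_lt_one hx).mul_left
      (((resCard K : ℂ) - 1) * (resCard K : ℂ) ^ (-1 - s))
    rw [← div_eq_mul_inv] at hsum
    refine HasSum.tsum_eq ?_
    -- A vanishing reduction excludes a = 0, so the geometric series starts at a = 1.
    rw [← hasSum_nat_add_iff' 1, Finset.sum_range_one]
    simp only [levelWeight, if_pos hp, if_true, Complex.ofReal_zero, zero_mul, sub_zero]
    refine (funext fun a => ?_ : _ = fun a : ℕ => _) ▸ hsum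
    rw [if_neg (Nat.succ_ne_zero a), mul_assoc, ← pow_succ', ← hϖ.cpow_natCast_mul]
    push_cast
    ring
  · rw [tsum_eq_single 0]
    · simp [levelWeight, hp]
    · intro a ha
      simp [levelWeight, hp, ha]

end LevelSum

/-! ### Decomposition of the domain of integration into cells. -/

section Cells

variable {ϖ : RingInt K}

/-- The points of the torus over the residue field. -/
abbrev ResTorus (K : Type*) [NontriviallyNormedField K] [IsUltrametricDist K] (n : ℕ) : Type _ :=
  Fin n → {r : ResField K // r ≠ 0}

/-- The piece of `Kⁿ` on which `|x j| = q ^ (-k j)`, the angular components are `z`, and the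
norms of the rescaled polynomials are `q ^ (-a i)`. -/
def cell (ϖ : RingInt K) (F : Fin r → (Fin n → ℕ) → MvPolynomial (Fin n) (RingInt K))
    (x : (Fin n → ℕ) × ResTorus K n × (Fin r → ℕ)) : Set (Fin n → K) :=
  unscale (ϖ : K) x.1 ⁻¹' levelSet (fun i => F i x.1) (fun j => (x.2.1 j : ResField K)) x.2.2

variable {h : Fin r → MvPolynomial (Fin n) (RingInt K)}
  {F : Fin r → (Fin n → ℕ) → MvPolynomial (Fin n) (RingInt K)} {d : Fin r → (Fin n → ℕ) → ℕ}

theorem scale_unscale (hϖ : IsUniformizer ϖ) (k : Fin n → ℕ) (x : Fin n → K) :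
    (fun j => (ϖ : K) ^ k j * unscale (ϖ : K) k x j) = x := by
  ext j
  have := pow_ne_zero (k j) hϖ.ne_zero
  simp only [unscale]
  field_simp

theorem norm_of_mem_cell (hϖ : IsUniformizer ϖ) (hF : ∀ i k, IsRescaling ϖ (h i) k (F i k) (d i k))
    {k : Fin n → ℕ} {z : ResTorus K n} {a : Fin r → ℕ} {x : Fin n → K}
    (hx : x ∈ cell ϖ F (k, z, a)) :
    (∀ j, ‖x j‖ = (resCard K : ℝ)⁻¹ ^ k j) ∧
      ∀ i, ‖MvPolynomial.aeval x (h i)‖ = (resCard K : ℝ)⁻¹ ^ (d i k + a i) := by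
  obtain ⟨h1, h2⟩ := hx
  have e := scale_unscale hϖ k x
  refine ⟨fun j => ?_, fun i => ?_⟩
  · have h3 : ‖unscale (ϖ : K) k x j - resLift (z j : ResField K)‖ < 1 :=
      hϖ.norm_lt_one_iff.2 (by simpa using h1 j)
    have h4 : ‖(resLift (z j : ResField K) : K)‖ = 1 := by
      refine le_antisymm (norm_ringInt_le _) (not_lt.1 fun h => (z j).2 ?_)
      rw [← residue_eq_zero_iff, residue_resLift] at h
      exact h
    have h5 : ‖unscale (ϖ : K) k x j‖ = 1 := by
      rw [← h4] at h3
      rw [← sub_add_cancel (unscale (ϖ : K) k x j) (resLift (z j : ResField K) : K),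
        IsUltrametricDist.norm_add_eq_max_of_norm_ne_norm h3.ne, max_eq_right h3.le, h4]
    rw [← congrFun e j, norm_mul, h5, norm_pow, hϖ.norm_eq, mul_one]
  · have h3 := h2 i
    rw [← e, (hF i k).aeval_eq, norm_mul, norm_pow, hϖ.norm_eq, h3, pow_add]

theorem cell_subset_zetaDomain (hϖ : IsUniformizer ϖ)
    (hF : ∀ i k, IsRescaling ϖ (h i) k (F i k) (d i k))
    (y : (Fin n → ℕ) × ResTorus K n × (Fin r → ℕ)) : cell ϖ F y ⊆ zetaDomain h := fun x hx => by
  obtain ⟨h1, h2⟩ := norm_of_mem_cell hϖ hF hx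
  refine ⟨fun j => ?_, fun i hi => ?_⟩
  · rw [h1]
    exact pow_le_one₀ hϖ.inv_pos.le hϖ.inv_lt_one.le
  · have := h2 i
    rw [hi, norm_zero] at this
    exact (pow_pos hϖ.inv_pos _).ne this

/-- A point determines its cell: the norms of the coordinates give `k`, the norms of the polynomials
then give `a`, and the digits of the unscaled point give `z`. -/
theorem pairwise_disjoint_cell (hϖ : IsUniformizer ϖ)
    (hF : ∀ i k, IsRescaling ϖ (h i) k (F i k) (d i k)) :
    Pairwise (Function.onFun Disjoint (cell (n := n) ϖ F)) := by
  rintro ⟨k, z, a⟩ ⟨k', z', a'⟩ hne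
  rw [Function.onFun, Set.disjoint_left]
  intro x hx hx'
  obtain ⟨h1, h2⟩ := norm_of_mem_cell hϖ hF hx
  obtain ⟨h1', h2'⟩ := norm_of_mem_cell hϖ hF hx'
  obtain rfl : k = k' := funext fun j => hϖ.pow_inj ((h1 j).symm.trans (h1' j))
  obtain rfl : a = a' := funext fun i => by
    have := hϖ.pow_inj ((h2 i).symm.trans (h2' i))
    omega
  refine hne ?_
  obtain rfl : z = z' := funext fun j => Subtype.ext (by
    by_contra hz
    have hd := lt_norm_digit_sub hϖ hz 0
    simp only [pow_zero, one_mul] at hd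
    exact (disjoint_polyBox (c := fun j => (resLift (z j : ResField K) : K))
      (c' := fun j => (resLift (z' j : ResField K) : K)) (a := 1) (i := j) hd).le_bot
      ⟨hx.1, hx'.1⟩)
  rfl

theorem mem_iUnion_cell (hϖ : IsUniformizer ϖ)
    (hF : ∀ i k, IsRescaling ϖ (h i) k (F i k) (d i k)) {x : Fin n → K} (hx : x ∈ zetaDomain h)
    (hx0 : ∀ j, x j ≠ 0) : x ∈ ⋃ y, cell ϖ F y := by
  choose k hk using fun j => hϖ.exists_norm_eq (x j) (hx0 j) (hx.1 j)
  choose u hu using fun j => exists_eq_pow_mul hϖ (hk j).le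
  have hunscale : unscale (ϖ : K) k x = fun j => (u j : K) := by
    ext j
    have := pow_ne_zero (k j) hϖ.ne_zero
    rw [unscale, hu j]
    field_simp
  have hz : ∀ j, IsLocalRing.residue (RingInt K) (u j) ≠ 0 := fun j => by
    rw [← norm_pow_mul_eq_iff hϖ (a := k j), ← hu j]
    exact hk j
  have hne : ∀ i, MvPolynomial.aeval (unscale (ϖ : K) k x) (F i k) ≠ 0 := fun i hi => by
    refine hx.2 i ?_
    rw [← scale_unscale hϖ k x, (hF i k).aeval_eq, hi, mul_zero]
  choose a ha using fun i => hϖ.exists_norm_eq _ (hne i) (norm_aeval_le _ fun j => by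
    rw [hunscale]
    exact norm_ringInt_le _)
  refine mem_iUnion.2 ⟨(k, fun j => ⟨_, hz j⟩, a), ?_, ha⟩
  intro j
  simp only [hunscale, Pi.one_apply, pow_one]
  exact (norm_sub_resLift_le hϖ).2 rfl

variable [LocallyCompactSpace K] [MeasurableSpace K] [BorelSpace K]
  {μ : Measure (Fin n → K)} [μ.IsAddHaarMeasure]

theorem measurableSet_cell (F : Fin r → (Fin n → ℕ) → MvPolynomial (Fin n) (RingInt K))
    (y : (Fin n → ℕ) × ResTorus K n × (Fin r → ℕ)) : MeasurableSet (cell ϖ F y) := by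
  refine measurableSet_preimage ?_ (measurableSet_levelSet _ _ _)
  exact measurable_pi_lambda _ fun j => (measurable_pi_apply j).const_mul _

/-- The set lies in polydiscs of measure q^{-N} for every N. It is the only part of the domain that
the cells can miss, since a zero coordinate has no order. -/
theorem haar_coordinate_hyperplane (hϖ : IsUniformizer ϖ) (hμ : μ {x | ∀ j, ‖x j‖ ≤ 1} = 1)
    (j : Fin n) : μ {x | (∀ j, ‖x j‖ ≤ 1) ∧ x j = 0} = 0 := by
  have hfin := haar_polyBox_lt_top hϖ hμ
  have hle : ∀ N : ℕ, μ.real {x | (∀ j, ‖x j‖ ≤ 1) ∧ x j = 0} ≤ (resCard K : ℝ)⁻¹ ^ N := fun N => by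
    have hsub : {x : Fin n → K | (∀ j, ‖x j‖ ≤ 1) ∧ x j = 0} ⊆ polyBox 0 (Pi.single j N) := by
      rintro x ⟨hx, hxj⟩ i
      rcases eq_or_ne i j with rfl | hi
      · simp [hxj]
      · simpa [Pi.single_eq_of_ne hi] using hx i
    refine (measureReal_mono hsub (hfin _ _).ne).trans_eq ?_
    rw [haar_real_polyBox hϖ hμ, Finset.prod_eq_single j]
    · rw [Pi.single_eq_same]
    · intro i _ hi
      rw [Pi.single_eq_of_ne hi, pow_zero]
    · simp
  have h0 : μ.real {x | (∀ j, ‖x j‖ ≤ 1) ∧ x j = 0} = 0 :=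
    le_antisymm (ge_of_tendsto' (tendsto_pow_atTop_nhds_zero_of_lt_one hϖ.inv_pos.le
      hϖ.inv_lt_one) hle) measureReal_nonneg
  refine (measureReal_eq_zero_iff ?_).1 h0
  refine ((measure_mono fun x hx => ?_).trans_lt (hfin 0 0)).ne
  exact mem_polyBox_zero_zero.2 hx.1

theorem iUnion_cell_ae_eq (hϖ : IsUniformizer ϖ) (hμ : μ {x | ∀ j, ‖x j‖ ≤ 1} = 1)
    (hF : ∀ i k, IsRescaling ϖ (h i) k (F i k) (d i k)) :
    (⋃ y, cell ϖ F y : Set (Fin n → K)) =ᵐ[μ] zetaDomain h := by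
  refine Filter.EventuallyLE.antisymm
    (LE.le.eventuallyLE (iUnion_subset (cell_subset_zetaDomain hϖ hF))) ?_
  refine ae_le_set.2 (measure_mono_null (t := ⋃ j, {x | (∀ j, ‖x j‖ ≤ 1) ∧ x j = 0}) ?_
    (measure_iUnion_null fun j => haar_coordinate_hyperplane hϖ hμ j))
  rintro x ⟨hx, hx'⟩
  by_contra hcon
  refine hx' (mem_iUnion_cell hϖ hF hx fun j hj => hcon ?_)
  exact mem_iUnion.2 ⟨j, hx.1, hj⟩

end Cells

end NewtonZeta

/-! ### The zeta integral as a series over lattice points. -/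

namespace NewtonZeta

variable {K : Type*} [NontriviallyNormedField K] [IsUltrametricDist K] {n r : ℕ}
  {ϖ : RingInt K} {h : Fin r → MvPolynomial (Fin n) (RingInt K)}

/-- The contribution `q ^ (-σ(k) - ∑ d(k, Γ(hᵢ)) sᵢ)` of a lattice point. -/
def latticeTerm (h : Fin r → MvPolynomial (Fin n) (RingInt K)) (s : Fin r → ℂ)
    (k : Fin n → ℕ) : ℂ :=
  (resCard K : ℂ) ^ (-(sigma k : ℂ) - ∑ i, (dist (toReal k) (newtonPolyhedron (h i)) : ℂ) * s i)

/-- The integral over the torus of units attached to the direction `a`. -/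
def torusFactor [Fintype (ResTorus K n)] (h : Fin r → MvPolynomial (Fin n) (RingInt K))
    (a : Fin n → ℝ) (s : Fin r → ℂ) : ℂ :=
  ∑ z : ResTorus K n, (resCard K : ℂ)⁻¹ ^ n * ∏ i, levelSum K
    (MvPolynomial.eval (fun j => (z j : ResField K)) (reduction (faceFun (h i) a)) = 0) (s i)

/-- Summability over the whole product being given, the sum may be computed fiber by fiber: first
over `A`, then over the finite set `Z`, and the value over `κ` is known. -/
theorem hasSum_of_fibers {κ Z A : Type*} [Fintype Z] {e : κ → ℂ} {c : ℂ} {T : κ → Z → A → ℂ}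
    (hs : Summable fun y : κ × Z × A => e y.1 * (c * T y.1 y.2.1 y.2.2)) {t : κ → Z → ℂ}
    (hT : ∀ k z, HasSum (T k z) (t k z)) {V : ℂ} (hV : HasSum (fun k => e k * ∑ z, c * t k z) V) :
    HasSum (fun y : κ × Z × A => e y.1 * (c * T y.1 y.2.1 y.2.2)) V := by
  have hfib : ∀ k, HasSum (fun y : Z × A => e k * (c * T k y.1 y.2)) (e k * ∑ z, c * t k z) :=
    fun k => by
      have h1 : HasSum (fun y : Z × A => e k * (c * T k y.1 y.2)) _ := (hs.prod_factor k).hasSum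
      have h2 := h1.prod_fiberwise fun z => ((hT k z).mul_left c).mul_left (e k)
      rw [h2.unique (hasSum_fintype _)] at h1
      rwa [Finset.mul_sum]
  rw [← (hs.hasSum.prod_fiberwise hfib).unique hV]
  exact hs.hasSum

section Term

variable {F : Fin r → (Fin n → ℕ) → MvPolynomial (Fin n) (RingInt K)} {d : Fin r → (Fin n → ℕ) → ℕ}

/-- The value of the zeta integral over a cell. -/
def cellTerm (h : Fin r → MvPolynomial (Fin n) (RingInt K)) (s : Fin r → ℂ)
    (y : (Fin n → ℕ) × ResTorus K n × (Fin r → ℕ)) : ℂ :=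
  latticeTerm h s y.1 * ((resCard K : ℂ)⁻¹ ^ n * ∏ i, ((levelWeight K (MvPolynomial.eval
    (fun j => (y.2.1 j : ResField K)) (reduction (faceFun (h i) (toReal y.1))) = 0) (y.2.2 i) : ℂ) *
      (resCard K : ℂ) ^ (-(y.2.2 i : ℂ) * s i)))

theorem summable_norm_cellTerm (hϖ : IsUniformizer ϖ) {s : Fin r → ℂ} (hs : ∀ i, -1 < (s i).re)
    (he : Summable fun k => ‖latticeTerm h s k‖) : Summable fun y => ‖cellTerm (n := n) h s y‖ := by
  have := hϖ.finite
  have h1 := (hasSum_prod_pi (fun (i : Fin r) (a : ℕ) =>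
    (resCard K : ℝ) * ‖(resCard K : ℂ) ^ (-1 - s i)‖ ^ a) fun i =>
      (hϖ.summable_levelWeight (hs i)).norm).1
  have h2 : Summable fun _ : ResTorus K n => (1 : ℝ) := Summable.of_finite
  have h3 := he.mul_of_nonneg (h2.mul_of_nonneg h1 (fun _ => zero_le_one) fun _ => norm_nonneg _)
    (fun _ => norm_nonneg _) fun _ => mul_nonneg zero_le_one (norm_nonneg _)
  refine Summable.of_nonneg_of_le (fun _ => norm_nonneg _) (fun y => ?_) h3
  rw [cellTerm, norm_mul]
  refine mul_le_mul_of_nonneg_left ?_ (norm_nonneg _)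
  rw [norm_mul]
  refine mul_le_mul ?_ ?_ (norm_nonneg _) zero_le_one
  · rw [norm_pow, norm_inv, Complex.norm_natCast]
    exact pow_le_one₀ hϖ.inv_pos.le hϖ.inv_lt_one.le
  · rw [norm_prod, Real.norm_of_nonneg (Finset.prod_nonneg fun i _ => by positivity)]
    exact Finset.prod_le_prod (fun _ _ => norm_nonneg _) fun i _ => hϖ.norm_levelWeight_mul_le _ _ _

theorem hasSum_cellTerm [Fintype (ResTorus K n)] (hϖ : IsUniformizer ϖ) {s : Fin r → ℂ}
    (hs : ∀ i, -1 < (s i).re) (he : Summable fun k => ‖latticeTerm h s k‖) {V : ℂ}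
    (hV : HasSum (fun k : Fin n → ℕ => latticeTerm h s k * torusFactor h (toReal k) s) V) :
    HasSum (cellTerm (n := n) h s) V := by
  refine hasSum_of_fibers (e := latticeTerm h s) (c := (resCard K : ℂ)⁻¹ ^ n)
    (T := fun k (z : ResTorus K n) (a : Fin r → ℕ) => ∏ i, ((levelWeight K (MvPolynomial.eval
      (fun j => (z j : ResField K)) (reduction (faceFun (h i) (toReal k))) = 0) (a i) : ℂ) *
        (resCard K : ℂ) ^ (-(a i : ℂ) * s i)))
    (t := fun k z => ∏ i, levelSum K (MvPolynomial.eval (fun j => (z j : ResField K))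
      (reduction (faceFun (h i) (toReal k))) = 0) (s i))
    (summable_norm_cellTerm (n := n) hϖ hs he).of_norm (fun k z => ?_) hV
  have h3 := (hasSum_prod_pi (fun (i : Fin r) (a : ℕ) => (levelWeight K (MvPolynomial.eval
    (fun j => (z j : ResField K)) (reduction (faceFun (h i) (toReal k))) = 0) a : ℂ) *
      (resCard K : ℂ) ^ (-(a : ℂ) * s i)) fun i =>
    (Summable.of_nonneg_of_le (fun _ => norm_nonneg _)
      (fun a => hϖ.norm_levelWeight_mul_le _ (s i) a) (hϖ.summable_levelWeight (hs i)))).2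
  rwa [Finset.prod_congr rfl fun i _ => hϖ.tsum_levelWeight _ (hs i)] at h3

end Term

variable [LocallyCompactSpace K] [MeasurableSpace K] [BorelSpace K]
  {μ : Measure (Fin n → K)} [μ.IsAddHaarMeasure]

/-- Each cell contributes its volume times the constant value of the integrand. Summability of the
absolute contributions gives integrability and the value together, so the statement applies wherever
the series converges, including exponents with negative real part. -/
theorem integral_zetaDomain_eq_of_hasSum [Fintype (ResTorus K n)] (hϖ : IsUniformizer ϖ)
    (hμ : μ {x | ∀ j, ‖x j‖ ≤ 1} = 1) (hh : ∀ i, h i ≠ 0) (hnd : NonDegenerate h)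
    {s : Fin r → ℂ} (hs : ∀ i, -1 < (s i).re) (he : Summable fun k => ‖latticeTerm h s k‖) {V : ℂ}
    (hV : HasSum (fun k : Fin n → ℕ => latticeTerm h s k * torusFactor h (toReal k) s) V) :
    IntegrableOn (fun x : Fin n → K => ∏ i, ((‖MvPolynomial.aeval x (h i)‖ : ℝ) : ℂ) ^ s i)
        (zetaDomain h) μ ∧
      ∫ x in zetaDomain h, ∏ i, ((‖MvPolynomial.aeval x (h i)‖ : ℝ) : ℂ) ^ s i ∂μ = V := by
  have := hϖ.finite
  choose F d hF using fun i k => exists_isRescaling hϖ (hh i) k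
  have hcount : Countable ((Fin n → ℕ) × ResTorus K n × (Fin r → ℕ)) := inferInstance
  have hmeas := measurableSet_cell (ϖ := ϖ) F
  have hdisj := pairwise_disjoint_cell (n := n) hϖ hF
  set G : (Fin n → K) → ℂ := fun x => ∏ i, ((‖MvPolynomial.aeval x (h i)‖ : ℝ) : ℂ) ^ s i with hG
  have hfin : ∀ y, μ (cell ϖ F y) < ⊤ := fun y =>
    (measure_mono fun x hx => mem_polyBox_zero_zero.2 (cell_subset_zetaDomain hϖ hF y hx).1).trans_lt
      (haar_polyBox_lt_top hϖ hμ 0 0)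
  have hval : ∀ y : (Fin n → ℕ) × ResTorus K n × (Fin r → ℕ), ∀ x ∈ cell ϖ F y,
      G x = ∏ i, (resCard K : ℂ) ^ (-((d i y.1 + y.2.2 i : ℕ) : ℂ) * s i) := fun y x hx => by
    refine Finset.prod_congr rfl fun i _ => ?_
    rw [(norm_of_mem_cell hϖ hF hx).2 i, hϖ.inv_pow_cpow]
  -- The volume is q^{-σ(k)} from the unscaling times the volume of the level set; `hnd` in
  -- direction `k` provides the rank condition because `F i k` and the face function have equal
  -- reductions.
  have hvol : ∀ y : (Fin n → ℕ) × ResTorus K n × (Fin r → ℕ),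
      ((μ.real (cell ϖ F y) : ℝ) : ℂ) * ∏ i, (resCard K : ℂ) ^ (-((d i y.1 + y.2.2 i : ℕ) : ℂ) * s i) =
        cellTerm h s y := by
    rintro ⟨k, z, a⟩
    rw [cell, haar_real_preimage_unscale hϖ hμ k (measurableSet_levelSet _ _ _),
      haar_real_levelSet hϖ hμ]
    · simp only [cellTerm, latticeTerm, (hF _ k).dist_eq, (hF _ k).reduction_eq]
      rw [sub_eq_add_neg, Complex.cpow_add _ _ hϖ.natCast_ne_zero, ← Finset.sum_neg_distrib]
      have e1 : (resCard K : ℂ) ^ (∑ i, -(((d i k : ℕ) : ℝ) : ℂ) * s i) =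
          ∏ i, (resCard K : ℂ) ^ (-((d i k : ℕ) : ℂ) * s i) := by
        simp only [Complex.cpow_def_of_ne_zero hϖ.natCast_ne_zero, Finset.mul_sum,
          ← Complex.exp_sum, Complex.ofReal_natCast]
      have e2 : ∏ j, (resCard K : ℝ)⁻¹ ^ k j = (resCard K : ℝ)⁻¹ ^ sigma k := by
        rw [Finset.prod_pow_eq_pow_sum]
        rfl
      simp only [← neg_mul]
      rw [e1, e2, Finset.prod_mul_distrib]
      have e3 : ∀ i, (resCard K : ℂ) ^ (-((d i k + a i : ℕ) : ℂ) * s i) =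
          (resCard K : ℂ) ^ (-((d i k : ℕ) : ℂ) * s i) * (resCard K : ℂ) ^ (-(a i : ℂ) * s i) :=
        fun i => by
          rw [← Complex.cpow_add _ _ hϖ.natCast_ne_zero]
          congr 1
          push_cast
          ring
      rw [Finset.prod_congr rfl fun i _ => e3 i, Finset.prod_mul_distrib, Complex.cpow_neg,
        Complex.cpow_natCast]
      push_cast
      ring
    · intro I hI hmem
      have := hnd (toReal k) (toReal_nonneg k) I hI (fun j => (z j : ResField K))
        (fun j => (z j).2) (fun i => by
          rw [← hmem i, (hF i k).reduction_eq])
      simpa only [(hF _ k).reduction_eq] using this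
  have hint : ∀ y, IntegrableOn G (cell ϖ F y) μ := fun y =>
    (integrableOn_congr_fun (hval y) (hmeas y)).2 (integrableOn_const (hfin y).ne)
  have hset : ∀ y, ∫ x in cell ϖ F y, G x ∂μ = cellTerm h s y := fun y => by
    rw [setIntegral_congr_fun (hmeas y) (hval y), setIntegral_const, Complex.real_smul, hvol y]
  have hnorm : ∀ y, ∫ x in cell ϖ F y, ‖G x‖ ∂μ = ‖cellTerm h s y‖ := fun y => by
    rw [setIntegral_congr_fun (hmeas y) fun x hx => congrArg norm (hval y x hx), setIntegral_const,
      ← hvol y, norm_mul, Complex.norm_real, Real.norm_of_nonneg measureReal_nonneg, smul_eq_mul]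
  have hsum := hasSum_cellTerm (n := n) hϖ hs he hV
  have hI : IntegrableOn G (⋃ y, cell ϖ F y) μ :=
    integrableOn_iUnion_of_summable_integral_norm hint (by
      simp only [hnorm]
      exact summable_norm_cellTerm hϖ hs he)
  have hS := hasSum_integral_iUnion hmeas hdisj hI
  simp only [hset] at hS
  have hae := iUnion_cell_ae_eq (μ := μ) hϖ hμ hF
  exact ⟨hI.congr_set_ae hae.symm, by rw [← setIntegral_congr_set hae, hS.unique hsum]⟩

end NewtonZeta

/-! ### Lattice points of a simplicial cone. -/

namespace NewtonZeta

section ConeSeries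

variable {n : ℕ} {W : Finset (Fin n → ℕ)}

/-- Coefficients outside `W` are irrelevant; the version indexed by `W` is the one to which linear
independence applies. -/
theorem exists_sum_extend {P : ℝ → Prop} {x : Fin n → ℝ} :
    (∃ c : (Fin n → ℕ) → ℝ, (∀ w ∈ W, P (c w)) ∧ x = ∑ w ∈ W, c w • toReal w) ↔
      ∃ c : W → ℝ, (∀ w, P (c w)) ∧ x = ∑ w, c w • toReal (w : Fin n → ℕ) := by
  classical
  constructor
  · rintro ⟨c, hc, rfl⟩
    exact ⟨fun w => c w, fun w => hc w w.2, (Finset.sum_coe_sort W fun w => c w • toReal w).symm⟩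
  · rintro ⟨c, hc, rfl⟩
    refine ⟨fun w => if hw : w ∈ W then c ⟨w, hw⟩ else 0, fun w hw => ?_, ?_⟩
    · simp only [dif_pos hw]
      exact hc _
    · rw [← Finset.sum_coe_sort W fun w => (if hw : w ∈ W then c ⟨w, hw⟩ else 0) • toReal w]
      exact Finset.sum_congr rfl fun w _ => by rw [dif_pos w.2]

theorem mem_openCone_iff {x : Fin n → ℝ} : x ∈ openCone W ↔
    ∃ c : W → ℝ, (∀ w, 0 < c w) ∧ x = ∑ w, c w • toReal (w : Fin n → ℕ) :=
  exists_sum_extend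

theorem mem_fundamentalPoints_iff {t : Fin n → ℤ} : t ∈ fundamentalPoints W ↔
    ∃ c : W → ℝ, (∀ w, 0 < c w ∧ c w ≤ 1) ∧
      (fun j => (t j : ℝ)) = ∑ w, c w • toReal (w : Fin n → ℕ) :=
  exists_sum_extend (P := fun y => 0 < y ∧ y ≤ 1)

/-- A vector of natural numbers as an integral vector. -/
def toInt (k : Fin n → ℕ) : Fin n → ℤ := fun j => (k j : ℤ)

theorem toReal_eq_of_toInt_eq {k : Fin n → ℕ} {t : Fin n → ℤ} {ν : W → ℕ}
    (h : toInt k = t + ∑ w, ν w • toInt (w : Fin n → ℕ)) {c : W → ℝ}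
    (hc : (fun j => (t j : ℝ)) = ∑ w, c w • toReal (w : Fin n → ℕ)) :
    toReal k = ∑ w, (c w + ν w) • toReal (w : Fin n → ℕ) := by
  ext j
  have h1 := congrFun h j
  have h2 := congrFun hc j
  rw [Pi.add_apply, Finset.sum_apply] at h1
  simp only [Pi.smul_apply, toInt, nsmul_eq_mul] at h1
  have h3 : (k j : ℝ) = t j + ∑ w : W, (ν w : ℝ) * ((w : Fin n → ℕ) j : ℝ) := by exact_mod_cast h1
  simp only [add_smul, Finset.sum_add_distrib]
  rw [Pi.add_apply, ← h2, toReal, h3]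
  congr 1
  rw [Finset.sum_apply]
  rfl

theorem fundamentalPoints_nonneg {t : Fin n → ℤ} (ht : t ∈ fundamentalPoints W) (j : Fin n) :
    0 ≤ t j := by
  obtain ⟨c, hc, h⟩ := ht
  have h1 := nonneg_of_combination (fun w hw => (hc w hw).1.le) j
  rw [← h] at h1
  exact Int.cast_nonneg_iff.1 h1

/-- Translation of a fundamental point by a natural combination of the generators. -/
def latticePoint (y : fundamentalPoints W × (W → ℕ)) : Fin n → ℕ :=
  fun j => (y.1.1 j).toNat + ∑ w, y.2 w * (w : Fin n → ℕ) j

theorem toInt_latticePoint (y : fundamentalPoints W × (W → ℕ)) :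
    toInt (latticePoint y) = y.1.1 + ∑ w, y.2 w • toInt (w : Fin n → ℕ) := by
  ext j
  have := fundamentalPoints_nonneg y.1.2 j
  simp [toInt, latticePoint, Finset.sum_apply, this]

theorem latticePoint_mem (y : fundamentalPoints W × (W → ℕ)) :
    toReal (latticePoint y) ∈ openCone W := by
  obtain ⟨c, hc, h⟩ := mem_fundamentalPoints_iff.1 y.1.2
  exact mem_openCone_iff.2 ⟨_, fun w => add_pos_of_pos_of_nonneg (hc w).1 (Nat.cast_nonneg _),
    toReal_eq_of_toInt_eq (toInt_latticePoint y) h⟩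

/-- By linear independence a point of the cone has unique coordinates, and each positive coordinate
splits uniquely as a number in (0, 1] plus a natural number. -/
theorem latticePoint_bijective
    (hW : LinearIndependent ℝ (fun w : W => toReal (w : Fin n → ℕ))) :
    Function.Bijective (fun y : fundamentalPoints W × (W → ℕ) =>
      (⟨latticePoint y, latticePoint_mem y⟩ : {k : Fin n → ℕ // toReal k ∈ openCone W})) := by
  constructor
  · rintro ⟨t, ν⟩ ⟨t', ν'⟩ heq
    have heq : latticePoint (t, ν) = latticePoint (t', ν') := congrArg Subtype.val heq
    obtain ⟨c, hc, h⟩ := mem_fundamentalPoints_iff.1 t.2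
    obtain ⟨c', hc', h'⟩ := mem_fundamentalPoints_iff.1 t'.2
    have h1 := toReal_eq_of_toInt_eq (toInt_latticePoint (t, ν)) h
    have h2 := toReal_eq_of_toInt_eq (toInt_latticePoint (t', ν')) h'
    have h3 : ∑ w : W, (c w + ν w - (c' w + ν' w)) • toReal (w : Fin n → ℕ) = 0 := by
      simp only [sub_smul, Finset.sum_sub_distrib]
      rw [← h1, ← h2, heq, sub_self]
    have h4 := Fintype.linearIndependent_iff.1 hW _ h3
    have hν : ν = ν' := by
      ext w
      have h5 := h4 w
      have h6 := hc w
      have h7 := hc' w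
      have h8 : (ν w : ℝ) < ν' w + 1 := by linarith
      have h9 : (ν' w : ℝ) < ν w + 1 := by linarith
      have h10 : ν w < ν' w + 1 := by exact_mod_cast h8
      have h11 : ν' w < ν w + 1 := by exact_mod_cast h9
      omega
    subst hν
    have ht : t = t' := by
      apply Subtype.ext
      have h5 := toInt_latticePoint (t, ν)
      rw [heq, toInt_latticePoint (t', ν)] at h5
      exact (add_right_cancel h5).symm
    rw [ht]
  · rintro ⟨k, hk⟩
    obtain ⟨l, hl, hkl⟩ := mem_openCone_iff.1 hk
    have hceil : ∀ w, ((⌈l w⌉₊ - 1 : ℕ) : ℝ) = (⌈l w⌉₊ : ℝ) - 1 := fun w => by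
      rw [Nat.cast_sub (Nat.one_le_ceil_iff.2 (hl w)), Nat.cast_one]
    -- Ceiling minus one rather than floor, since the fundamental domain contains 1 and omits 0.
    let ν : W → ℕ := fun w => ⌈l w⌉₊ - 1
    let t : Fin n → ℤ := toInt k - ∑ w, ν w • toInt (w : Fin n → ℕ)
    have ht : t ∈ fundamentalPoints W := by
      refine mem_fundamentalPoints_iff.2 ⟨fun w => l w - ν w, fun w => ?_, ?_⟩
      · have h1 := Nat.ceil_lt_add_one (hl w).le
        have h2 := Nat.le_ceil (l w)
        have h3 : (ν w : ℝ) = (⌈l w⌉₊ : ℝ) - 1 := hceil w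
        constructor <;> linarith
      · have h1 : ∀ j, (k j : ℝ) = (∑ w, l w • toReal (w : Fin n → ℕ)) j := fun j => congrFun hkl j
        ext j
        simp only [sub_smul, Finset.sum_sub_distrib, Pi.sub_apply, t]
        push_cast
        rw [← h1 j]
        simp [toInt, toReal, Finset.sum_apply]
    refine ⟨(⟨t, ht⟩, ν), Subtype.ext ?_⟩
    have h1 : toInt (latticePoint (⟨t, ht⟩, ν)) = toInt k := by
      rw [toInt_latticePoint]
      simp only [t, sub_add_cancel]
    ext j
    have h2 := congrFun h1 j
    simp only [toInt, Nat.cast_inj] at h2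
    exact h2

/-- The generating series of the lattice points of a simplicial cone. -/
theorem hasSum_cone (hW : LinearIndependent ℝ (fun w : W => toReal (w : Fin n → ℕ)))
    {χ : (Fin n → ℤ) → ℂ} (hadd : ∀ t u, χ (t + u) = χ t * χ u) (hzero : χ 0 = 1)
    (hlt : ∀ w ∈ W, ‖χ (toInt w)‖ < 1) :
    (Summable fun k : {k : Fin n → ℕ // toReal k ∈ openCone W} => ‖χ (toInt k)‖) ∧
      HasSum (fun k : {k : Fin n → ℕ // toReal k ∈ openCone W} => χ (toInt k))
        ((∑ t ∈ (fundamentalPoints_finite W).toFinset, χ t) / ∏ w ∈ W, (1 - χ (toInt w))) := by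
  have hnsmul : ∀ (m : ℕ) t, χ (m • t) = χ t ^ m := fun m t => by
    induction m with
    | zero => simp [hzero]
    | succ m ih => rw [succ_nsmul, hadd, ih, pow_succ]
  have hsum : ∀ (ν : W → ℕ), χ (∑ w, ν w • toInt (w : Fin n → ℕ)) =
      ∏ w : W, χ (toInt (w : Fin n → ℕ)) ^ ν w := fun ν => by
    have : ∀ s : Finset W, χ (∑ w ∈ s, ν w • toInt (w : Fin n → ℕ)) =
        ∏ w ∈ s, χ (toInt (w : Fin n → ℕ)) ^ ν w := fun s => by
      classical
      induction s using Finset.induction_on with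
      | empty => simp [hzero]
      | insert w s hw ih => rw [Finset.sum_insert hw, Finset.prod_insert hw, hadd, ih, hnsmul]
    exact this Finset.univ
  obtain ⟨h1, h2⟩ := hasSum_prod_pi (fun (w : W) (m : ℕ) => χ (toInt (w : Fin n → ℕ)) ^ m)
    fun w => by
      simp only [norm_pow]
      exact summable_geometric_of_lt_one (norm_nonneg _) (hlt w w.2)
  rw [Finset.prod_congr rfl fun w _ => tsum_geometric_of_norm_lt_one (hlt w.1 w.2),
    Finset.prod_coe_sort W fun w => (1 - χ (toInt w))⁻¹] at h2
  have := (fundamentalPoints_finite W).fintype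
  have h3 : Summable fun t : fundamentalPoints W => ‖χ t‖ := Summable.of_finite
  have h4 : HasSum (fun t : fundamentalPoints W => χ t)
      (∑ t ∈ (fundamentalPoints_finite W).toFinset, χ t) := by
    have e : ∑ t ∈ (fundamentalPoints_finite W).toFinset, χ t =
        ∑ t : fundamentalPoints W, χ t :=
      Finset.sum_subtype _ (fun t => (fundamentalPoints_finite W).mem_toFinset) χ
    rw [e]
    exact hasSum_fintype _
  have h5 := h3.mul_of_nonneg h1 (fun _ => norm_nonneg _) fun _ => norm_nonneg _
  simp only [← norm_mul] at h5
  have h6 := h4.mul h2 h5.of_norm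
  have hχ : ∀ y : fundamentalPoints W × (W → ℕ), χ (toInt (latticePoint y)) =
      χ y.1 * ∏ w : W, χ (toInt (w : Fin n → ℕ)) ^ y.2 w := fun y => by
    rw [toInt_latticePoint, hadd, hsum]
  simp only [← hχ] at h5 h6
  rw [Finset.prod_inv_distrib, ← div_eq_mul_inv] at h6
  let e := Equiv.ofBijective _ (latticePoint_bijective hW)
  exact ⟨(Equiv.summable_iff (f := fun k : {k : Fin n → ℕ // toReal k ∈ openCone W} =>
    ‖χ (toInt k)‖) e).1 h5, (Equiv.hasSum_iff (f := fun k : {k : Fin n → ℕ //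
      toReal k ∈ openCone W} => χ (toInt k)) e).1 h6⟩

end ConeSeries

end NewtonZeta

/-! ### Summation over a partition of the orthant into cones. -/

namespace NewtonZeta

variable {K : Type*} [NontriviallyNormedField K] [IsUltrametricDist K] {n r : ℕ}
  {ϖ : RingInt K} {h : Fin r → MvPolynomial (Fin n) (RingInt K)}

/-- `latticeTerm` for a lattice point given by integral coordinates. -/
def intTerm (h : Fin r → MvPolynomial (Fin n) (RingInt K)) (s : Fin r → ℂ) (t : Fin n → ℤ) : ℂ :=
  (resCard K : ℂ) ^ (-((∑ j, t j : ℤ) : ℂ) -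
    ∑ i, (dist (fun j => (t j : ℝ)) (newtonPolyhedron (h i)) : ℂ) * s i)

theorem intTerm_toInt (s : Fin r → ℂ) (k : Fin n → ℕ) :
    intTerm h s (toInt k) = latticeTerm h s k := by
  have e : (fun j => ((toInt k j : ℤ) : ℝ)) = toReal k := by
    ext j
    simp [toInt, toReal]
  rw [intTerm, latticeTerm, e]
  simp [toInt, sigma]

/-- The numerator of the generating series of a cone. -/
def coneNum (h : Fin r → MvPolynomial (Fin n) (RingInt K)) (s : Fin r → ℂ)
    (W : Finset (Fin n → ℕ)) : ℂ :=
  ∑ t ∈ (fundamentalPoints_finite W).toFinset, intTerm h s t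

/-- The functions `d(·, Γ(hᵢ))` are linear on the closed cone generated by `W`, and the face
functions are constant on the open cone. -/
structure IsSubordinate (h : Fin r → MvPolynomial (Fin n) (RingInt K))
    (W : Finset (Fin n → ℕ)) : Prop where
  linearIndependent : LinearIndependent ℝ (fun w : W => toReal (w : Fin n → ℕ))
  exists_dist_eq : ∀ i, ∃ m : Fin n →₀ ℕ, ∀ c : (Fin n → ℕ) → ℝ, (∀ w ∈ W, 0 ≤ c w) →
    dist (∑ w ∈ W, c w • toReal w) (newtonPolyhedron (h i)) =
      pairing (∑ w ∈ W, c w • toReal w) m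
  faceFun_eq : ∀ i, ∀ a ∈ openCone W, faceFun (h i) a = faceFun (h i) (barycenter W)

theorem isSubordinate_empty (hh : ∀ i, h i ≠ 0) : IsSubordinate h ∅ where
  linearIndependent := linearIndependent_empty_type
  exists_dist_eq i := by
    obtain ⟨m, -, hm⟩ := exists_dist_eq (a := 0) (hh i) fun _ => le_rfl
    exact ⟨m, fun c _ => by simpa using hm⟩
  faceFun_eq i a ha := by
    obtain ⟨c, -, rfl⟩ := ha
    simp [barycenter]

/-- The functions d(·, Γ(hᵢ)) are only piecewise linear, but on the closed cone each is pairing with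
a fixed exponent. The term therefore agrees there with a homomorphism from ℤⁿ to the multiplicative
group, to which `hasSum_cone` applies. -/
theorem IsSubordinate.hasSum_latticeTerm (hϖ : IsUniformizer ϖ) {W : Finset (Fin n → ℕ)}
    (hW : IsSubordinate h W) {s : Fin r → ℂ} (hlt : ∀ w ∈ W, ‖latticeTerm h s w‖ < 1) :
    (Summable fun k : {k : Fin n → ℕ // toReal k ∈ openCone W} => ‖latticeTerm h s k‖) ∧
      HasSum (fun k : {k : Fin n → ℕ // toReal k ∈ openCone W} => latticeTerm h s k)
        (coneNum h s W / ∏ w ∈ W, (1 - latticeTerm h s w)) := by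
  classical
  choose m hm using hW.exists_dist_eq
  let ψ : (Fin n → ℤ) → ℂ := fun t =>
    -((∑ j, t j : ℤ) : ℂ) - ∑ i, (∑ j, (t j : ℂ) * (m i j : ℂ)) * s i
  have hψ : ∀ t u, ψ (t + u) = ψ t + ψ u := fun t u => by
    simp only [ψ, Pi.add_apply, Int.cast_add, Finset.sum_add_distrib, add_mul]
    ring
  have key : ∀ (t : Fin n → ℤ) (c : (Fin n → ℕ) → ℝ), (∀ w ∈ W, 0 ≤ c w) →
      (fun j => (t j : ℝ)) = ∑ w ∈ W, c w • toReal w →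
      intTerm h s t = (resCard K : ℂ) ^ ψ t := fun t c hc ht => by
    rw [intTerm]
    congr 2
    refine Finset.sum_congr rfl fun i _ => ?_
    rw [ht, hm i c hc, ← ht, pairing]
    push_cast
    rfl
  have hnat : ∀ k : Fin n → ℕ, (∃ c : (Fin n → ℕ) → ℝ, (∀ w ∈ W, 0 ≤ c w) ∧
      toReal k = ∑ w ∈ W, c w • toReal w) →
      latticeTerm h s k = (resCard K : ℂ) ^ ψ (toInt k) := fun k ⟨c, hc, hk⟩ => by
    rw [← intTerm_toInt]
    refine key _ c hc ?_
    rw [← hk]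
    ext j
    simp [toInt, toReal]
  -- A generator usually lies on the boundary of its cone, so linearity on the closed cone is
  -- needed.
  have hgen : ∀ w ∈ W, latticeTerm h s w = (resCard K : ℂ) ^ ψ (toInt w) := fun w hw =>
    hnat w ⟨Pi.single w 1, fun w' _ => by
      rcases eq_or_ne w' w with rfl | hne
      · simp
      · simp [Pi.single_eq_of_ne hne], by
      rw [Finset.sum_eq_single w (fun w' _ hne => by rw [Pi.single_eq_of_ne hne, zero_smul])
        (fun h => (h hw).elim), Pi.single_eq_same, one_smul]⟩
  have hcone : ∀ k : {k : Fin n → ℕ // toReal k ∈ openCone W},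
      latticeTerm h s k = (resCard K : ℂ) ^ ψ (toInt k) := fun k =>
    hnat k (by
      obtain ⟨c, hc, hk⟩ := k.2
      exact ⟨c, fun w hw => (hc w hw).le, hk⟩)
  have hnum : coneNum h s W = ∑ t ∈ (fundamentalPoints_finite W).toFinset,
      (resCard K : ℂ) ^ ψ t := Finset.sum_congr rfl fun t ht => by
    obtain ⟨c, hc, h⟩ := (fundamentalPoints_finite W).mem_toFinset.1 ht
    exact key t c (fun w hw => (hc w hw).1.le) h
  rw [hnum, Finset.prod_congr rfl fun w hw => congrArg (1 - ·) (hgen w hw)]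
  simp only [hcone]
  refine hasSum_cone hW.linearIndependent (χ := fun t => (resCard K : ℂ) ^ ψ t)
    (fun t u => ?_) ?_ fun w hw => ?_
  · rw [hψ, Complex.cpow_add _ _ hϖ.natCast_ne_zero]
  · simp [ψ]
  · rw [← hgen w hw]
    exact hlt w hw

/-- A finite family of cones containing every lattice point of the orthant exactly once. -/
structure IsConePartition (𝒲 : Finset (Finset (Fin n → ℕ))) : Prop where
  disjoint : ∀ W ∈ 𝒲, ∀ W' ∈ 𝒲, W ≠ W' → Disjoint (openCone W) (openCone W')
  exists_mem : ∀ k : Fin n → ℕ, ∃ W ∈ 𝒲, toReal k ∈ openCone W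

theorem IsConePartition.hasSum {E : Type*} [NormedAddCommGroup E]
    {𝒲 : Finset (Finset (Fin n → ℕ))} (h𝒲 : IsConePartition 𝒲) {G : (Fin n → ℕ) → E}
    {V : Finset (Fin n → ℕ) → E}
    (hG : ∀ W ∈ 𝒲, HasSum (fun k : {k : Fin n → ℕ // toReal k ∈ openCone W} => G k) (V W)) :
    HasSum G (∑ W ∈ 𝒲, V W) := by
  have h1 := hasSum_sum fun W hW =>
    (hasSum_subtype_iff_indicator (s := {k : Fin n → ℕ | toReal k ∈ openCone W})).1 (hG W hW)
  refine (funext fun k => ?_ :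
    (fun k => ∑ W ∈ 𝒲, Set.indicator {k : Fin n → ℕ | toReal k ∈ openCone W} G k) = G) ▸ h1
  obtain ⟨W, hW, hk⟩ := h𝒲.exists_mem k
  rw [Finset.sum_eq_single W]
  · exact Set.indicator_of_mem (s := {k : Fin n → ℕ | toReal k ∈ openCone W}) hk G
  · intro W' hW' hne
    refine Set.indicator_of_notMem (s := {k : Fin n → ℕ | toReal k ∈ openCone W'}) (fun hk' => ?_) G
    exact (h𝒲.disjoint W' hW' W hW hne).le_bot ⟨hk', hk⟩
  · exact fun h => (h hW).elim

variable [LocallyCompactSpace K] [MeasurableSpace K] [BorelSpace K]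
  {μ : Measure (Fin n → K)} [μ.IsAddHaarMeasure]

/-- The torus factor depends on the direction only through the face functions, so on each cone it
may be evaluated at the barycenter and taken out of the sum. -/
theorem integral_zetaDomain_eq_sum [Fintype (ResTorus K n)] (hϖ : IsUniformizer ϖ)
    (hμ : μ {x | ∀ j, ‖x j‖ ≤ 1} = 1) (hh : ∀ i, h i ≠ 0) (hnd : NonDegenerate h)
    {𝒲 : Finset (Finset (Fin n → ℕ))} (h𝒲 : IsConePartition 𝒲)
    (hsub : ∀ W ∈ 𝒲, IsSubordinate h W) {s : Fin r → ℂ} (hs : ∀ i, -1 < (s i).re)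
    (hlt : ∀ W ∈ 𝒲, ∀ w ∈ W, ‖latticeTerm h s w‖ < 1) :
    IntegrableOn (fun x : Fin n → K => ∏ i, ((‖MvPolynomial.aeval x (h i)‖ : ℝ) : ℂ) ^ s i)
        (zetaDomain h) μ ∧
      ∫ x in zetaDomain h, ∏ i, ((‖MvPolynomial.aeval x (h i)‖ : ℝ) : ℂ) ^ s i ∂μ =
        ∑ W ∈ 𝒲, torusFactor h (barycenter W) s *
          (coneNum h s W / ∏ w ∈ W, (1 - latticeTerm h s w)) := by
  refine integral_zetaDomain_eq_of_hasSum hϖ hμ hh hnd hs ?_ ?_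
  · have h1 := h𝒲.hasSum (G := fun k => ‖latticeTerm h s k‖)
      (V := fun W => ∑' k : {k : Fin n → ℕ // toReal k ∈ openCone W}, ‖latticeTerm h s k‖)
      fun W hW => ((hsub W hW).hasSum_latticeTerm hϖ (hlt W hW)).1.hasSum
    exact h1.summable
  · refine h𝒲.hasSum (G := fun k => latticeTerm h s k * torusFactor h (toReal k) s)
      (V := fun W => torusFactor h (barycenter W) s *
        (coneNum h s W / ∏ w ∈ W, (1 - latticeTerm h s w))) fun W hW => ?_
    have h1 := ((hsub W hW).hasSum_latticeTerm hϖ (hlt W hW)).2.mul_left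
      (torusFactor h (barycenter W) s)
    have h2 : (fun k : {k : Fin n → ℕ // toReal k ∈ openCone W} =>
        latticeTerm h s k * torusFactor h (toReal k) s) =
        fun k : {k : Fin n → ℕ // toReal k ∈ openCone W} =>
          torusFactor h (barycenter W) s * latticeTerm h s k := by
      ext k
      simp only [torusFactor, (hsub W hW).faceFun_eq _ _ k.2]
      rw [mul_comm]
    rw [h2]
    exact h1

end NewtonZeta

/-! ### Clearing denominators, and analyticity. -/

namespace NewtonZeta

section NormalForm

/-- The meromorphic normal form of a quotient of entire functions agrees with the quotient and is
analytic wherever the denominator does not vanish. -/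
theorem toMeromorphicNFOn_div {A B : ℂ → ℂ} (hA : ∀ s, AnalyticAt ℂ A s)
    (hB : ∀ s, AnalyticAt ℂ B s) {s : ℂ} (hs : B s ≠ 0) :
    toMeromorphicNFOn (fun s => A s / B s) univ s = A s / B s ∧
      AnalyticAt ℂ (toMeromorphicNFOn (fun s => A s / B s) univ) s := by
  have hM : MeromorphicOn (fun s => A s / B s) univ := fun x _ =>
    (hA x).meromorphicAt.div (hB x).meromorphicAt
  have hana : AnalyticAt ℂ (fun s => A s / B s) s := (hA s).div (hB s) hs
  have h1 := toMeromorphicNFOn_eq_toMeromorphicNFAt_on_nhds hM (mem_univ s)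
  rw [toMeromorphicNFAt_eq_self.2 hana.meromorphicNFAt] at h1
  exact ⟨h1.eq_of_nhds, hana.congr h1.symm⟩

end NormalForm

variable {K : Type*} [NontriviallyNormedField K] [IsUltrametricDist K] {n r : ℕ}
  {ϖ : RingInt K} {h : Fin r → MvPolynomial (Fin n) (RingInt K)}

section Clearing

/-- `levelSum` multiplied by its denominator. -/
def levelNum (K : Type*) [NontriviallyNormedField K] [IsUltrametricDist K] (p : Prop) (s : ℂ) :
    ℂ :=
  open scoped Classical in
  if p then ((resCard K : ℂ) - 1) * (resCard K : ℂ) ^ (-1 - s) else 1 - (resCard K : ℂ) ^ (-1 - s)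

/-- `torusFactor` multiplied by its denominator. -/
def torusNum [Fintype (ResTorus K n)] (h : Fin r → MvPolynomial (Fin n) (RingInt K))
    (a : Fin n → ℝ) (s : Fin r → ℂ) : ℂ :=
  ∑ z : ResTorus K n, (resCard K : ℂ)⁻¹ ^ n * ∏ i, levelNum K
    (MvPolynomial.eval (fun j => (z j : ResField K)) (reduction (faceFun (h i) a)) = 0) (s i)

theorem prod_mul_torusFactor [Fintype (ResTorus K n)] (a : Fin n → ℝ) {s : Fin r → ℂ}
    (hs : ∀ i, 1 - (resCard K : ℂ) ^ (-1 - s i) ≠ 0) :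
    (∏ i, (1 - (resCard K : ℂ) ^ (-1 - s i))) * torusFactor h a s = torusNum h a s := by
  rw [torusFactor, torusNum, Finset.mul_sum]
  refine Finset.sum_congr rfl fun z _ => ?_
  rw [mul_left_comm, ← Finset.prod_mul_distrib]
  congr 1
  refine Finset.prod_congr rfl fun i _ => ?_
  rw [levelSum, levelNum]
  split_ifs
  · rw [mul_div_cancel₀ _ (hs i)]
  · rw [mul_one]

/-- The common denominator of the zeta function. -/
def zetaDen (h : Fin r → MvPolynomial (Fin n) (RingInt K)) (𝒲 : Finset (Finset (Fin n → ℕ)))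
    (s : Fin r → ℂ) : ℂ :=
  (∏ i, (1 - (resCard K : ℂ) ^ (-1 - s i))) * ∏ w ∈ 𝒲.biUnion id, (1 - latticeTerm h s w)

/-- The zeta function multiplied by its common denominator. -/
def zetaNum [Fintype (ResTorus K n)] (h : Fin r → MvPolynomial (Fin n) (RingInt K))
    (𝒲 : Finset (Finset (Fin n → ℕ))) (s : Fin r → ℂ) : ℂ :=
  ∑ W ∈ 𝒲, torusNum h (barycenter W) s *
    (coneNum h s W * ∏ w ∈ 𝒲.biUnion id \ W, (1 - latticeTerm h s w))

theorem zetaDen_ne_zero_iff {𝒲 : Finset (Finset (Fin n → ℕ))} {s : Fin r → ℂ} :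
    zetaDen h 𝒲 s ≠ 0 ↔ (∀ i, 1 - (resCard K : ℂ) ^ (-1 - s i) ≠ 0) ∧
      ∀ W ∈ 𝒲, ∀ w ∈ W, 1 - latticeTerm h s w ≠ 0 := by
  simp only [zetaDen, mul_ne_zero_iff, Finset.prod_ne_zero_iff, Finset.mem_univ, true_imp_iff,
    Finset.mem_biUnion, id, forall_exists_index, and_imp]
  exact and_congr_right fun _ => ⟨fun h W hW w hw => h w W hW hw, fun h w W hW hw => h W hW w hw⟩

/-- A generator shared by several cones occurs once in the common denominator; each cone leaves the
factors of the generators it lacks. -/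
theorem zetaDen_mul_sum [Fintype (ResTorus K n)] {𝒲 : Finset (Finset (Fin n → ℕ))} {s : Fin r → ℂ}
    (hs : zetaDen h 𝒲 s ≠ 0) :
    zetaDen h 𝒲 s * ∑ W ∈ 𝒲, torusFactor h (barycenter W) s *
      (coneNum h s W / ∏ w ∈ W, (1 - latticeTerm h s w)) = zetaNum h 𝒲 s := by
  obtain ⟨h1, h2⟩ := zetaDen_ne_zero_iff.1 hs
  rw [Finset.mul_sum, zetaNum]
  refine Finset.sum_congr rfl fun W hW => ?_
  have h3 : ∏ w ∈ W, (1 - latticeTerm h s w) ≠ 0 := Finset.prod_ne_zero_iff.2 (h2 W hW)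
  have h4 : W ⊆ 𝒲.biUnion id := Finset.subset_biUnion_of_mem id hW
  rw [zetaDen, ← prod_mul_torusFactor _ h1, ← Finset.prod_sdiff h4]
  field_simp

/-- Used twice: for Re s_i > 0, where it identifies the continuation, and on the line s₂ = -s₁ over
the band. That line does not meet the region Re s_i > 0, and applying the same identity there makes
a continuation argument between the two unnecessary. -/
theorem zetaDen_mul_integral [LocallyCompactSpace K] [MeasurableSpace K] [BorelSpace K]
    {μ : Measure (Fin n → K)} [μ.IsAddHaarMeasure] [Fintype (ResTorus K n)]
    (hϖ : IsUniformizer ϖ)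
    (hμ : μ {x | ∀ j, ‖x j‖ ≤ 1} = 1) (hh : ∀ i, h i ≠ 0) (hnd : NonDegenerate h)
    {𝒲 : Finset (Finset (Fin n → ℕ))} (h𝒲 : IsConePartition 𝒲)
    (hsub : ∀ W ∈ 𝒲, IsSubordinate h W) {s : Fin r → ℂ} (hs : ∀ i, -1 < (s i).re)
    (hlt : ∀ W ∈ 𝒲, ∀ w ∈ W, ‖latticeTerm h s w‖ < 1) :
    zetaDen h 𝒲 s ≠ 0 ∧
    IntegrableOn (fun x : Fin n → K => ∏ i, ((‖MvPolynomial.aeval x (h i)‖ : ℝ) : ℂ) ^ s i)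
        (zetaDomain h) μ ∧
      zetaDen h 𝒲 s * ∫ x in zetaDomain h,
        ∏ i, ((‖MvPolynomial.aeval x (h i)‖ : ℝ) : ℂ) ^ s i ∂μ = zetaNum h 𝒲 s := by
  obtain ⟨h1, h2⟩ := integral_zetaDomain_eq_sum hϖ hμ hh hnd h𝒲 hsub hs hlt
  have h3 : zetaDen h 𝒲 s ≠ 0 := by
    refine zetaDen_ne_zero_iff.2 ⟨fun i => hϖ.one_sub_cpow_ne_zero ?_, fun W hW w hw h0 => ?_⟩
    · have := hs i
      simp only [Complex.sub_re, Complex.neg_re, Complex.one_re]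
      linarith
    · have h4 := hlt W hW w hw
      rw [← sub_eq_zero.1 h0, norm_one] at h4
      exact h4.false
  exact ⟨h3, h1, by rw [h2, zetaDen_mul_sum h3]⟩

end Clearing

section Analytic

variable {E : Type*} [NormedAddCommGroup E] [NormedSpace ℂ E]

theorem IsUniformizer.analyticAt_cpow (hϖ : IsUniformizer ϖ) {φ : E → ℂ} {x : E}
    (hφ : AnalyticAt ℂ φ x) : AnalyticAt ℂ (fun y => (resCard K : ℂ) ^ φ y) x := by
  simp only [Complex.cpow_def_of_ne_zero hϖ.natCast_ne_zero]
  fun_prop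

theorem analyticAt_coordinate (i : Fin r) (s : Fin r → ℂ) :
    AnalyticAt ℂ (fun s : Fin r → ℂ => s i) s :=
  (ContinuousLinearMap.proj (R := ℂ) (φ := fun _ : Fin r => ℂ) i).analyticAt s

theorem analyticAt_unitFactor (hϖ : IsUniformizer ϖ) (i : Fin r) (s : Fin r → ℂ) :
    AnalyticAt ℂ (fun s : Fin r → ℂ => (resCard K : ℂ) ^ (-1 - s i)) s :=
  hϖ.analyticAt_cpow (analyticAt_const.sub (analyticAt_coordinate i s))

theorem analyticAt_linear (c : ℂ) (d : Fin r → ℂ) (s : Fin r → ℂ) :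
    AnalyticAt ℂ (fun s : Fin r → ℂ => c - ∑ i, d i * s i) s :=
  analyticAt_const.sub (Finset.univ.analyticAt_fun_sum fun i _ =>
    analyticAt_const.mul (analyticAt_coordinate i s))

theorem analyticAt_latticeTerm (hϖ : IsUniformizer ϖ) (k : Fin n → ℕ) (s : Fin r → ℂ) :
    AnalyticAt ℂ (fun s => latticeTerm h s k) s :=
  hϖ.analyticAt_cpow (analyticAt_linear _ _ s)

theorem analyticAt_zetaDen (hϖ : IsUniformizer ϖ) (𝒲 : Finset (Finset (Fin n → ℕ)))
    (s : Fin r → ℂ) : AnalyticAt ℂ (zetaDen h 𝒲) s :=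
  (Finset.univ.analyticAt_fun_prod fun i _ =>
    analyticAt_const.sub (analyticAt_unitFactor hϖ i s)).mul
  ((𝒲.biUnion id).analyticAt_fun_prod fun w _ =>
    analyticAt_const.sub (analyticAt_latticeTerm hϖ w s))

theorem analyticAt_zetaNum [Fintype (ResTorus K n)] (hϖ : IsUniformizer ϖ)
    (𝒲 : Finset (Finset (Fin n → ℕ))) (s : Fin r → ℂ) : AnalyticAt ℂ (zetaNum h 𝒲) s := by
  refine 𝒲.analyticAt_fun_sum fun W _ => AnalyticAt.mul ?_ (AnalyticAt.mul ?_ ?_)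
  · refine Finset.univ.analyticAt_fun_sum fun z _ => analyticAt_const.mul
      (Finset.univ.analyticAt_fun_prod fun i _ => ?_)
    simp only [levelNum]
    split_ifs
    · exact analyticAt_const.mul (analyticAt_unitFactor hϖ i s)
    · exact analyticAt_const.sub (analyticAt_unitFactor hϖ i s)
  · exact Finset.analyticAt_fun_sum _ fun t _ => hϖ.analyticAt_cpow (analyticAt_linear _ _ s)
  · exact Finset.analyticAt_fun_prod _ fun w _ =>
      analyticAt_const.sub (analyticAt_latticeTerm hϖ w s)

theorem analyticAt_antidiagonal (s : ℂ) : AnalyticAt ℂ (fun s : ℂ => ![s, -s]) s := by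
  refine analyticAt_pi_iff.2 fun i => ?_
  fin_cases i
  · exact analyticAt_id
  · exact analyticAt_id.neg

end Analytic

/-! ### Laurent polynomials in q^{-s}. -/

section Laurent

/-- `φ` is a Laurent polynomial in `q ^ (-s)`. -/
def IsLaurent (K : Type*) [NontriviallyNormedField K] [IsUltrametricDist K] (φ : ℂ → ℂ) : Prop :=
  ∃ (P : Polynomial ℂ) (N : ℕ), ∀ s, φ s * ((resCard K : ℂ) ^ (-s)) ^ N =
    P.eval ((resCard K : ℂ) ^ (-s))

theorem IsLaurent.const (c : ℂ) : IsLaurent K fun _ => c := ⟨Polynomial.C c, 0, by simp⟩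

theorem IsLaurent.add {φ ψ : ℂ → ℂ} (hφ : IsLaurent K φ) (hψ : IsLaurent K ψ) :
    IsLaurent K fun s => φ s + ψ s := by
  obtain ⟨P, N, hP⟩ := hφ
  obtain ⟨Q, M, hQ⟩ := hψ
  refine ⟨P * Polynomial.X ^ M + Q * Polynomial.X ^ N, N + M, fun s => ?_⟩
  simp only [Polynomial.eval_add, Polynomial.eval_mul, Polynomial.eval_pow, Polynomial.eval_X,
    ← hP, ← hQ]
  ring

theorem IsLaurent.mul {φ ψ : ℂ → ℂ} (hφ : IsLaurent K φ) (hψ : IsLaurent K ψ) :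
    IsLaurent K fun s => φ s * ψ s := by
  obtain ⟨P, N, hP⟩ := hφ
  obtain ⟨Q, M, hQ⟩ := hψ
  refine ⟨P * Q, N + M, fun s => ?_⟩
  simp only [Polynomial.eval_mul, ← hP, ← hQ]
  ring

theorem IsLaurent.sub {φ ψ : ℂ → ℂ} (hφ : IsLaurent K φ) (hψ : IsLaurent K ψ) :
    IsLaurent K fun s => φ s - ψ s := by
  simpa only [neg_one_mul, ← sub_eq_add_neg] using hφ.add ((IsLaurent.const (-1)).mul hψ)

theorem IsLaurent.sum {ι : Type*} (t : Finset ι) {φ : ι → ℂ → ℂ}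
    (hφ : ∀ i ∈ t, IsLaurent K (φ i)) : IsLaurent K fun s => ∑ i ∈ t, φ i s := by
  classical
  induction t using Finset.induction_on with
  | empty => simpa using IsLaurent.const 0
  | insert i t hi ih =>
    simp only [Finset.sum_insert hi]
    exact (hφ i (Finset.mem_insert_self i t)).add
      (ih fun j hj => hφ j (Finset.mem_insert_of_mem hj))

theorem IsLaurent.prod {ι : Type*} (t : Finset ι) {φ : ι → ℂ → ℂ}
    (hφ : ∀ i ∈ t, IsLaurent K (φ i)) : IsLaurent K fun s => ∏ i ∈ t, φ i s := by
  classical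
  induction t using Finset.induction_on with
  | empty => simpa using IsLaurent.const 1
  | insert i t hi ih =>
    simp only [Finset.prod_insert hi]
    exact (hφ i (Finset.mem_insert_self i t)).mul
      (ih fun j hj => hφ j (Finset.mem_insert_of_mem hj))

theorem isLaurent_cpow (hϖ : IsUniformizer ϖ) (c : ℂ) (a b : ℕ) :
    IsLaurent K fun s => (resCard K : ℂ) ^ (c + a * s - b * s) := by
  refine ⟨Polynomial.C ((resCard K : ℂ) ^ c) * Polynomial.X ^ b, a, fun s => ?_⟩
  simp only [Polynomial.eval_mul, Polynomial.eval_C, Polynomial.eval_pow, Polynomial.eval_X,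
    ← Complex.cpow_nat_mul, ← Complex.cpow_add _ _ hϖ.natCast_ne_zero]
  congr 1
  ring

theorem exists_nat_dist_eq {f : MvPolynomial (Fin n) (RingInt K)} (hf : f ≠ 0) (k : Fin n → ℕ) :
    ∃ d : ℕ, dist (toReal k) (newtonPolyhedron f) = d := by
  obtain ⟨m, -, hm⟩ := exists_dist_eq hf (toReal_nonneg k)
  exact ⟨natPairing k m, by rw [hm, pairing_toReal]⟩

theorem latticeTerm_antidiagonal (f g : MvPolynomial (Fin n) (RingInt K)) (s : ℂ)
    (k : Fin n → ℕ) : latticeTerm ![f, g] ![s, -s] k =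
      (resCard K : ℂ) ^ (-(sigma k : ℂ) + (distDiff f g (toReal k) : ℂ) * s) := by
  rw [latticeTerm, distDiff, Fin.sum_univ_two]
  congr 1
  simp only [Matrix.cons_val_zero, Matrix.cons_val_one]
  push_cast
  ring

variable {f g : MvPolynomial (Fin n) (RingInt K)}

theorem isLaurent_latticeTerm (hϖ : IsUniformizer ϖ) (hf : f ≠ 0) (hg : g ≠ 0) (k : Fin n → ℕ) :
    IsLaurent K fun s => latticeTerm ![f, g] ![s, -s] k := by
  obtain ⟨a, ha⟩ := exists_nat_dist_eq hg k
  obtain ⟨b, hb⟩ := exists_nat_dist_eq hf k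
  simp only [latticeTerm_antidiagonal, distDiff, ha, hb]
  have := isLaurent_cpow hϖ (-(sigma k : ℂ)) a b
  refine Eq.mpr (congrArg (IsLaurent K) (funext fun s => ?_)) this
  congr 1
  push_cast
  ring

theorem isLaurent_unitFactor (hϖ : IsUniformizer ϖ) (i : Fin 2) :
    IsLaurent K fun s => (resCard K : ℂ) ^ (-1 - ![s, -s] i) := by
  fin_cases i
  · simpa using isLaurent_cpow hϖ (-1) 0 1
  · simpa using isLaurent_cpow hϖ (-1) 1 0

theorem isLaurent_zetaDen (hϖ : IsUniformizer ϖ) (hf : f ≠ 0) (hg : g ≠ 0)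
    (𝒲 : Finset (Finset (Fin n → ℕ))) : IsLaurent K fun s => zetaDen ![f, g] 𝒲 ![s, -s] :=
  (IsLaurent.prod _ fun i _ => (IsLaurent.const 1).sub (isLaurent_unitFactor hϖ i)).mul
    (IsLaurent.prod _ fun w _ => (IsLaurent.const 1).sub (isLaurent_latticeTerm hϖ hf hg w))

theorem isLaurent_zetaNum [Fintype (ResTorus K n)] (hϖ : IsUniformizer ϖ) (hf : f ≠ 0)
    (hg : g ≠ 0) (𝒲 : Finset (Finset (Fin n → ℕ))) :
    IsLaurent K fun s => zetaNum ![f, g] 𝒲 ![s, -s] := by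
  refine IsLaurent.sum _ fun W _ => IsLaurent.mul ?_ (IsLaurent.mul ?_ ?_)
  · refine IsLaurent.sum _ fun z _ => (IsLaurent.const _).mul (IsLaurent.prod _ fun i _ => ?_)
    simp only [levelNum]
    split_ifs
    · exact (IsLaurent.const _).mul (isLaurent_unitFactor hϖ i)
    · exact (IsLaurent.const 1).sub (isLaurent_unitFactor hϖ i)
  · refine IsLaurent.sum _ fun t ht => ?_
    -- Fundamental points have natural coordinates, so the support functions take integer values at
    -- them and the exponents of q^{-s} are integers.
    have ht' := fundamentalPoints_nonneg ((fundamentalPoints_finite W).mem_toFinset.1 ht)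
    have e : t = toInt fun j => (t j).toNat := funext fun j => (Int.toNat_of_nonneg (ht' j)).symm
    rw [e]
    simp only [intTerm_toInt]
    exact isLaurent_latticeTerm hϖ hf hg _
  · exact IsLaurent.prod _ fun w _ => (IsLaurent.const 1).sub (isLaurent_latticeTerm hϖ hf hg w)

end Laurent

end NewtonZeta

/-! ### The explicit formula, the band of convergence and the candidate poles. -/

namespace NewtonZeta

variable {K : Type*} [NontriviallyNormedField K] [IsUltrametricDist K] {n : ℕ}
  {ϖ : RingInt K} {f g : MvPolynomial (Fin n) (RingInt K)}

section Formula

theorem natCard_torus (P : (Fin n → ResField K) → Prop) [Fintype (ResTorus K n)]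
    [DecidablePred fun z : ResTorus K n => P fun j => (z j : ResField K)] :
    Nat.card {z : Fin n → ResField K // (∀ j, z j ≠ 0) ∧ P z} =
      (Finset.univ.filter fun z : ResTorus K n => P fun j => (z j : ResField K)).card := by
  rw [← Fintype.card_subtype, ← Nat.card_eq_fintype_card]
  exact Nat.card_congr
    { toFun := fun z => ⟨fun j => ⟨z.1 j, z.2.1 j⟩, z.2.2⟩
      invFun := fun z => ⟨fun j => (z.1 j : ResField K), fun j => (z.1 j).2, z.2⟩
      left_inv := fun _ => rfl
      right_inv := fun _ => rfl }

theorem card_resTorus [Fintype (ResTorus K n)] (hϖ : IsUniformizer ϖ) :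
    (Fintype.card (ResTorus K n) : ℂ) = ((resCard K : ℂ) - 1) ^ n := by
  classical
  have := hϖ.finite
  have := Fintype.ofFinite (ResField K)
  have hcard : Nat.card {r : ResField K // r ≠ 0} = resCard K - 1 := by
    rw [Nat.card_eq_fintype_card, Fintype.card_subtype_compl, Fintype.card_subtype_eq, resCard,
      Nat.card_eq_fintype_card]
  rw [← Nat.card_eq_fintype_card, Nat.card_pi, Finset.prod_const, hcard, Finset.card_univ,
    Fintype.card_fin, Nat.cast_pow, Nat.cast_sub hϖ.one_lt.le, Nat.cast_one]

theorem IsUniformizer.cpow_neg_one_sub (hϖ : IsUniformizer ϖ) (s : ℂ) :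
    (resCard K : ℂ) ^ (-1 - s) = (resCard K : ℂ)⁻¹ * (resCard K : ℂ) ^ (-s) := by
  rw [sub_eq_add_neg, Complex.cpow_add _ _ hϖ.natCast_ne_zero, Complex.cpow_neg_one]

theorem levelSum_of_true (hϖ : IsUniformizer ϖ) {p : Prop} (hp : p) {s : ℂ}
    (hs : 1 - (resCard K : ℂ) ^ (-1 - s) ≠ 0) :
    levelSum K p s = 1 - (1 - (resCard K : ℂ) ^ (-s)) / (1 - (resCard K : ℂ) ^ (-1 - s)) := by
  have hq := hϖ.natCast_ne_zero
  rw [levelSum, if_pos hp, eq_sub_iff_add_eq, ← add_div, div_eq_one_iff_eq hs,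
    hϖ.cpow_neg_one_sub]
  field_simp
  ring

/-- Each point of the torus contributes 1, 1 - U, 1 - U' or (1 - U)(1 - U'), according to which
reductions vanish. The last product equals 1 - V, and counting points of each kind gives the
formula. -/
theorem torusFactor_eq_LFactor [Fintype (ResTorus K n)] (hϖ : IsUniformizer ϖ)
    (W : Finset (Fin n → ℕ)) {s : ℂ} (h1 : 1 - (resCard K : ℂ) ^ (-1 - s) ≠ 0)
    (h2 : 1 - (resCard K : ℂ) ^ (-1 + s) ≠ 0) :
    torusFactor ![f, g] (barycenter W) ![s, -s] = LFactor f g W s := by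
  classical
  have hq := hϖ.natCast_ne_zero
  have hT : (resCard K : ℂ) ^ (-s) * (resCard K : ℂ) ^ s = 1 := by
    rw [← Complex.cpow_add _ _ hq, neg_add_cancel, Complex.cpow_zero]
  have h2' : 1 - (resCard K : ℂ) ^ (-1 - -s) ≠ 0 := by rwa [sub_neg_eq_add]
  set U := (1 - (resCard K : ℂ) ^ (-s)) / (1 - (resCard K : ℂ) ^ (-1 - s)) with hU
  set U' := (1 - (resCard K : ℂ) ^ s) / (1 - (resCard K : ℂ) ^ (-1 + s)) with hU'
  set V := ((1 - (resCard K : ℂ) ^ (-s)) * (1 - (resCard K : ℂ) ^ s)) /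
    ((resCard K : ℂ) * (1 - (resCard K : ℂ) ^ (-1 - s)) * (1 - (resCard K : ℂ) ^ (-1 + s))) with hV
  have hUV : (1 - U) * (1 - U') = 1 - V := by
    have e2 : (resCard K : ℂ) ^ (-1 + s) = (resCard K : ℂ)⁻¹ * (resCard K : ℂ) ^ s := by
      rw [Complex.cpow_add _ _ hq, Complex.cpow_neg_one]
    rw [hU, hU', hV]
    rw [hϖ.cpow_neg_one_sub] at h1 ⊢
    rw [e2] at h2 ⊢
    generalize (resCard K : ℂ) ^ (-s) = T at *
    generalize (resCard K : ℂ) ^ s = T' at *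
    generalize (resCard K : ℂ) = q at *
    have h3 : q - T ≠ 0 := fun h => h1 (by rw [← sub_eq_zero.1 h, inv_mul_cancel₀ hq, sub_self])
    have h4 : q - T' ≠ 0 := fun h => h2 (by rw [← sub_eq_zero.1 h, inv_mul_cancel₀ hq, sub_self])
    have e3 : 1 - q⁻¹ * T = (q - T) / q := by field_simp
    have e4 : 1 - q⁻¹ * T' = (q - T') / q := by field_simp
    rw [e3, e4]
    field_simp
    -- The two sides differ by a multiple of T T' - 1: the identity relies on the two exponents
    -- being opposite.
    linear_combination (q ^ 2 - q) * hT
  have hterm : ∀ z : ResTorus K n, (∏ i, levelSum K (MvPolynomial.eval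
      (fun j => (z j : ResField K)) (reduction (faceFun (![f, g] i) (barycenter W))) = 0)
        (![s, -s] i)) =
      1 - (if MvPolynomial.eval (fun j => (z j : ResField K))
          (reduction (faceFun f (barycenter W))) = 0 ∧ MvPolynomial.eval
          (fun j => (z j : ResField K)) (reduction (faceFun g (barycenter W))) ≠ 0 then U else 0)
        - (if MvPolynomial.eval (fun j => (z j : ResField K))
          (reduction (faceFun g (barycenter W))) = 0 ∧ MvPolynomial.eval
          (fun j => (z j : ResField K)) (reduction (faceFun f (barycenter W))) ≠ 0 then U' else 0)
        - (if MvPolynomial.eval (fun j => (z j : ResField K))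
          (reduction (faceFun f (barycenter W))) = 0 ∧ MvPolynomial.eval
          (fun j => (z j : ResField K)) (reduction (faceFun g (barycenter W))) = 0
            then V else 0) := fun z => by
    rw [Fin.prod_univ_two]
    simp only [Matrix.cons_val_zero, Matrix.cons_val_one]
    by_cases hp : MvPolynomial.eval (fun j => (z j : ResField K))
        (reduction (faceFun f (barycenter W))) = 0 <;>
      by_cases hp' : MvPolynomial.eval (fun j => (z j : ResField K))
        (reduction (faceFun g (barycenter W))) = 0
    · rw [levelSum_of_true hϖ hp h1, levelSum_of_true hϖ hp' h2', neg_neg, sub_neg_eq_add, ← hU,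
        ← hU', hUV]
      simp [hp, hp']
    · rw [levelSum_of_true hϖ hp h1, ← hU, levelSum, if_neg hp']
      simp [hp, hp']
    · rw [levelSum_of_true hϖ hp' h2', neg_neg, sub_neg_eq_add, ← hU', levelSum, if_neg hp]
      simp [hp, hp']
    · rw [levelSum, if_neg hp, levelSum, if_neg hp']
      simp [hp, hp']
  rw [torusFactor, ← Finset.mul_sum, LFactor, Complex.cpow_neg, Complex.cpow_natCast, inv_pow]
  congr 1
  simp only [hterm, Finset.sum_sub_distrib, ← Finset.sum_filter, Finset.sum_const, nsmul_eq_mul,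
    mul_one, Finset.card_univ, card_resTorus hϖ]
  rw [countOne, countOne, countBoth, natCard_torus, natCard_torus, natCard_torus]

theorem denomFactor_eq (w : Fin n → ℕ) (s : ℂ) :
    denomFactor f g w s = 1 - latticeTerm ![f, g] ![s, -s] w := by
  rw [denomFactor, latticeTerm_antidiagonal]

theorem coneNum_div_eq_SFactor (W : Finset (Fin n → ℕ)) (s : ℂ) :
    coneNum ![f, g] ![s, -s] W / ∏ w ∈ W, (1 - latticeTerm ![f, g] ![s, -s] w) =
      SFactor f g W s := by
  rw [SFactor, coneNum]
  simp only [denomFactor_eq]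
  congr 1
  refine Finset.sum_congr rfl fun t _ => ?_
  rw [intTerm, Fin.sum_univ_two, distDiff]
  congr 1
  simp only [Matrix.cons_val_zero, Matrix.cons_val_one]
  push_cast
  ring

theorem coneNum_empty (hf : f ≠ 0) (hg : g ≠ 0) (s : ℂ) : coneNum ![f, g] ![s, -s] ∅ = 1 := by
  have h0 : ∀ h : MvPolynomial (Fin n) (RingInt K), h ≠ 0 →
      dist (fun _ => 0) (newtonPolyhedron h) = 0 := fun h hh => by
    obtain ⟨m, -, hm⟩ := exists_dist_eq (a := fun _ => 0) hh fun _ => le_rfl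
    simpa [pairing] using hm
  have e : (fundamentalPoints_finite (∅ : Finset (Fin n → ℕ))).toFinset = {0} := by
    ext t
    simp only [Set.Finite.mem_toFinset, Finset.mem_singleton, fundamentalPoints, mem_ofPred_eq]
    constructor
    · rintro ⟨c, -, h⟩
      ext j
      have := congrFun h j
      simpa using this
    · rintro rfl
      exact ⟨fun _ => 0, by simp, by ext j; simp⟩
  rw [coneNum, e, Finset.sum_singleton, intTerm, Fin.sum_univ_two]
  simp [h0 f hf, h0 g hg]

end Formula

section Subdivision

/-- The subdivision omits the origin, and the cone of the empty set of generators is exactly {0}; it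
accounts for the points all of whose coordinates are units. -/
theorem isConePartition_insert_empty {Γ : Set (Fin n → ℝ)} (F : SimplicialSubdivision Γ) :
    IsConePartition (insert ∅ F.cones) := by
  have hcov : ∀ W ∈ F.cones, ∀ x ∈ openCone W, (∀ j, 0 ≤ x j) ∧ x ≠ 0 := fun W hW x hx => by
    have : x ∈ ⋃ W ∈ F.cones, openCone W := mem_iUnion₂.2 ⟨W, hW, hx⟩
    rwa [F.cover] at this
  have hempty : ∀ x ∈ openCone (∅ : Finset (Fin n → ℕ)), x = 0 := by
    rintro x ⟨c, -, rfl⟩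
    simp
  refine ⟨fun W hW W' hW' hne => ?_, fun k => ?_⟩
  · rw [Finset.mem_insert] at hW hW'
    rcases hW with rfl | hW <;> rcases hW' with rfl | hW'
    · exact (hne rfl).elim
    · exact Set.disjoint_left.2 fun x hx hx' => (hcov _ hW' x hx').2 (hempty x hx)
    · exact Set.disjoint_left.2 fun x hx hx' => (hcov _ hW x hx).2 (hempty x hx')
    · exact F.disjoint W hW W' hW' hne
  · by_cases hk : toReal k = 0
    · refine ⟨∅, Finset.mem_insert_self _ _, ?_⟩
      rw [hk]
      simpa [barycenter] using barycenter_mem_openCone (∅ : Finset (Fin n → ℕ))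
    · have : toReal k ∈ ⋃ W ∈ F.cones, openCone W := by
        rw [F.cover]
        exact ⟨toReal_nonneg k, hk⟩
      obtain ⟨W, hW, hkW⟩ := mem_iUnion₂.1 this
      exact ⟨W, Finset.mem_insert_of_mem hW, hkW⟩

theorem isSubordinate_of_mem (hf : f ≠ 0) (hg : g ≠ 0)
    (F : SimplicialSubdivision (newtonPolyhedron (f * g))) :
    ∀ W ∈ insert ∅ F.cones, IsSubordinate ![f, g] W := by
  intro W hW
  rcases Finset.mem_insert.1 hW with rfl | hW
  · exact isSubordinate_empty (Fin.forall_fin_two.2 ⟨hf, hg⟩)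
  · obtain ⟨τ, ⟨-, -, -, -, -, hτ⟩, hWτ⟩ := F.subordinate W hW
    have hWτ' : openCone W ⊆ faceCone (newtonPolyhedron (g * f)) τ := by rwa [mul_comm]
    exact ⟨F.linearIndependent W hW, Fin.forall_fin_two.2
      ⟨exists_dist_eq_pairing_on_cone hf hg hτ hWτ, exists_dist_eq_pairing_on_cone hg hf hτ hWτ'⟩,
      Fin.forall_fin_two.2
        ⟨fun a ha => faceFun_eq_of_mem_openCone hf hg hτ hWτ ha (barycenter_mem_openCone W),
        fun a ha => faceFun_eq_of_mem_openCone hg hf hτ hWτ' ha (barycenter_mem_openCone W)⟩⟩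

theorem sigma_pos {w : Fin n → ℕ} (hw : w ≠ 0) : 0 < sigma w := by
  obtain ⟨j, hj⟩ := Function.ne_iff.1 hw
  exact Finset.sum_pos' (fun _ _ => Nat.zero_le _) ⟨j, Finset.mem_univ j, Nat.pos_of_ne_zero hj⟩

theorem norm_latticeTerm_lt_one (hϖ : IsUniformizer ϖ) (hf : f ≠ 0) (hg : g ≠ 0)
    {w : Fin n → ℕ} (hw : w ≠ 0) {s : Fin 2 → ℂ} (hs : ∀ i, 0 < (s i).re) :
    ‖latticeTerm ![f, g] s w‖ < 1 := by
  refine hϖ.norm_cpow_lt_one ?_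
  obtain ⟨a, ha⟩ := exists_nat_dist_eq hf w
  obtain ⟨b, hb⟩ := exists_nat_dist_eq hg w
  have h1 : (0 : ℝ) < sigma w := by exact_mod_cast sigma_pos hw
  have h2 := mul_nonneg (Nat.cast_nonneg (α := ℝ) a) (hs 0).le
  have h3 := mul_nonneg (Nat.cast_nonneg (α := ℝ) b) (hs 1).le
  simp only [Fin.sum_univ_two, Matrix.cons_val_zero, Matrix.cons_val_one, ha, hb, Complex.sub_re,
    Complex.neg_re, Complex.natCast_re, Complex.add_re, Complex.re_ofReal_mul]
  linarith

/-- The modulus is less than 1 exactly when e(w) Re s < σ(w). According to the sign of e(w) this is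
a lower bound on Re s, no condition since σ(w) > 0, or an upper bound; the bounds are those that
define the band. -/
theorem norm_latticeTerm_antidiagonal_lt_one (hϖ : IsUniformizer ϖ) {w : Fin n → ℕ}
    (hw : w ∈ facetNormals (newtonPolyhedron (f * g))) {s : ℂ} (hs : s ∈ band f g) :
    ‖latticeTerm ![f, g] ![s, -s] w‖ < 1 := by
  rw [latticeTerm_antidiagonal]
  refine hϖ.norm_cpow_lt_one ?_
  have hσ : (0 : ℝ) < sigma w := by exact_mod_cast sigma_pos hw.1
  simp only [Complex.add_re, Complex.neg_re, Complex.natCast_re, Complex.re_ofReal_mul]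
  rcases lt_trichotomy (distDiff f g (toReal w)) 0 with h | h | h
  · have h1 : ((slope f g w : ℝ) : EReal) ≤ beta f g :=
      le_iSup₂ (f := fun w _ => ((slope f g w : ℝ) : EReal)) w ⟨hw, h⟩
    have h2 : slope f g w < s.re := by
      exact_mod_cast h1.trans_lt ((le_max_right _ _).trans_lt hs.1)
    rw [slope, div_lt_iff_of_neg h] at h2
    linarith
  · rw [h]
    linarith
  · have h1 : alpha f g ≤ ((slope f g w : ℝ) : EReal) :=
      iInf₂_le (f := fun w _ => ((slope f g w : ℝ) : EReal)) w ⟨hw, h⟩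
    have h2 : s.re < slope f g w := by
      exact_mod_cast (hs.2.trans_le (min_le_right _ _)).trans_le h1
    rw [slope, lt_div_iff₀ h] at h2
    linarith

theorem re_of_mem_band {s : ℂ} (hs : s ∈ band f g) : -1 < s.re ∧ s.re < 1 := by
  constructor
  · have h : ((-1 : ℝ) : EReal) < s.re := by simpa using (le_max_left _ _).trans_lt hs.1
    exact_mod_cast h
  · have := hs.2.trans_le (min_le_left _ _)
    exact_mod_cast this

end Subdivision

section Poles

theorem IsUniformizer.exists_int_of_cpow_eq_one (hϖ : IsUniformizer ϖ) {w : ℂ}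
    (hw : 1 - (resCard K : ℂ) ^ w = 0) :
    ∃ k : ℤ, (Real.log (resCard K) : ℂ) * w = 2 * Real.pi * Complex.I * k := by
  rw [Complex.cpow_def_of_ne_zero hϖ.natCast_ne_zero] at hw
  obtain ⟨k, hk⟩ := Complex.exp_eq_one_iff.1 (sub_eq_zero.1 hw).symm
  refine ⟨k, ?_⟩
  rw [Complex.natCast_log, hk]
  ring

theorem IsUniformizer.log_ne_zero (hϖ : IsUniformizer ϖ) :
    (Real.log (resCard K) : ℂ) ≠ 0 := by
  have : (1 : ℝ) < resCard K := by exact_mod_cast hϖ.one_lt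
  exact_mod_cast (Real.log_pos this).ne'

/-- A factor 1 - q^x vanishes only if x log q is an integral multiple of 2πi. For e(w) = 0 the
factor is the constant 1 - q^{-σ(w)}, which is not zero. -/
theorem mem_candidatePoles (hϖ : IsUniformizer ϖ) {𝒲 : Finset (Finset (Fin n → ℕ))}
    (h𝒲 : ∀ W ∈ 𝒲, ∀ w ∈ W, w ∈ facetNormals (newtonPolyhedron (f * g))) {s : ℂ}
    (hs : zetaDen ![f, g] 𝒲 ![s, -s] = 0) : s ∈ candidatePoles f g := by
  have hlog := hϖ.log_ne_zero
  by_contra hcon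
  simp only [candidatePoles, mem_union, not_or] at hcon
  obtain ⟨⟨hc1, hc2⟩, hc3⟩ := hcon
  refine zetaDen_ne_zero_iff.2 ⟨Fin.forall_fin_two.2 ⟨fun h => hc2 ?_, fun h => hc1 ?_⟩,
    fun W hW w hw h => ?_⟩ hs
  · obtain ⟨k, hk⟩ := hϖ.exists_int_of_cpow_eq_one h
    -- In the exponent -1 - s the variable has coefficient -1, which reverses the sign of the
    -- integer.
    refine ⟨-k, ?_⟩
    simp only [Matrix.cons_val_zero] at hk
    rw [← sub_eq_iff_eq_add', eq_div_iff hlog, Int.cast_neg]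
    linear_combination -hk
  · obtain ⟨k, hk⟩ := hϖ.exists_int_of_cpow_eq_one h
    refine ⟨k, ?_⟩
    simp only [Matrix.cons_val_one, Matrix.cons_val_fin_one] at hk
    rw [← sub_eq_iff_eq_add', eq_div_iff hlog]
    linear_combination hk
  · rw [latticeTerm_antidiagonal] at h
    by_cases he : distDiff f g (toReal w) = 0
    · refine hϖ.one_sub_cpow_ne_zero ?_ h
      have hσ : (0 : ℝ) < sigma w := by exact_mod_cast sigma_pos (h𝒲 W hW w hw).1
      simp [he, hσ]
    · obtain ⟨k, hk⟩ := hϖ.exists_int_of_cpow_eq_one h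
      refine hc3 ⟨w, h𝒲 W hW w hw, he, k, ?_⟩
      have he' : (distDiff f g (toReal w) : ℂ) ≠ 0 := by exact_mod_cast he
      rw [← sub_eq_iff_eq_add', eq_div_iff (mul_ne_zero he' hlog), slope, Complex.ofReal_div,
        sub_mul, ← mul_assoc (_ / _), div_mul_cancel₀ _ he', ← hk]
      push_cast
      ring

end Poles

end NewtonZeta

end

/-! ### The main theorem. -/

theorem theorem2 {K : Type*} [NontriviallyNormedField K] [IsUltrametricDist K]
    [LocallyCompactSpace K] [MeasurableSpace K] [BorelSpace K]
    -- the absolute value of the local field `K` is the normalized one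
    (hnorm : ∀ ϖ : NewtonZeta.RingInt K, Irreducible ϖ → ‖(ϖ : K)‖ = (NewtonZeta.resCard K : ℝ)⁻¹)
    {n : ℕ} (hn : 2 ≤ n)
    -- the Haar measure on `Kⁿ` for which `𝒪ⁿ` has measure one
    (μ : Measure (Fin n → K)) [μ.IsAddHaarMeasure]
    (hμ : μ {x | ∀ j, ‖x j‖ ≤ 1} = 1)
    (f g : MvPolynomial (Fin n) (NewtonZeta.RingInt K))
    (hf : ∀ c, f ≠ MvPolynomial.C c) (hg : ∀ c, g ≠ MvPolynomial.C c)
    (hf' : NewtonZeta.reduction f ≠ 0) (hg' : NewtonZeta.reduction g ≠ 0)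
    (hfg : NewtonZeta.NonDegenerate ![f, g])
    (F : NewtonZeta.SimplicialSubdivision (NewtonZeta.newtonPolyhedron (f * g))) :
    ∃ Z : ℂ → ℂ, NewtonZeta.IsQuotientZeta μ f g Z ∧
      -- (i) rationality in `q ^ (-s)` and the explicit formula
      (∃ P Q : Polynomial ℂ, Q ≠ 0 ∧ ∀ s : ℂ,
        Q.eval ((NewtonZeta.resCard K : ℂ) ^ (-s)) ≠ 0 →
          Z s = P.eval ((NewtonZeta.resCard K : ℂ) ^ (-s)) /
            Q.eval ((NewtonZeta.resCard K : ℂ) ^ (-s))) ∧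
      (∀ s : ℂ, 1 - (NewtonZeta.resCard K : ℂ) ^ (-1 - s) ≠ 0 →
        1 - (NewtonZeta.resCard K : ℂ) ^ (-1 + s) ≠ 0 →
        (∀ W ∈ F.cones, ∀ w ∈ W, NewtonZeta.denomFactor f g w s ≠ 0) →
          Z s = NewtonZeta.LFactor f g ∅ s +
            ∑ W ∈ F.cones, NewtonZeta.LFactor f g W s * NewtonZeta.SFactor f g W s) ∧
      -- (ii) holomorphy on the band, and the integral there
      DifferentiableOn ℂ Z (NewtonZeta.band f g) ∧
      (∀ s ∈ NewtonZeta.band f g,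
        IntegrableOn (fun x : Fin n → K =>
          ((‖MvPolynomial.aeval x f / MvPolynomial.aeval x g‖ : ℝ) : ℂ) ^ s)
          (NewtonZeta.zetaDomain ![f, g]) μ ∧
        Z s = ∫ x in NewtonZeta.zetaDomain ![f, g],
          ((‖MvPolynomial.aeval x f / MvPolynomial.aeval x g‖ : ℝ) : ℂ) ^ s ∂μ) ∧
      -- (iii) the poles
      (∀ s : ℂ, meromorphicOrderAt Z s < 0 → s ∈ NewtonZeta.candidatePoles f g) := by
  open NewtonZeta in
  classical
  obtain ⟨ϖ, hϖ⟩ := exists_isUniformizer hnorm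
  have := hϖ.finite
  have : Fintype (ResTorus K n) := Fintype.ofFinite _
  have hf0 : f ≠ 0 := fun h => hf 0 (by rw [h, map_zero])
  have hg0 : g ≠ 0 := fun h => hg 0 (by rw [h, map_zero])
  have hh : ∀ i, ![f, g] i ≠ 0 := Fin.forall_fin_two.2 ⟨hf0, hg0⟩
  set 𝒲 := insert ∅ F.cones with h𝒲def
  have h𝒲 : IsConePartition 𝒲 := isConePartition_insert_empty F
  have hsub : ∀ W ∈ 𝒲, IsSubordinate ![f, g] W := isSubordinate_of_mem hf0 hg0 F
  have hgen : ∀ W ∈ 𝒲, ∀ w ∈ W, w ∈ facetNormals (newtonPolyhedron (f * g)) := fun W hW w hw => by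
    rcases Finset.mem_insert.1 hW with rfl | hW
    · simp at hw
    · exact F.generators_mem W hW w hw
  set A : ℂ → ℂ := fun s => zetaNum ![f, g] 𝒲 ![s, -s] with hAdef
  set B : ℂ → ℂ := fun s => zetaDen ![f, g] 𝒲 ![s, -s] with hBdef
  have hA : ∀ s, AnalyticAt ℂ A s := fun s =>
    AnalyticAt.comp (g := zetaNum ![f, g] 𝒲) (f := fun s : ℂ => ![s, -s])
      (analyticAt_zetaNum hϖ 𝒲 _) (analyticAt_antidiagonal s)
  have hB : ∀ s, AnalyticAt ℂ B s := fun s =>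
    AnalyticAt.comp (g := zetaDen ![f, g] 𝒲) (f := fun s : ℂ => ![s, -s])
      (analyticAt_zetaDen hϖ 𝒲 _) (analyticAt_antidiagonal s)
  have hZ := fun {s} (hs : B s ≠ 0) => toMeromorphicNFOn_div hA hB hs
  have hB_band : ∀ s ∈ band f g, B s ≠ 0 ∧
      IntegrableOn (fun x : Fin n → K =>
          ((‖MvPolynomial.aeval x f / MvPolynomial.aeval x g‖ : ℝ) : ℂ) ^ s)
          (zetaDomain ![f, g]) μ ∧
        B s * ∫ x in zetaDomain ![f, g],
          ((‖MvPolynomial.aeval x f / MvPolynomial.aeval x g‖ : ℝ) : ℂ) ^ s ∂μ = A s := fun s hs => by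
    have hre := re_of_mem_band hs
    obtain ⟨h1, h2, h3⟩ := zetaDen_mul_integral (s := ![s, -s]) hϖ hμ hh hfg h𝒲 hsub
      (Fin.forall_fin_two.2 ⟨hre.1, by simpa using hre.2⟩)
      (fun W hW w hw => norm_latticeTerm_antidiagonal_lt_one hϖ (hgen W hW w hw) hs)
    have hm : MeasurableSet (zetaDomain ![f, g] : Set (Fin n → K)) := by
      have e : (zetaDomain ![f, g] : Set (Fin n → K)) = polyBox 0 0 ∩
          ⋂ i, (fun x : Fin n → K => MvPolynomial.aeval x (![f, g] i)) ⁻¹' {0}ᶜ := by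
        ext x
        rw [mem_inter_iff, mem_polyBox_zero_zero]
        simp [zetaDomain]
      rw [e]
      exact (measurableSet_polyBox _ _).inter (MeasurableSet.iInter fun i =>
        measurable_aeval _ (measurableSet_singleton _).compl)
    have hcongr : ∀ x ∈ (zetaDomain ![f, g] : Set (Fin n → K)),
        (∏ i, ((‖MvPolynomial.aeval x (![f, g] i)‖ : ℝ) : ℂ) ^ (![s, -s] i)) =
          ((‖MvPolynomial.aeval x f / MvPolynomial.aeval x g‖ : ℝ) : ℂ) ^ s := fun x hx => by
      rw [Fin.prod_univ_two]
      simp only [Matrix.cons_val_zero, Matrix.cons_val_one]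
      rw [norm_div, div_eq_mul_inv, Complex.ofReal_mul,
        Complex.mul_cpow_ofReal_nonneg (norm_nonneg _) (inv_nonneg.2 (norm_nonneg _)),
        Complex.cpow_neg, Complex.ofReal_inv, Complex.inv_cpow]
      rw [Complex.arg_ofReal_of_nonneg (norm_nonneg _)]
      exact Real.pi_pos.ne
    exact ⟨h1, (integrableOn_congr_fun hcongr hm).1 h2, by
      rw [← setIntegral_congr_fun hm hcongr]
      exact h3⟩
  -- At s = 0 the factors are 1 - q^{-1} and 1 - q^{-σ(w)}. This point shows that the denominator is
  -- not identically zero on the line, and later that `Q` is not the zero polynomial.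
  have hB0 : B 0 ≠ 0 := by
    refine zetaDen_ne_zero_iff.2 ⟨fun i => hϖ.one_sub_cpow_ne_zero ?_, fun W hW w hw => ?_⟩
    · fin_cases i <;> simp
    · rw [latticeTerm_antidiagonal]
      refine hϖ.one_sub_cpow_ne_zero ?_
      have := sigma_pos (hgen W hW w hw).1
      simpa using this
  refine ⟨toMeromorphicNFOn (fun s => A s / B s) univ, ⟨meromorphicNFOn_toMeromorphicNFOn _ _,
    zetaNum ![f, g] 𝒲, zetaDen ![f, g] 𝒲, fun s _ => analyticAt_zetaNum hϖ 𝒲 s,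
    fun s _ => analyticAt_zetaDen hϖ 𝒲 s, fun s hs => ?_, ⟨0, hB0⟩, fun s hs => (hZ hs).1⟩,
    ?_, ?_, ?_, ?_, ?_⟩
  · exact (zetaDen_mul_integral hϖ hμ hh hfg h𝒲 hsub (fun i => by linarith [hs i]) fun W hW w hw =>
      norm_latticeTerm_lt_one hϖ hf0 hg0 (hgen W hW w hw).1 hs).2.2
  · obtain ⟨P, N, hP⟩ := isLaurent_zetaNum hϖ hf0 hg0 𝒲
    obtain ⟨Q, M, hQ⟩ := isLaurent_zetaDen hϖ hf0 hg0 𝒲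
    -- With T = q^{-s} one has A T^N = P(T) and B T^M = Q(T), whence the crossed powers. Evaluation
    -- at T = 1, that is s = 0, shows that the denominator is non-zero.
    refine ⟨P * Polynomial.X ^ M, Q * Polynomial.X ^ N, fun h => ?_, fun s hs => ?_⟩
    · have h1 := congrArg (Polynomial.eval 1) h
      have h2 := hQ 0
      rw [neg_zero, Complex.cpow_zero, one_pow, mul_one] at h2
      rw [Polynomial.eval_mul, Polynomial.eval_pow, Polynomial.eval_X, one_pow, mul_one, ← h2,
        Polynomial.eval_zero] at h1
      exact hB0 h1
    · simp only [Polynomial.eval_mul, Polynomial.eval_pow, Polynomial.eval_X, ← hP, ← hQ] at hs ⊢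
      have hT : (resCard K : ℂ) ^ (-s) ≠ 0 := by
        simp [Complex.cpow_eq_zero_iff, hϖ.natCast_ne_zero]
      have hBs : B s ≠ 0 := left_ne_zero_of_mul (left_ne_zero_of_mul hs)
      rw [(hZ hBs).1, div_eq_div_iff hBs hs]
      simp only [hAdef, hBdef]
      ring
  · intro s h1 h2 h3
    have hBs : B s ≠ 0 := by
      refine zetaDen_ne_zero_iff.2 ⟨Fin.forall_fin_two.2 ⟨h1, ?_⟩, fun W hW w hw => ?_⟩
      · simpa using h2
      · rcases Finset.mem_insert.1 hW with rfl | hW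
        · simp at hw
        · rw [← denomFactor_eq]
          exact h3 W hW w hw
    -- Otherwise the origin would be covered by the subdivision; this is what lets the term of {0}
    -- be split off the sum.
    have h4 : ∅ ∉ F.cones := fun hmem => by
      have h5 : (0 : Fin n → ℝ) ∈ ⋃ W ∈ F.cones, openCone W :=
        mem_iUnion₂.2 ⟨∅, hmem, by
          simpa [barycenter] using barycenter_mem_openCone (∅ : Finset (Fin n → ℕ))⟩
      rw [F.cover] at h5
      exact h5.2 rfl
    have h5 := zetaDen_mul_sum (h := ![f, g]) hBs
    rw [(hZ hBs).1, div_eq_iff hBs, mul_comm]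
    refine h5.symm.trans (congrArg _ ?_)
    rw [h𝒲def, Finset.sum_insert h4, coneNum_empty hf0 hg0, Finset.prod_empty, div_one, mul_one]
    simp only [torusFactor_eq_LFactor hϖ _ h1 h2, coneNum_div_eq_SFactor]
  · exact fun s hs => (hZ (hB_band s hs).1).2.differentiableAt.differentiableWithinAt
  · intro s hs
    obtain ⟨h1, h2, h3⟩ := hB_band s hs
    refine ⟨h2, ?_⟩
    rw [(hZ h1).1, div_eq_iff h1, mul_comm]
    exact h3.symm
  · intro s hs
    refine mem_candidatePoles hϖ hgen ?_
    -- Where the denominator does not vanish, the normal form is analytic, so its order there is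
    -- non-negative.
    by_contra hBs
    exact hs.not_ge (hZ hBs).2.meromorphicOrderAt_nonneg
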